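/- Write $\Delta=-\partial_{xx}-\partial_{yy}$ on $\mathbb R^2$, $B_r(0)$ for the disc of radius $r$ centred at $0$, and identify radially symmetric functions with functions of $r=|x|\ge 0$; a prime denotes $d/dr$. Fix $p\in(1,2]$ and $h_0>0$. Let $T_0(r)=\ln(1+r^2)$, $$w_0(r)=-T_0(r)+\frac{2r^2}{1+r^2}-\frac12T_0(r)^2+\frac{1-r^2}{1+r^2}\int_1^{1+r^2}\frac{\ln t}{1-t}\,dt,$$ $$F=2(p-1)w_0+(p-2)T_0^2-8(p-1)T_0w_0-\frac{8p-10}{3}T_0^3+4(p-1)w_0^2+4(p-1)T_0^2w_0+(p-1)T_0^4 .$$ Then $w_0$ is the unique radially symmetric $C^2$ solution of $\Delta w_0=4e^{-2T_0}(2w_0+T_0^2-T_0)$ in $\mathbb R^2$, $w_0(0)=0$, and there is a unique radially symmetric $C^2$ function $w_1$ with $\Delta w_1=4e^{-2T_0}\big(2w_1+\frac{4(p-1)}{p^3}F\big)$ in $\mathbb R^2$, $w_1(0)=0$. Let $\mu_\gamma,\bar r_\gamma>0$ and $\lambda_\gamma$ be families of real numbers, indexed by large $\gamma>0$, such that, with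 $t_\gamma(r)=\ln(1+r^2/\mu_\gamma^2)$, $$\lambda_\gamma p^2\gamma^{2(p-1)}\mu_\gamma^2e^{\gamma^p}=8,\qquad t_\gamma(\bar r_\gamma)\le\sqrt\gamma\qquad\text{for all large }\gamma,$$ $$\mu_\gamma/\bar r_\gamma\to0,\qquad \gamma^{4p}\bar r_\gamma^2=O(1)\qquad\text{as }\gamma\to+\infty .$$ Consider positive, radially symmetric $C^2$ solutions $B_\gamma$, in a disc centred at $0$, of $$\Delta B_\gamma+h_0B_\gamma=\lambda_\gamma p\,B_\gamma^{p-1}e^{B_\gamma^p},\qquad B_\gamma(0)=\gamma .\qquad(\ast)$$ For all large $\gamma$ there is such a solution in a disc of radius larger than $\bar r_\gamma$, and any two such solutions agree on the smaller of their discs. Let $B_\gamma$ be this solution and define $w_\gamma$ by $$B_\gamma=\gamma-\frac{2t_\gamma}{p\gamma^{p-1}}+\frac{4(p-1)}{p^2\gamma^{2p-1}}w_{0,\gamma}+\frac{w_{1,\gamma}+w_\gamma}{\gamma^{3p-1}},\qquad w_{i,\gamma}=w_i(\cdot/\mu_\gamma).$$ (1) Uniformly in $[0,\bar r_\gamma]$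 as $\gamma\to+\infty$: $w_\gamma=O(\gamma^{-p}t_\gamma)$, $w_\gamma'=O(\gamma^{-p}t_\gamma')$, and $$\lambda_\gamma pB_\gamma^{p-1}e^{B_\gamma^p}=-\frac{2}{p\gamma^{p-1}}\Delta t_\gamma\Big(1+O\Big(\frac{e^{t_\gamma/2}}{\gamma^{3p}}\Big)\Big)+\frac{4(p-1)}{p^2\gamma^{2p-1}}\Delta w_{0,\gamma}+\frac{\Delta w_{1,\gamma}}{\gamma^{3p-1}} .$$ (2) If in addition $t_\gamma(\bar r_\gamma)=\sqrt\gamma$ for all large $\gamma$, then, as $\gamma\to+\infty$, the quantities $$M_\gamma=\frac{\lambda_\gamma p^2}{2}\int_{B_{\bar r_\gamma}(0)}B_\gamma^pe^{B_\gamma^p}\,dx,\qquad N_\gamma=\frac{\lambda_\gamma p^2}{2}\int_{B_{\bar r_\gamma}(0)}e^{B_\gamma^p}\,dx$$ satisfy $$M_\gamma=4\pi\gamma^{2-p}\Big[1+\frac{2(p-2)}{p\gamma^p}+\frac{p-1}{p^2\gamma^{2p}}\Big(-8-\frac{2\pi^2}{3}+2(p-1)\Big(\frac{\pi^2}{3}+\frac{33}{2}\Big)+3(p-2)-7(4p-5)\Big)+o(\gamma^{-2p})\Big],$$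 $$N_\gamma=\frac{4\pi}{\gamma^{2(p-1)}}\Big[1+\frac{4(p-1)}{p\gamma^p}+\frac1{\gamma^{2p}}\Big(\frac{2(p-1)}{p^2}\Big((p-1)\Big(\frac{\pi^2}{3}+\frac{33}{2}\Big)+\frac32(p-2)-\frac{7(4p-5)}{2}\Big)+\frac{4(p-1)}{p}+\frac{(p-1)^2}{p^2}\Big(8+\frac{2\pi^2}{3}\Big)\Big)+o(\gamma^{-2p})\Big],$$ $$N_\gamma^{\frac{2-p}{p}}\,M_\gamma^{\frac{2(p-1)}{p}}=4\pi\Big(1+\frac{4(p-1)}{p^2\gamma^{2p}}+o(\gamma^{-2p})\Big).$$ -/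

import Mathlib

open Filter Topology Asymptotics

noncomputable section

namespace RadialBubble

/-- The Euclidean plane. -/
abbrev Plane : Type := EuclideanSpace ℝ (Fin 2)

/-- The radially symmetric function `x ↦ f |x|` on the plane with radial profile `f`. -/
def radial (f : ℝ → ℝ) : Plane → ℝ := fun x => f ‖x‖

/-- The Laplace operator with the geometers' sign, `-∂ₓₓ - ∂ᵧᵧ`, applied to the radially symmetric
function with profile `f`. -/
def lap (f : ℝ → ℝ) (x : Plane) : ℝ := -(Laplacian.laplacian (radial f) x)

/-- The derivative `d/dr` of a radial profile on `[0, ∞)` (one-sided at `r = 0`). -/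
def radialDeriv (f : ℝ → ℝ) (r : ℝ) : ℝ := derivWithin f (Set.Ici 0) r

/-- `T₀(r) = log (1 + r²)`. -/
def T₀ (r : ℝ) : ℝ := Real.log (1 + r ^ 2)

/-- `t(r) = log (1 + r² / μ²)`. -/
def tlog (μ r : ℝ) : ℝ := Real.log (1 + r ^ 2 / μ ^ 2)

/-- The first correction profile, in closed form. -/
def w₀ (r : ℝ) : ℝ :=
  -T₀ r + 2 * r ^ 2 / (1 + r ^ 2) - 1 / 2 * T₀ r ^ 2
    + (1 - r ^ 2) / (1 + r ^ 2) * ∫ t in (1 : ℝ)..(1 + r ^ 2), Real.log t / (1 - t)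

/-- The source term in the equation for the second correction profile. -/
def F (p r : ℝ) : ℝ :=
  2 * (p - 1) * w₀ r + (p - 2) * T₀ r ^ 2 - 8 * (p - 1) * T₀ r * w₀ r
    - (8 * p - 10) / 3 * T₀ r ^ 3
    + 4 * (p - 1) * w₀ r ^ 2 + 4 * (p - 1) * T₀ r ^ 2 * w₀ r + (p - 1) * T₀ r ^ 4

/-- `w` is the profile of a radially symmetric `C²` solution on the whole plane of
`Δ w = 4 e^{-2 T₀} (2 w + G)`, `w(0) = 0`. -/
structure IsProfile (G w : ℝ → ℝ) : Prop where
  contDiff : ContDiff ℝ 2 (radial w)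
  zero : w 0 = 0
  eqn : ∀ x : Plane, lap w x = 4 * Real.exp (-2 * T₀ ‖x‖) * (2 * w ‖x‖ + G ‖x‖)

/-- `w` is the unique radial solution of `Δ w = 4 e^{-2 T₀} (2 w + G)`, `w(0) = 0`; profiles are
compared on `[0, ∞)`, where they carry information. -/
def IsUniqueProfile (G w : ℝ → ℝ) : Prop :=
  IsProfile G w ∧ ∀ v : ℝ → ℝ, IsProfile G v → Set.EqOn v w (Set.Ici 0)

/-- `b` is the profile of a radially symmetric, positive `C²` solution in the open disc of radius
`R > 0` of `Δ B + h₀ B = lam p B^{p-1} e^{B^p}`, with `B(0) = γ`. -/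
structure IsBubble (p h₀ lam γ R : ℝ) (b : ℝ → ℝ) : Prop where
  radius_pos : 0 < R
  contDiffOn : ContDiffOn ℝ 2 (radial b) (Metric.ball 0 R)
  center : b 0 = γ
  pos : ∀ x ∈ Metric.ball (0 : Plane) R, 0 < b ‖x‖
  eqn : ∀ x ∈ Metric.ball (0 : Plane) R,
    lap b x + h₀ * b ‖x‖ = lam * p * b ‖x‖ ^ (p - 1) * Real.exp (b ‖x‖ ^ p)

/-- The remainder `w` defined by
`b = γ - 2 t / (p γ^{p-1}) + 4 (p-1) w₀(·/μ) / (p² γ^{2p-1}) + (w₁(·/μ) + w) / γ^{3p-1}`. -/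
def remainder (p : ℝ) (w₁ : ℝ → ℝ) (γ μ : ℝ) (b : ℝ → ℝ) (r : ℝ) : ℝ :=
  γ ^ (3 * p - 1) * (b r - (γ - 2 * tlog μ r / (p * γ ^ (p - 1))
    + 4 * (p - 1) * w₀ (r / μ) / (p ^ 2 * γ ^ (2 * p - 1)))) - w₁ (r / μ)

/-- `(lam p² / 2) ∫ B^p e^{B^p}` over the disc of radius `r`. -/
def weightedMass (p lam : ℝ) (b : ℝ → ℝ) (r : ℝ) : ℝ :=
  lam * p ^ 2 / 2 * ∫ x in Metric.ball (0 : Plane) r, b ‖x‖ ^ p * Real.exp (b ‖x‖ ^ p)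

/-- `(lam p² / 2) ∫ e^{B^p}` over the disc of radius `r`. -/
def mass (p lam : ℝ) (b : ℝ → ℝ) (r : ℝ) : ℝ :=
  lam * p ^ 2 / 2 * ∫ x in Metric.ball (0 : Plane) r, Real.exp (b ‖x‖ ^ p)

end RadialBubble

end

open RadialBubble

noncomputable section

namespace RadialBubble

/-! In the variable `ρ = |x|² / μ²` a radial function `g` satisfies `Δ g = -(4/μ²) (ρ g')'`, so
every equation here becomes a singular initial value problem for the flux `ρ g'`, encoded by
`FluxSol`. Write `ε = γ^(-p)` and `L = log (1 + ρ)`. The normalisation of `λ` turns the nonlinearity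
into a constant times `Phi / (1 + ρ)²`. Expanding `Phi` to second order in `ε` (`Phi_expansion`,
`exists_uniform_expansion`), the three orders reproduce the Liouville equation solved by `L` and the
equations of `w₀` and `w₁`. For the remainder this leaves `(ρ w')' = -2 w / (1 + ρ)² + O(ε (1 +
ρ)^(-3/2))` plus the `h₀` term, which `γ^(4p) r̄² = O(1)` makes small enough (`defect_eq`).

The analytic core is `FluxSol.bound`: a solution of such an inequality vanishing at the centre is
`O(ε) log (1 + ρ)`, with derivative `O(ε) / (1 + ρ)`. To get existence, the equation is solved with
the remainder truncated to `[-1, 1]`, which makes it globally Lipschitz. The bound then gives `|w| ≤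
1` for large `γ`, because `ε √γ → 0`, so the truncation is inactive (`exists_remainder`). Uniqueness
(`IsBubble.eqOn`) transfers the estimates to an arbitrary solution.

Both masses are, up to explicit factors, integrals of `Phi / (1 + ρ)²`, with prefactor exponent `q =
p` or `q = 0`. The expansion is integrated term by term; cutting at `r̄` costs `e^(-√γ/2)`, smaller
than any power of `γ`. The coefficients come from explicit antiderivatives. The number `π²` enters
through Landen's identity for the dilogarithm (`dil_add_log_sq`). No formula for `w₁` is needed:
testing its equation against `1/(1 + ρ)` trades its integral for one of `F`
(`hasImproperIntegral_second_profile`), and a second identity evaluates that together with the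
square of `2 w₀ + T₀²` (`hasImproperIntegral_quadratic`). In the product of powers of the masses,
the powers of `γ` and the first order terms cancel. -/

/-! ### Radial functions on the plane in flux form -/

/-- `g` solves `(ρ g')' = q` on `(-a, ∞)`, with derivative `A`; in the variable `ρ = |x|²` this is
the radial Poisson equation `Δ g = -4 q`. -/
structure FluxSol (a : ℝ) (g A q : ℝ → ℝ) : Prop where
  deriv : ∀ ρ, -a < ρ → HasDerivAt g (A ρ) ρ
  flux : ∀ ρ, -a < ρ → HasDerivAt (fun σ => σ * A σ) (q ρ) ρ
  cont : ∀ ρ, -a < ρ → ContinuousAt A ρ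
  cont_src : ∀ ρ, -a < ρ → ContinuousAt q ρ

theorem FluxSol.add {a : ℝ} {g A q g' A' q' : ℝ → ℝ} (h : FluxSol a g A q)
    (h' : FluxSol a g' A' q') :
    FluxSol a (fun ρ => g ρ + g' ρ) (fun ρ => A ρ + A' ρ) (fun ρ => q ρ + q' ρ) where
  deriv ρ hρ := (h.deriv ρ hρ).add (h'.deriv ρ hρ)
  flux ρ hρ := by
    have := (h.flux ρ hρ).add (h'.flux ρ hρ)
    refine this.congr_of_eventuallyEq (Eventually.of_forall fun σ => ?_)
    simp [mul_add]
  cont ρ hρ := (h.cont ρ hρ).add (h'.cont ρ hρ)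
  cont_src ρ hρ := (h.cont_src ρ hρ).add (h'.cont_src ρ hρ)

theorem FluxSol.const_mul {a : ℝ} {g A q : ℝ → ℝ} (h : FluxSol a g A q) (c : ℝ) :
    FluxSol a (fun ρ => c * g ρ) (fun ρ => c * A ρ) (fun ρ => c * q ρ) where
  deriv ρ hρ := (h.deriv ρ hρ).const_mul c
  flux ρ hρ := by
    have := (h.flux ρ hρ).const_mul c
    refine this.congr_of_eventuallyEq (Eventually.of_forall fun σ => ?_)
    simp only; ring
  cont ρ hρ := (h.cont ρ hρ).const_mul c
  cont_src ρ hρ := (h.cont_src ρ hρ).const_mul c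

theorem FluxSol.const (a c : ℝ) : FluxSol a (fun _ => c) (fun _ => 0) (fun _ => 0) where
  deriv ρ _ := hasDerivAt_const ρ c
  flux ρ _ := by simpa using hasDerivAt_const ρ (0 : ℝ)
  cont ρ _ := continuousAt_const
  cont_src ρ _ := continuousAt_const

/-- The flux form is invariant under dilation of `ρ`; with `κ = 1/μ²` this passes from `|x|² / μ²`
back to `|x|²`. -/
theorem FluxSol.comp_mul {a : ℝ} {g A q : ℝ → ℝ} (h : FluxSol a g A q) {κ : ℝ} (hκ : 0 < κ) :
    FluxSol (a / κ) (fun ρ => g (κ * ρ)) (fun ρ => κ * A (κ * ρ)) (fun ρ => κ * q (κ * ρ)) := by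
  have key : ∀ ρ, -(a / κ) < ρ → -a < κ * ρ := fun ρ hρ => by
    rw [← neg_div, div_lt_iff₀ hκ] at hρ; linarith
  have hd : ∀ ρ, HasDerivAt (fun σ : ℝ => κ * σ) κ ρ := fun ρ => by
    simpa using (hasDerivAt_id ρ).const_mul κ
  have hc : ∀ ρ, ContinuousAt (fun σ : ℝ => κ * σ) ρ := fun ρ => (hd ρ).continuousAt
  refine ⟨fun ρ hρ => ?_, fun ρ hρ => ?_, fun ρ hρ => ?_, fun ρ hρ => ?_⟩
  · have := (h.deriv _ (key ρ hρ)).comp ρ (hd ρ)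
    rw [mul_comm] at this; exact this
  · have := (h.flux _ (key ρ hρ)).comp ρ (hd ρ)
    rw [mul_comm] at this
    refine this.congr_of_eventuallyEq (Eventually.of_forall fun σ => ?_)
    simp only [Function.comp]; ring
  · exact ((h.cont _ (key ρ hρ)).comp (f := fun σ : ℝ => κ * σ) (hc ρ)).const_mul κ
  · exact ((h.cont_src _ (key ρ hρ)).comp (f := fun σ : ℝ => κ * σ) (hc ρ)).const_mul κ

theorem FluxSol.hasDerivAt_A {a : ℝ} {g A q : ℝ → ℝ} (h : FluxSol a g A q) {ρ : ℝ} (hρ : -a < ρ)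
    (h0 : ρ ≠ 0) : HasDerivAt A ((q ρ - A ρ) / ρ) ρ := by
  have h1 := (h.flux ρ hρ).mul (hasDerivAt_inv h0)
  have h2 : HasDerivAt A (q ρ * ρ⁻¹ + ρ * A ρ * -(ρ ^ 2)⁻¹) ρ := by
    refine h1.congr_of_eventuallyEq ?_
    filter_upwards [eventually_ne_nhds h0] with σ hσ
    simp only [Pi.mul_apply]; field_simp
  convert h2 using 1
  field_simp
  ring

/-- The difference quotient of `σ A(σ)` at `0` is `A(σ)` itself, so continuity of `A` suffices. This
compatibility makes the Hessian of the radial function extend continuously over the centre. -/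
theorem FluxSol.src_zero {a : ℝ} {g A q : ℝ → ℝ} (h : FluxSol a g A q) (ha : 0 < a) :
    q 0 = A 0 := by
  have h0 : -a < 0 := by linarith
  have h1 : HasDerivAt (fun σ => σ * A σ) (A 0) 0 := by
    rw [hasDerivAt_iff_tendsto_slope]
    refine ((h.cont 0 h0).tendsto.mono_left nhdsWithin_le_nhds).congr' ?_
    filter_upwards [self_mem_nhdsWithin] with σ hσ
    have : σ ≠ 0 := hσ
    simp [slope_def_field]; field_simp
  exact (h.flux 0 h0).unique h1

/-- If the gradient of `u` is `2 v`, the Laplacian of `u` is twice the trace of the derivative of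
`v`. -/
theorem laplacian_of_gradient {u : Plane → ℝ} {v : Plane → Plane} {x : Plane}
    {V : Plane →L[ℝ] Plane}
    (h1 : ∀ᶠ y in 𝓝 x, HasFDerivAt u ((2 : ℝ) • innerSL ℝ (v y)) y) (h2 : HasFDerivAt v V x) :
    Laplacian.laplacian u x = 2 * (V (EuclideanSpace.single 0 1) 0
      + V (EuclideanSpace.single 1 1) 1) := by
  rw [InnerProductSpace.laplacian_eq_iteratedFDeriv_orthonormalBasis u
    (EuclideanSpace.basisFun (Fin 2) ℝ)]
  have h3 : HasFDerivAt (fderiv ℝ u) ((2 : ℝ) • ((innerSL ℝ : Plane →L[ℝ] _).comp V)) x := by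
    have : HasFDerivAt (fun y => (2 : ℝ) • innerSL ℝ (v y))
        ((2 : ℝ) • ((innerSL ℝ : Plane →L[ℝ] _).comp V)) x :=
      (((innerSL ℝ : Plane →L[ℝ] _).hasFDerivAt).comp x h2).const_smul (2 : ℝ)
    refine this.congr_of_eventuallyEq ?_
    filter_upwards [h1] with y hy using hy.fderiv
  simp only [iteratedFDeriv_two_apply, h3.fderiv, Fin.sum_univ_two]
  simp [EuclideanSpace.inner_single_right]
  ring

/-- The derivative of `x ↦ A(|x|²) x`. -/
def radialHess (A q : ℝ → ℝ) (x : Plane) : Plane →L[ℝ] Plane :=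
  A (‖x‖ ^ 2) • ContinuousLinearMap.id ℝ Plane
    + (2 * (q (‖x‖ ^ 2) - A (‖x‖ ^ 2)) / ‖x‖ ^ 2) • (innerSL ℝ x).smulRight x

theorem hasFDerivAt_comp_norm_sq {g : ℝ → ℝ} {x : Plane} {c : ℝ}
    (h : HasDerivAt g c (‖x‖ ^ 2)) :
    HasFDerivAt (fun y : Plane => g (‖y‖ ^ 2)) ((2 : ℝ) • innerSL ℝ (c • x)) x := by
  have h1 := (hasStrictFDerivAt_norm_sq x).hasFDerivAt
  have h2 := h.comp_hasFDerivAt x h1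
  refine h2.congr_fderiv ?_
  ext y
  simp
  ring

theorem hasFDerivAt_radial_field {A : ℝ → ℝ} {x : Plane} {c : ℝ} 
    (h : HasDerivAt A c (‖x‖ ^ 2)) :
    HasFDerivAt (fun y : Plane => A (‖y‖ ^ 2) • y)
      (A (‖x‖ ^ 2) • ContinuousLinearMap.id ℝ Plane + (2 * c) • (innerSL ℝ x).smulRight x) x := by
  have h1 := (hasFDerivAt_comp_norm_sq h).smul (hasFDerivAt_id x)
  refine h1.congr_fderiv ?_
  ext y
  simp
  ring

theorem FluxSol.hasFDerivAt_field {a : ℝ} {g A q : ℝ → ℝ} (h : FluxSol a g A q) (ha : 0 < a)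
    (x : Plane) : HasFDerivAt (fun y : Plane => A (‖y‖ ^ 2) • y) (radialHess A q x) x := by
  by_cases hx : x = 0
  · subst hx
    have : radialHess A q 0 = A 0 • ContinuousLinearMap.id ℝ Plane := by simp [radialHess]
    rw [this, hasFDerivAt_iff_isLittleO]
    -- At the centre no derivative of `A` is needed: the increment differs from its linear part by
    -- `(A(|y|²) - A 0) y`, which is `o(|y|)` by continuity alone.
    have hA : Tendsto (fun y : Plane => A (‖y‖ ^ 2) - A 0) (𝓝 0) (𝓝 0) := by
      have hc : ContinuousAt (fun y : Plane => A (‖y‖ ^ 2)) 0 := by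
        refine ContinuousAt.comp (f := fun y : Plane => ‖y‖ ^ 2) (g := A) ?_ (by fun_prop)
        simpa using h.cont 0 (by linarith)
      have := hc.tendsto.sub_const (A 0)
      simpa using this
    have h2 := ((isLittleO_one_iff ℝ).2 hA).smul_isBigO (isBigO_refl (fun y : Plane => y) (𝓝 0))
    have h3 : (fun y : Plane => A (‖y‖ ^ 2) • y - A (‖(0 : Plane)‖ ^ 2) • (0 : Plane)
        - (A 0 • ContinuousLinearMap.id ℝ Plane) (y - 0))
        = fun y => (A (‖y‖ ^ 2) - A 0) • y := by
      ext1 y; simp [sub_smul]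
    rw [h3]
    simpa using h2
  · have hx' : ‖x‖ ^ 2 ≠ 0 := by simpa using hx
    have := hasFDerivAt_radial_field (h.hasDerivAt_A (ρ := ‖x‖ ^ 2)
      (by nlinarith [sq_nonneg ‖x‖]) hx')
    refine this.congr_fderiv ?_
    simp [radialHess, mul_div_assoc]

/-- Only the origin is in doubt. There the rank-one part has norm at most `2 |q - A|` evaluated at
`|y|²`, which tends to `0` because `q 0 = A 0`. -/
theorem FluxSol.continuous_hess {a : ℝ} {g A q : ℝ → ℝ} (h : FluxSol a g A q) (ha : 0 < a) :
    Continuous (radialHess A q) := by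
  have hdom : ∀ x : Plane, -a < ‖x‖ ^ 2 := fun x => by nlinarith [sq_nonneg ‖x‖]
  have cA : Continuous fun y : Plane => A (‖y‖ ^ 2) := continuous_iff_continuousAt.2 fun x =>
    ContinuousAt.comp (f := fun y : Plane => ‖y‖ ^ 2) (h.cont _ (hdom x)) (by fun_prop)
  have cq : Continuous fun y : Plane => q (‖y‖ ^ 2) := continuous_iff_continuousAt.2 fun x =>
    ContinuousAt.comp (f := fun y : Plane => ‖y‖ ^ 2) (h.cont_src _ (hdom x)) (by fun_prop)
  refine Continuous.add (cA.smul continuous_const) ?_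
  rw [continuous_iff_continuousAt]
  intro x
  by_cases hx : x = 0
  · subst hx
    have h0 : Tendsto (fun y : Plane => 2 * |q (‖y‖ ^ 2) - A (‖y‖ ^ 2)|) (𝓝 0) (𝓝 0) := by
      have : ContinuousAt (fun y : Plane => 2 * |q (‖y‖ ^ 2) - A (‖y‖ ^ 2)|) 0 :=
        ((cq.sub cA).abs.const_mul 2).continuousAt
      simpa [ContinuousAt, h.src_zero ha] using this
    have h1 : (2 * (q (‖(0 : Plane)‖ ^ 2) - A (‖(0 : Plane)‖ ^ 2)) / ‖(0 : Plane)‖ ^ 2) •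
        (innerSL ℝ (0 : Plane)).smulRight (0 : Plane) = 0 := by simp
    rw [ContinuousAt, h1]
    refine squeeze_zero_norm (fun y => ?_) h0
    rw [norm_smul, ContinuousLinearMap.norm_smulRight_apply, innerSL_apply_norm, norm_div,
      norm_mul, Real.norm_eq_abs, Real.norm_eq_abs, Real.norm_eq_abs, abs_two,
      abs_of_nonneg (sq_nonneg ‖y‖), ← sq]
    by_cases hy : ‖y‖ ^ 2 = 0
    · rw [hy]; simp
    · rw [div_mul_cancel₀ _ hy]
  · have hx' : ‖x‖ ^ 2 ≠ 0 := by simpa using hx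
    refine ContinuousAt.fun_smul ?_ ?_
    · refine ContinuousAt.div ?_ (by fun_prop) hx'
      exact ((cq.sub cA).const_mul 2).continuousAt
    · have : Continuous fun y : Plane =>
          ContinuousLinearMap.smulRightL ℝ Plane Plane (innerSL ℝ y) y := by fun_prop
      exact this.continuousAt

theorem FluxSol.hasFDerivAt {a : ℝ} {g A q : ℝ → ℝ} (h : FluxSol a g A q) (ha : 0 < a)
    (x : Plane) : HasFDerivAt (radial fun r => g (r ^ 2))
      ((2 : ℝ) • innerSL ℝ (A (‖x‖ ^ 2) • x)) x :=
  hasFDerivAt_comp_norm_sq (h.deriv _ (by nlinarith [sq_nonneg ‖x‖]))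

theorem FluxSol.contDiff {a : ℝ} {g A q : ℝ → ℝ} (h : FluxSol a g A q) (ha : 0 < a) :
    ContDiff ℝ 2 (radial fun r => g (r ^ 2)) := by
  have h1 : fderiv ℝ (radial fun r => g (r ^ 2))
      = fun x => (2 : ℝ) • innerSL ℝ (A (‖x‖ ^ 2) • x) :=
    funext fun x => (h.hasFDerivAt ha x).fderiv
  rw [show (2 : WithTop ℕ∞) = 1 + 1 by norm_num, contDiff_succ_iff_fderiv]
  refine ⟨fun x => (h.hasFDerivAt ha x).differentiableAt, by simp, ?_⟩
  rw [h1]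
  have h2 : ContDiff ℝ 1 (fun x : Plane => A (‖x‖ ^ 2) • x) := by
    rw [contDiff_one_iff_fderiv]
    refine ⟨fun x => (h.hasFDerivAt_field ha x).differentiableAt, ?_⟩
    rw [show fderiv ℝ (fun y : Plane => A (‖y‖ ^ 2) • y) = radialHess A q from
      funext fun x => (h.hasFDerivAt_field ha x).fderiv]
    exact h.continuous_hess ha
  exact ((innerSL ℝ : Plane →L[ℝ] Plane →L[ℝ] ℝ).contDiff.comp h2).const_smul (2 : ℝ)

theorem trace_radialHess {A q : ℝ → ℝ} {x : Plane} (h0 : x = 0 → q 0 = A 0) :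
    2 * (radialHess A q x (EuclideanSpace.single 0 1) 0
      + radialHess A q x (EuclideanSpace.single 1 1) 1) = 4 * q (‖x‖ ^ 2) := by
  have hn : ‖x‖ ^ 2 = x 0 ^ 2 + x 1 ^ 2 := by
    rw [EuclideanSpace.norm_sq_eq]; simp [Fin.sum_univ_two]
  by_cases hx : ‖x‖ ^ 2 = 0
  · have : x = 0 := by simpa using hx
    subst this
    simp [radialHess, h0 rfl]; ring
  · simp [radialHess, EuclideanSpace.inner_single_right]
    have h1 : ‖x‖ ≠ 0 := fun h => hx (by rw [h]; norm_num)
    field_simp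
    rw [hn]
    ring

theorem FluxSol.lap_eq {a : ℝ} {g A q : ℝ → ℝ} (h : FluxSol a g A q) (ha : 0 < a) (x : Plane) :
    lap (fun r => g (r ^ 2)) x = -4 * q (‖x‖ ^ 2) := by
  rw [lap, laplacian_of_gradient (Eventually.of_forall fun y => h.hasFDerivAt ha y)
    (h.hasFDerivAt_field ha x), trace_radialHess fun _ => h.src_zero ha]
  ring

/-- A `C²` radial function, written in the variable `ρ = |x|²`, has the flux form of the Laplacian
away from the centre, and no flux at the centre. -/
theorem exists_flux_of_contDiffOn {f : ℝ → ℝ} {R : ℝ} (hR : 0 < R)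
    (hf : ContDiffOn ℝ 2 (radial f) (Metric.ball 0 R)) :
    ∃ A q : ℝ → ℝ, ContinuousOn (fun ρ => f (√ρ)) (Set.Ico 0 (R ^ 2)) ∧
      ContinuousOn (fun ρ => ρ * A ρ) (Set.Ico 0 (R ^ 2)) ∧
      (∀ ρ ∈ Set.Ioo 0 (R ^ 2), HasDerivAt (fun σ => f (√σ)) (A ρ) ρ ∧
        HasDerivAt (fun σ => σ * A σ) (q ρ) ρ) ∧
      ∀ x ∈ Metric.ball (0 : Plane) R, x ≠ 0 → lap f x = -4 * q (‖x‖ ^ 2) := by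
  set e : Plane := EuclideanSpace.single 0 1 with he
  have hne : ‖e‖ = 1 := by simp [he]
  -- The profile `f` is unconstrained at negative arguments, so it is replaced by the restriction of
  -- the plane function to a line through the origin, which is `C²` across `0`.
  set φ : ℝ → ℝ := fun t => radial f (t • e) with hφ
  have hφC : ContDiffOn ℝ 2 φ (Set.Ioo (-R) R) := by
    refine hf.comp (t := Metric.ball 0 R) (f := fun t : ℝ => t • e)
      (contDiff_id.smul contDiff_const).contDiffOn ?_
    intro t ht
    simp [norm_smul, hne, abs_lt.2 ⟨ht.1, ht.2⟩]
  have hφf : ∀ t, 0 ≤ t → φ t = f t := fun t ht => by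
    simp [hφ, radial, norm_smul, hne, abs_of_nonneg ht]
  have hop : IsOpen (Set.Ioo (-R) R) := isOpen_Ioo
  have hd1 : ContDiffOn ℝ 1 (deriv φ) (Set.Ioo (-R) R) :=
    ((contDiffOn_succ_iff_deriv_of_isOpen (n := 1) hop).1 hφC).2.2
  have hd2 : ∀ t ∈ Set.Ioo (-R) R, HasDerivAt φ (deriv φ t) t := fun t ht =>
    ((hφC.differentiableOn (by norm_num)).differentiableAt (hop.mem_nhds ht)).hasDerivAt
  have hd3 : ∀ t ∈ Set.Ioo (-R) R, HasDerivAt (deriv φ) (deriv (deriv φ) t) t := fun t ht =>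
    ((hd1.differentiableOn (by norm_num)).differentiableAt (hop.mem_nhds ht)).hasDerivAt
  have hsq : ∀ ρ ∈ Set.Ico 0 (R ^ 2), √ρ ∈ Set.Ioo (-R) R := fun ρ hρ =>
    ⟨by linarith [Real.sqrt_nonneg ρ], (Real.sqrt_lt' hR).2 hρ.2⟩
  set A : ℝ → ℝ := fun ρ => deriv φ (√ρ) / (2 * √ρ) with hA
  have hg : ∀ ρ ∈ Set.Ioo 0 (R ^ 2), HasDerivAt (fun σ => f (√σ)) (A ρ) ρ := fun ρ hρ => by
    have h1 := (hd2 _ (hsq ρ ⟨hρ.1.le, hρ.2⟩)).comp ρ (Real.hasDerivAt_sqrt hρ.1.ne')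
    refine (h1.congr_of_eventuallyEq (Eventually.of_forall fun σ => ?_)).congr_deriv ?_
    · simp [Function.comp, hφf _ (Real.sqrt_nonneg σ)]
    · simp [hA]; ring
  -- In this form the flux is visibly continuous up to `ρ = 0`, although `A` involves division by
  -- `√ρ`.
  have hA2 : ∀ ρ, ρ * A ρ = √ρ * deriv φ (√ρ) / 2 ∨ ρ < 0 := fun ρ => by
    rcases lt_trichotomy ρ 0 with h | h | h
    · exact Or.inr h
    · subst h; left; simp
    · left
      have h1 : 0 < √ρ := Real.sqrt_pos.2 h
      have h2 : ρ = √ρ * √ρ := (Real.mul_self_sqrt h.le).symm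
      simp only [hA]
      conv_lhs => rw [h2]
      rw [Real.sqrt_mul_self h1.le]
      field_simp
  -- With `r = √ρ` the value is a quarter of the polar expression `φ'' + φ'/r`.
  have hq : ∀ ρ ∈ Set.Ioo 0 (R ^ 2), HasDerivAt (fun σ => σ * A σ)
      ((deriv φ (√ρ) / √ρ + deriv (deriv φ) (√ρ)) / 4) ρ := fun ρ hρ => by
    have hs : 0 < √ρ := Real.sqrt_pos.2 hρ.1
    have hsd := Real.hasDerivAt_sqrt hρ.1.ne'
    have h1 := (hsd.mul ((hd3 _ (hsq ρ ⟨hρ.1.le, hρ.2⟩)).comp ρ hsd)).div_const 2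
    refine (h1.congr_of_eventuallyEq ?_).congr_deriv ?_
    · filter_upwards [lt_mem_nhds hρ.1] with σ hσ
      rcases hA2 σ with h | h
      · simpa using h
      · linarith
    · simp only [Function.comp]
      field_simp
      ring
  refine ⟨A, fun ρ => (deriv φ (√ρ) / √ρ + deriv (deriv φ) (√ρ)) / 4, ?_, ?_,
    fun ρ hρ => ⟨hg ρ hρ, hq ρ hρ⟩, ?_⟩
  · have : ContinuousOn (fun ρ => φ (√ρ)) (Set.Ico 0 (R ^ 2)) :=
      hφC.continuousOn.comp Real.continuous_sqrt.continuousOn hsq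
    exact this.congr fun ρ _ => (hφf _ (Real.sqrt_nonneg ρ)).symm
  · have : ContinuousOn (fun ρ => √ρ * deriv φ (√ρ) / 2) (Set.Ico 0 (R ^ 2)) :=
      (Real.continuous_sqrt.continuousOn.mul
        (hd1.continuousOn.comp Real.continuous_sqrt.continuousOn hsq)).div_const 2
    refine this.congr fun ρ hρ => ?_
    rcases hA2 ρ with h | h
    · exact h
    · exact absurd hρ.1 (not_le.2 h)
  · intro x hx hx0
    have hdom : ∀ y : Plane, y ∈ Metric.ball (0 : Plane) R → y ≠ 0 →
        ‖y‖ ^ 2 ∈ Set.Ioo 0 (R ^ 2) := fun y hy hy0 => by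
      have h1 : 0 < ‖y‖ := norm_pos_iff.2 hy0
      have h2 : ‖y‖ < R := by simpa using hy
      exact ⟨by positivity, by gcongr⟩
    have hρ := hdom x hx hx0
    have hu : ∀ᶠ y in 𝓝 x, HasFDerivAt (radial f) ((2 : ℝ) • innerSL ℝ (A (‖y‖ ^ 2) • y)) y := by
      filter_upwards [Metric.isOpen_ball.mem_nhds hx, eventually_ne_nhds hx0] with y hy hy0
      have := hasFDerivAt_comp_norm_sq (hg _ (hdom y hy hy0))
      refine this.congr_of_eventuallyEq (Eventually.of_forall fun z => ?_)
      simp [radial]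
    set q : ℝ → ℝ := fun ρ => (deriv φ (√ρ) / √ρ + deriv (deriv φ) (√ρ)) / 4 with hqdef
    have hAd : HasDerivAt A ((q (‖x‖ ^ 2) - A (‖x‖ ^ 2)) / ‖x‖ ^ 2) (‖x‖ ^ 2) := by
      have h1 := (hq _ hρ).mul (hasDerivAt_inv hρ.1.ne')
      refine (h1.congr_of_eventuallyEq ?_).congr_deriv ?_
      · filter_upwards [eventually_ne_nhds hρ.1.ne'] with σ hσ
        simp only [Pi.mul_apply]; field_simp
      · have := hρ.1.ne'
        simp only [hqdef]
        field_simp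
        ring
    have hv : HasFDerivAt (fun y : Plane => A (‖y‖ ^ 2) • y) (radialHess A q x) x := by
      refine (hasFDerivAt_radial_field hAd).congr_fderiv ?_
      simp [radialHess, mul_div_assoc]
    rw [lap, laplacian_of_gradient hu hv, trace_radialHess fun h => absurd h hx0]
    ring

/-! ### The singular initial value problem: comparison, existence, uniqueness -/

-- Both `B - f` and `B + f` are monotone and nonnegative at `0`. All integrations of differential
-- inequalities on the half line below go through this comparison.
open Set in
theorem abs_le_of_abs_deriv_le {f f' B B' : ℝ → ℝ} {b : ℝ} (hf : ContinuousOn f (Icc 0 b))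
    (hB : ContinuousOn B (Icc 0 b)) (hf0 : f 0 = 0) (hB0 : 0 ≤ B 0)
    (hf' : ∀ ρ ∈ Ioo 0 b, HasDerivAt f (f' ρ) ρ) (hB' : ∀ ρ ∈ Ioo 0 b, HasDerivAt B (B' ρ) ρ)
    (h : ∀ ρ ∈ Ioo 0 b, |f' ρ| ≤ B' ρ) : ∀ ρ ∈ Icc 0 b, |f ρ| ≤ B ρ := by
  intro ρ hρ
  have h0 : (0 : ℝ) ∈ Icc 0 b := ⟨le_rfl, hρ.1.trans hρ.2⟩
  have m1 : MonotoneOn (fun ρ => B ρ - f ρ) (Icc 0 b) := by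
    refine monotoneOn_of_hasDerivWithinAt_nonneg (f' := fun ρ => B' ρ - f' ρ) (convex_Icc 0 b)
      (hB.sub hf) (fun x hx => ?_) fun x hx => ?_
    · rw [interior_Icc] at hx
      exact ((hB' x hx).sub (hf' x hx)).hasDerivWithinAt
    · rw [interior_Icc] at hx
      linarith [le_abs_self (f' x), h x hx]
  have m2 : MonotoneOn (fun ρ => B ρ + f ρ) (Icc 0 b) := by
    refine monotoneOn_of_hasDerivWithinAt_nonneg (f' := fun ρ => B' ρ + f' ρ) (convex_Icc 0 b)
      (hB.add hf) (fun x hx => ?_) fun x hx => ?_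
    · rw [interior_Icc] at hx
      exact ((hB' x hx).add (hf' x hx)).hasDerivWithinAt
    · rw [interior_Icc] at hx
      linarith [neg_le_abs (f' x), h x hx]
  have h1 := m1 h0 hρ hρ.1
  have h2 := m2 h0 hρ hρ.1
  simp only [hf0] at h1 h2
  rw [abs_le]
  constructor <;> linarith

/-- The inner average inherits the exponential bound, and the outer integration gains the factor
`1/K`. That gain is what makes the Picard map contract in a weighted norm. -/
theorem abs_integral_average_le {h : ℝ → ℝ} {C K : ℝ} (hC : 0 ≤ C)
    (hK : 0 < K) (hb : ∀ τ, |h τ| ≤ C * Real.exp (K * |τ|)) (ρ : ℝ) :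
    |∫ σ in (0 : ℝ)..ρ, ∫ θ in (0 : ℝ)..1, h (σ * θ)| ≤ C / K * Real.exp (K * |ρ|) := by
  have h1 : ∀ σ, |∫ θ in (0 : ℝ)..1, h (σ * θ)| ≤ C * Real.exp (K * |σ|) := fun σ => by
    have := intervalIntegral.norm_integral_le_of_norm_le_const (a := 0) (b := 1)
      (f := fun θ => h (σ * θ)) (C := C * Real.exp (K * |σ|)) (fun θ hθ => ?_)
    · simpa using this
    · rw [Set.uIoc_of_le zero_le_one] at hθ
      refine (hb _).trans ?_
      rw [abs_mul, abs_of_pos hθ.1]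
      gcongr
      exact mul_le_of_le_one_right (abs_nonneg _) hθ.2
  -- Rescaling the outer integral to `[0, 1]` treats both signs of `ρ` at once.
  have h2 := intervalIntegral.smul_integral_comp_mul_left (a := 0) (b := 1)
    (fun σ => ∫ θ in (0 : ℝ)..1, h (σ * θ)) ρ
  simp only [mul_zero, mul_one] at h2
  rw [← h2, smul_eq_mul, ← intervalIntegral.integral_const_mul]
  have hd : ∀ t ∈ Set.uIcc (0 : ℝ) 1, HasDerivAt (fun t => C / K * Real.exp (K * |ρ| * t))
      (C * |ρ| * Real.exp (K * |ρ| * t)) t := fun t _ => by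
    have := (((hasDerivAt_id t).const_mul (K * |ρ|)).exp).const_mul (C / K)
    refine this.congr_deriv ?_
    simp only [id]
    field_simp
  have h3 := intervalIntegral.integral_eq_sub_of_hasDerivAt hd
    (Continuous.intervalIntegrable (by fun_prop) 0 1)
  have h4 := intervalIntegral.norm_integral_le_of_norm_le (a := 0) (b := 1)
    (μ := MeasureTheory.volume)
    (f := fun t => ρ * ∫ θ in (0 : ℝ)..1, h (ρ * t * θ))
    (g := fun t => C * |ρ| * Real.exp (K * |ρ| * t)) zero_le_one
    (Eventually.of_forall fun t ht => ?_) (Continuous.intervalIntegrable (by fun_prop) 0 1)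
  · rw [h3] at h4
    refine h4.trans ?_
    simp
    positivity
  · rw [Real.norm_eq_abs, abs_mul]
    have := h1 (ρ * t)
    rw [abs_mul, abs_of_pos ht.1] at this
    calc |ρ| * |∫ θ in (0 : ℝ)..1, h (ρ * t * θ)| ≤ |ρ| * (C * Real.exp (K * (|ρ| * t))) := by gcongr
      _ = _ := by ring_nf

theorem continuous_average {h : ℝ → ℝ} (hh : Continuous h) :
    Continuous fun σ : ℝ => ∫ θ in (0 : ℝ)..1, h (σ * θ) := by
  apply intervalIntegral.continuous_parametric_intervalIntegral_of_continuous'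
  fun_prop

/-- The singular initial value problem `(ρ g')' = f(ρ, g)`, `g(0) = 0`, has a global solution when
`f` is Lipschitz in `g`. -/
theorem exists_fluxSol {f : ℝ → ℝ → ℝ} (hf : Continuous (Function.uncurry f)) {L M : ℝ}
    (hL : 0 < L) (hLip : ∀ τ y z, |f τ y - f τ z| ≤ L * |y - z|) (hM : ∀ τ, |f τ 0| ≤ M) :
    ∃ g A : ℝ → ℝ, g 0 = 0 ∧ ∀ a, FluxSol a g A fun ρ => f ρ (g ρ) := by
  have hM0 : 0 ≤ M := (abs_nonneg _).trans (hM 0)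
  -- The unknown is `v = g / E`, a bounded function. The rate `2 L` makes the contraction constant
  -- `L / (2 L) = 1/2`.
  set E : ℝ → ℝ := fun τ => Real.exp (2 * L * |τ|) with hE
  have hEc : Continuous E := by fun_prop
  have hE1 : ∀ τ, 1 ≤ E τ := fun τ => Real.one_le_exp (by positivity)
  let src : BoundedContinuousFunction ℝ ℝ → ℝ → ℝ := fun v τ => f τ (E τ * v τ)
  have hsrc : ∀ v, Continuous (src v) := fun v => by
    have : Continuous fun τ => (τ, E τ * v τ) := by fun_prop
    exact hf.comp this
  -- Integrating `(ρ g')' = src` once gives `g'(σ) = σ⁻¹ ∫₀^σ src`; written as an average over `θ ∈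
  -- [0, 1]` it has no singularity at `0`.
  let I : BoundedContinuousFunction ℝ ℝ → ℝ → ℝ := fun v ρ =>
    ∫ σ in (0 : ℝ)..ρ, ∫ θ in (0 : ℝ)..1, src v (σ * θ)
  have hI : ∀ v ρ, HasDerivAt (I v) (∫ θ in (0 : ℝ)..1, src v (ρ * θ)) ρ := fun v ρ =>
    (continuous_average (hsrc v)).integral_hasStrictDerivAt 0 ρ |>.hasDerivAt
  have hIc : ∀ v, Continuous (I v) := fun v =>
    continuous_iff_continuousAt.2 fun ρ => (hI v ρ).continuousAt
  have hIb : ∀ v ρ, |I v ρ| ≤ (M + L * ‖v‖) / (2 * L) * E ρ := fun v ρ => by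
    refine abs_integral_average_le (by positivity) (by positivity) (fun τ => ?_) ρ
    have h1 := hLip τ (E τ * v τ) 0
    have h2 := hM τ
    have h3 : |v τ| ≤ ‖v‖ := v.norm_coe_le_norm τ
    have h4 : |f τ (E τ * v τ)| ≤ |f τ (E τ * v τ) - f τ 0| + |f τ 0| := by
      simpa using abs_add_le (f τ (E τ * v τ) - f τ 0) (f τ 0)
    rw [sub_zero, abs_mul, abs_of_pos (zero_lt_one.trans_le (hE1 τ))] at h1
    calc |f τ (E τ * v τ)| ≤ L * (E τ * ‖v‖) + M * E τ := by
          refine h4.trans (add_le_add (h1.trans ?_) (h2.trans ?_))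
          · have := hE1 τ
            gcongr
          · exact le_mul_of_one_le_right hM0 (hE1 τ)
      _ = (M + L * ‖v‖) * E τ := by ring
  have hEinv : Continuous fun ρ => (E ρ)⁻¹ :=
    hEc.inv₀ fun τ => by linarith [hE1 τ]
  let T : BoundedContinuousFunction ℝ ℝ → BoundedContinuousFunction ℝ ℝ := fun v =>
    BoundedContinuousFunction.ofNormedAddCommGroup (fun ρ => (E ρ)⁻¹ * I v ρ)
      (hEinv.mul (hIc v)) ((M + L * ‖v‖) / (2 * L)) fun ρ => by
        have := hIb v ρ
        have h1 := hE1 ρ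
        rw [Real.norm_eq_abs, abs_mul, abs_inv, abs_of_pos (by linarith : 0 < E ρ),
          inv_mul_le_iff₀ (by linarith), mul_comm (E ρ)]
        exact this
  have hT : ContractingWith (1 / 2) T := by
    refine ⟨by norm_num, LipschitzWith.of_dist_le_mul fun v w => ?_⟩
    rw [BoundedContinuousFunction.dist_le (by positivity)]
    intro ρ
    have h1 : I v ρ - I w ρ = ∫ σ in (0 : ℝ)..ρ, ∫ θ in (0 : ℝ)..1,
        (src v (σ * θ) - src w (σ * θ)) := by
      rw [← intervalIntegral.integral_sub]
      · refine intervalIntegral.integral_congr fun σ _ => ?_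
        rw [intervalIntegral.integral_sub]
        · exact Continuous.intervalIntegrable ((hsrc v).comp (by fun_prop)) _ _
        · exact Continuous.intervalIntegrable ((hsrc w).comp (by fun_prop)) _ _
      · exact Continuous.intervalIntegrable (continuous_average (hsrc v)) _ _
      · exact Continuous.intervalIntegrable (continuous_average (hsrc w)) _ _
    have h2 : |I v ρ - I w ρ| ≤ (L * dist v w) / (2 * L) * E ρ := by
      rw [h1]
      refine abs_integral_average_le (h := fun τ => src v τ - src w τ) (by positivity)
        (by positivity) (fun τ => ?_) ρ
      refine (hLip τ _ _).trans ?_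
      rw [← mul_sub, abs_mul, abs_of_pos (by linarith [hE1 τ])]
      have h3 : |v τ - w τ| ≤ dist v w := by
        rw [← Real.dist_eq]; exact BoundedContinuousFunction.dist_coe_le_dist τ
      have := hE1 τ
      calc L * (E τ * |v τ - w τ|) ≤ L * (E τ * dist v w) := by gcongr
        _ = _ := by ring
    have h5 := hE1 ρ
    have h6 : T v ρ - T w ρ = (E ρ)⁻¹ * (I v ρ - I w ρ) := by
      simp [T, mul_sub]
    rw [Real.dist_eq, h6, abs_mul, abs_inv, abs_of_pos (by linarith : 0 < E ρ),
      inv_mul_le_iff₀ (by linarith)]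
    refine h2.trans (le_of_eq ?_)
    push_cast
    field_simp
  set v := hT.fixedPoint with hv
  have hfix : T v = v := hT.fixedPoint_isFixedPt
  have hg : ∀ ρ, E ρ * v ρ = I v ρ := fun ρ => by
    have h1 := hE1 ρ
    have h2 : T v ρ = (E ρ)⁻¹ * I v ρ := rfl
    rw [hfix] at h2
    rw [h2, mul_inv_cancel_left₀ (by linarith)]
  have hsv : ∀ ρ, src v ρ = f ρ (I v ρ) := fun ρ => by simp only [src, hg]
  refine ⟨I v, fun ρ => ∫ θ in (0 : ℝ)..1, src v (ρ * θ), by simp [I], fun a =>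
    ⟨fun ρ _ => hI v ρ, fun ρ _ => ?_, fun ρ _ => (continuous_average (hsrc v)).continuousAt,
      fun ρ _ => ?_⟩⟩
  · have h1 : (fun σ : ℝ => σ * ∫ θ in (0 : ℝ)..1, src v (σ * θ))
        = fun σ => ∫ τ in (0 : ℝ)..σ, src v τ := by
      ext σ
      simp
    rw [h1, ← hsv]
    exact ((hsrc v).integral_hasStrictDerivAt 0 ρ).hasDerivAt
  · have := (hsrc v).continuousAt (x := ρ)
    exact this.congr (Eventually.of_forall hsv)

open Set in
/-- Uniqueness for the singular initial value problem. -/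
theorem eqOn_zero_of_flux {d A q : ℝ → ℝ} {b L : ℝ} (hd : ContinuousOn d (Icc 0 b))
    (hd0 : d 0 = 0) (hk : ContinuousOn (fun ρ => ρ * A ρ) (Icc 0 b))
    (h1 : ∀ ρ ∈ Ioo 0 b, HasDerivAt d (A ρ) ρ)
    (h2 : ∀ ρ ∈ Ioo 0 b, HasDerivAt (fun σ => σ * A σ) (q ρ) ρ)
    (hq : ∀ ρ ∈ Ioo 0 b, |q ρ| ≤ L * |d ρ|) : ∀ ρ ∈ Icc 0 b, d ρ = 0 := by
  intro ρ₁ hρ₁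
  obtain ⟨L', hL', hLL'⟩ : ∃ L', 0 < L' ∧ L ≤ L' := ⟨max L 1, by positivity, le_max_left _ _⟩
  set E : ℝ → ℝ := fun ρ => Real.exp (2 * L' * ρ) with hE
  have hEd : ∀ ρ, HasDerivAt E (2 * L' * E ρ) ρ := fun ρ => by
    have := ((hasDerivAt_id ρ).const_mul (2 * L')).exp
    refine this.congr_deriv ?_
    simp [hE]; ring
  have hEc : Continuous E := by fun_prop
  have hE0 : ∀ ρ, 0 < E ρ := fun ρ => Real.exp_pos _
  -- At the maximum `m` of `|d| / E`, two integrations of `|q| ≤ L' m E` return `|d| ≤ (m/2) E`,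
  -- which forces `m = 0`. The first uses that `E` is increasing, the second that `E' = 2 L' E`.
  obtain ⟨ρ₀, hρ₀, hmax⟩ := isCompact_Icc.exists_isMaxOn (f := fun ρ => |d ρ| / E ρ) ⟨ρ₁, hρ₁⟩
    (hd.abs.div hEc.continuousOn fun ρ _ => (hE0 ρ).ne')
  set m := |d ρ₀| / E ρ₀ with hm
  have hm0 : 0 ≤ m := div_nonneg (abs_nonneg _) (hE0 _).le
  have hdm : ∀ ρ ∈ Icc 0 b, |d ρ| ≤ m * E ρ := fun ρ hρ => by
    have : |d ρ| / E ρ ≤ m := hmax hρ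
    rwa [div_le_iff₀ (hE0 ρ)] at this
  have hkb := abs_le_of_abs_deriv_le (B := fun ρ => L' * m * (ρ * E ρ))
    (B' := fun ρ => L' * m * (1 * E ρ + ρ * (2 * L' * E ρ))) hk
    (by fun_prop) (by simp) (by simp) h2
    (fun ρ _ => ((hasDerivAt_id ρ).mul (hEd ρ)).const_mul _) (fun ρ hρ => by
      have h3 := hdm ρ (Ioo_subset_Icc_self hρ)
      have h4 : 0 ≤ L' * m * (ρ * (2 * L' * E ρ)) := by
        have := hρ.1; have := hE0 ρ; positivity
      calc |q ρ| ≤ L * |d ρ| := hq ρ hρ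
        _ ≤ L' * (m * E ρ) := by gcongr
        _ ≤ _ := by linarith)
  have hA : ∀ ρ ∈ Ioo 0 b, |A ρ| ≤ L' * m * E ρ := fun ρ hρ => by
    have := hkb ρ (Ioo_subset_Icc_self hρ)
    simp only [abs_mul, abs_of_pos hρ.1] at this
    have h5 := hρ.1
    refine le_of_mul_le_mul_left (this.trans (le_of_eq ?_)) h5
    ring
  have hdb := abs_le_of_abs_deriv_le (B := fun ρ => m / 2 * E ρ)
    (B' := fun ρ => m / 2 * (2 * L' * E ρ)) hd (by fun_prop) hd0
    (by have := hE0 0; positivity) h1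
    (fun ρ _ => (hEd ρ).const_mul _) (fun ρ hρ => (hA ρ hρ).trans (le_of_eq (by ring)))
  have h6 : m ≤ m / 2 := by
    rw [hm, div_le_iff₀ (hE0 ρ₀)]
    exact hdb ρ₀ hρ₀
  have h7 : m = 0 := by linarith
  have h8 := hdm ρ₁ hρ₁
  rw [h7, zero_mul] at h8
  exact abs_nonpos_iff.1 h8

/-! ### The a priori bound for the linearised equation -/

/-- Comparing derivatives reduces this to `(√(1 + x) - 1)² ≥ 0`. The factor `ρ` on the right, which
a plain bound by a power would lose, is needed near the centre. -/
theorem log_one_add_le_div_sqrt {ρ : ℝ} (hρ : 0 ≤ ρ) : Real.log (1 + ρ) ≤ ρ / √(1 + ρ) := by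
  refine (le_abs_self _).trans (abs_le_of_abs_deriv_le (b := ρ) (f := fun x => Real.log (1 + x))
    (B := fun x => x / √(1 + x)) (f' := fun x => 1 / (1 + x))
    (B' := fun x => (1 * √(1 + x) - x * (1 / (2 * √(1 + x)))) / √(1 + x) ^ 2)
    ?_ ?_ (by simp) (by simp) ?_ ?_ ?_ ρ ⟨hρ, le_rfl⟩)
  · exact ContinuousOn.log (by fun_prop) fun x hx => by linarith [hx.1]
  · refine ContinuousOn.div (by fun_prop) (by fun_prop) fun x hx => ?_
    have : 0 < 1 + x := by linarith [hx.1]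
    positivity
  · intro x hx
    exact ((hasDerivAt_id x).const_add 1).log (by simp; linarith [hx.1])
  · intro x hx
    have h1 : 0 < 1 + x := by linarith [hx.1]
    exact (hasDerivAt_id x).div (((hasDerivAt_id x).const_add 1).sqrt h1.ne') (by positivity)
  · intro x hx
    have h1 : 0 < 1 + x := by linarith [hx.1]
    have h2 : 0 < √(1 + x) := by positivity
    have h3 : √(1 + x) ^ 2 = 1 + x := Real.sq_sqrt h1.le
    rw [abs_of_pos (by positivity), h3, div_le_div_iff_of_pos_right h1]
    rw [show 1 * √(1 + x) - x * (1 / (2 * √(1 + x))) = (2 * √(1 + x) ^ 2 - x) / (2 * √(1 + x)) by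
      field_simp]
    rw [le_div_iff₀ (by positivity), h3]
    nlinarith [sq_nonneg (√(1 + x) - 1)]

open Set in
/-- A solution of `(ρ d')' = O(2 |d| / (1+ρ)² + η (1+ρ)^{-3/2} + h)` grows at most logarithmically,
with constant proportional to `η`. -/
theorem FluxSol.bound {d A q : ℝ → ℝ} (hs : FluxSol 1 d A q) {b η h : ℝ} (hη : 0 ≤ η)
    (hh : h * (1 + b) ≤ η) (hh0 : 0 ≤ h) (hd0 : d 0 = 0)
    (hq : ∀ ρ ∈ Icc 0 b, |q ρ| ≤ 2 * |d ρ| / (1 + ρ) ^ 2 + η / ((1 + ρ) * √(1 + ρ)) + h) :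
    ∀ ρ ∈ Icc 0 b, (1 + ρ) * |A ρ| ≤ 6 * Real.exp 8 * η ∧
      |d ρ| ≤ 6 * Real.exp 8 * η * Real.log (1 + ρ) := by
  intro ρ₁ hρ₁
  have hup : ∀ ρ ∈ Icc 0 b, 0 < 1 + ρ := fun ρ hρ => by linarith [hρ.1]
  have hdom : ∀ ρ ∈ Icc 0 b, (-1 : ℝ) < ρ := fun ρ hρ => by linarith [hρ.1]
  have hAc : ContinuousOn A (Icc 0 b) := fun ρ hρ =>
    (hs.cont ρ (hdom ρ hρ)).continuousWithinAt
  have hdc : ContinuousOn d (Icc 0 b) := fun ρ hρ =>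
    (hs.deriv ρ (hdom ρ hρ)).continuousAt.continuousWithinAt
  set r : ℝ → ℝ := fun ρ => √(1 + ρ) with hr
  have hrp : ∀ ρ ∈ Icc 0 b, 0 < r ρ := fun ρ hρ => Real.sqrt_pos.2 (hup ρ hρ)
  have hr2 : ∀ ρ ∈ Icc 0 b, 1 + ρ = r ρ ^ 2 := fun ρ hρ => (Real.sq_sqrt (hup ρ hρ).le).symm
  have hr1 : ∀ ρ ∈ Icc 0 b, 1 ≤ r ρ := fun ρ hρ => Real.one_le_sqrt.2 (by linarith [hρ.1])
  have hrc : Continuous r := by fun_prop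
  have hrd : ∀ ρ ∈ Icc 0 b, HasDerivAt r (1 / (2 * r ρ)) ρ := fun ρ hρ =>
    ((hasDerivAt_id ρ).const_add 1).sqrt (hup ρ hρ).ne'
  have hrid : ∀ ρ ∈ Icc 0 b, HasDerivAt (fun ρ => (r ρ)⁻¹) (-(1 / (2 * r ρ)) / r ρ ^ 2) ρ :=
    fun ρ hρ => (hrd ρ hρ).inv (hrp ρ hρ).ne'
  have hric : ContinuousOn (fun ρ => (r ρ)⁻¹) (Icc 0 b) :=
    hrc.continuousOn.inv₀ fun ρ hρ => (hrp ρ hρ).ne'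
  -- This weight stays between `1` and `e⁸`, while `ω' = 4 ω (1 + ρ)^(-3/2)` is large enough to
  -- absorb the potential `2 / (1 + ρ)²` with a factor `1/2` to spare.
  set ω : ℝ → ℝ := fun ρ => Real.exp (8 * (1 - (r ρ)⁻¹)) with hω
  have hωp : ∀ ρ, 0 < ω ρ := fun ρ => Real.exp_pos _
  have hωc : ContinuousOn ω (Icc 0 b) :=
    Real.continuous_exp.comp_continuousOn ((continuousOn_const.sub hric).const_smul (8 : ℝ))
  have hω1 : ∀ ρ ∈ Icc 0 b, 1 ≤ ω ρ := fun ρ hρ => by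
    refine Real.one_le_exp ?_
    have := inv_le_one_of_one_le₀ (hr1 ρ hρ)
    linarith
  have hω8 : ∀ ρ ∈ Icc 0 b, ω ρ ≤ Real.exp 8 := fun ρ hρ => by
    refine Real.exp_le_exp.2 ?_
    have := inv_pos.2 (hrp ρ hρ)
    linarith
  have hωd : ∀ ρ ∈ Icc 0 b, HasDerivAt ω (4 * ω ρ / r ρ ^ 3) ρ := fun ρ hρ => by
    have := ((((hrid ρ hρ).const_sub 1).const_mul 8)).exp
    refine this.congr_deriv ?_
    have h1 := (hrp ρ hρ).ne'
    simp only [hω]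
    field_simp
    ring
  have hlogd : ∀ ρ ∈ Icc 0 b, HasDerivAt (fun ρ => Real.log (1 + ρ)) (1 / (1 + ρ)) ρ :=
    fun ρ hρ => ((hasDerivAt_id ρ).const_add 1).log (hup ρ hρ).ne'
  have hlogc : ContinuousOn (fun ρ => Real.log (1 + ρ)) (Icc 0 b) := fun ρ hρ =>
    (hlogd ρ hρ).continuousAt.continuousWithinAt
  have hlog0 : ∀ ρ ∈ Icc 0 b, 0 ≤ Real.log (1 + ρ) := fun ρ hρ =>
    Real.log_nonneg (by linarith [hρ.1])
  obtain ⟨ρ₀, hρ₀, hmax⟩ := isCompact_Icc.exists_isMaxOn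
    (f := fun ρ => (1 + ρ) * |A ρ| / ω ρ) ⟨ρ₁, hρ₁⟩
    (((continuousOn_const.add continuousOn_id).mul hAc.abs).div hωc fun ρ _ => (hωp ρ).ne')
  set m := (1 + ρ₀) * |A ρ₀| / ω ρ₀ with hm
  have hm0 : 0 ≤ m :=
    div_nonneg (mul_nonneg (hup _ hρ₀).le (abs_nonneg _)) (hωp _).le
  have hAm : ∀ ρ ∈ Icc 0 b, (1 + ρ) * |A ρ| ≤ m * ω ρ := fun ρ hρ => by
    have : (1 + ρ) * |A ρ| / ω ρ ≤ m := hmax hρ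
    rwa [div_le_iff₀ (hωp ρ)] at this
  -- Since `ω` is increasing, the derivative of `m ω log (1 + ρ)` dominates `m ω / (1 + ρ)`, hence
  -- `|A|`.
  have hdm := abs_le_of_abs_deriv_le (B := fun ρ => m * (ω ρ * Real.log (1 + ρ)))
    (B' := fun ρ => m * (4 * ω ρ / r ρ ^ 3 * Real.log (1 + ρ) + ω ρ * (1 / (1 + ρ)))) hdc
    (continuousOn_const.mul (hωc.mul hlogc)) hd0 (by simp)
    (fun ρ hρ => hs.deriv ρ (hdom ρ (Ioo_subset_Icc_self hρ)))
    (fun ρ hρ => ((hωd ρ (Ioo_subset_Icc_self hρ)).mul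
      (hlogd ρ (Ioo_subset_Icc_self hρ))).const_mul m) (fun ρ hρ' => by
        have hρ := Ioo_subset_Icc_self hρ'
        have h1 := hAm ρ hρ
        have h2 := hup ρ hρ
        have h3 := hrp ρ hρ
        have h4 := hlog0 ρ hρ
        have h5 := hωp ρ
        have h6 : |A ρ| ≤ m * (ω ρ * (1 / (1 + ρ))) := by
          rw [show m * (ω ρ * (1 / (1 + ρ))) = m * ω ρ / (1 + ρ) by ring, le_div_iff₀ h2]
          linarith
        have h7 : 0 ≤ m * (4 * ω ρ / r ρ ^ 3 * Real.log (1 + ρ)) := by positivity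
        linarith)
  -- By `log (1 + ρ) ≤ ρ / √(1 + ρ)` the potential term is at most `(m/2) (1 - 1/(1 + ρ)) ω'`, one
  -- half of the product rule for the first summand of `B`. The other two summands integrate `η (1 +
  -- ρ)^(-3/2)` and `h`.
  have hkm := abs_le_of_abs_deriv_le (f := fun ρ => ρ * A ρ)
    (B := fun ρ => m / 2 * ((1 - (r ρ)⁻¹ * (r ρ)⁻¹) * ω ρ) + 2 * η * (1 - (r ρ)⁻¹) + h * ρ)
    (B' := fun ρ => m / 2 * (-(-(1 / (2 * r ρ)) / r ρ ^ 2 * (r ρ)⁻¹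
      + (r ρ)⁻¹ * (-(1 / (2 * r ρ)) / r ρ ^ 2)) * ω ρ
      + (1 - (r ρ)⁻¹ * (r ρ)⁻¹) * (4 * ω ρ / r ρ ^ 3))
      + 2 * η * (-(-(1 / (2 * r ρ)) / r ρ ^ 2)) + h * 1)
    (b := b)
    (continuousOn_id.mul hAc)
    (((continuousOn_const.mul ((continuousOn_const.sub (hric.mul hric)).mul hωc)).add
      (continuousOn_const.mul (continuousOn_const.sub hric))).add
      (continuousOn_const.mul continuousOn_id)) (by simp) (by simp [hr])
    (fun ρ hρ => hs.flux ρ (hdom ρ (Ioo_subset_Icc_self hρ)))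
    (fun ρ hρ' => by
      have hρ := Ioo_subset_Icc_self hρ'
      have i1 := hrid ρ hρ
      exact (((((i1.mul i1).const_sub 1).mul (hωd ρ hρ)).const_mul (m / 2)).add
        ((i1.const_sub 1).const_mul (2 * η))).add ((hasDerivAt_id ρ).const_mul h))
    (fun ρ hρ' => by
      have hρ := Ioo_subset_Icc_self hρ'
      have h1 := hq ρ hρ
      have h2 := hdm ρ hρ
      have h3 := log_one_add_le_div_sqrt hρ.1
      have h4 := hrp ρ hρ
      have h5 := hωp ρ
      change |q ρ| ≤ 2 * |d ρ| / (1 + ρ) ^ 2 + η / ((1 + ρ) * r ρ) + h at h1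
      change Real.log (1 + ρ) ≤ ρ / r ρ at h3
      have h6 : |d ρ| ≤ m * (ω ρ * (ρ / r ρ)) := h2.trans (by gcongr)
      have h7 : ρ = r ρ ^ 2 - 1 := by linarith [hr2 ρ hρ]
      have h8 : 2 * |d ρ| / (1 + ρ) ^ 2 ≤ m / 2 * ((1 - (r ρ)⁻¹ * (r ρ)⁻¹) * (4 * ω ρ / r ρ ^ 3)) := by
        rw [hr2 ρ hρ]
        calc 2 * |d ρ| / (r ρ ^ 2) ^ 2 ≤ 2 * (m * (ω ρ * (ρ / r ρ))) / (r ρ ^ 2) ^ 2 := by gcongr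
          _ = 2 * (m * (ω ρ * ((r ρ ^ 2 - 1) / r ρ))) / (r ρ ^ 2) ^ 2 := by rw [← h7]
          _ = _ := by field_simp; ring
      have h9 : η / ((1 + ρ) * r ρ) = 2 * η * (-(-(1 / (2 * r ρ)) / r ρ ^ 2)) := by
        rw [hr2 ρ hρ]; field_simp
      have h10 : 0 ≤ m / 2 * (-(-(1 / (2 * r ρ)) / r ρ ^ 2 * (r ρ)⁻¹
          + (r ρ)⁻¹ * (-(1 / (2 * r ρ)) / r ρ ^ 2)) * ω ρ) := by
        rw [show (-(-(1 / (2 * r ρ)) / r ρ ^ 2 * (r ρ)⁻¹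
          + (r ρ)⁻¹ * (-(1 / (2 * r ρ)) / r ρ ^ 2))) = 1 / r ρ ^ 4 by field_simp; ring]
        positivity
      linarith)
  -- For `ρ > 0` the flux bound is multiplied by `1 + ρ` and divided by `ρ`. At `ρ = 0` the flux
  -- carries no information, and `A 0 = q 0` is used instead.
  have hfin : ∀ ρ ∈ Icc 0 b, (1 + ρ) * |A ρ| ≤ m / 2 * ω ρ + 3 * η := fun ρ hρ => by
    have h5 := hωp ρ
    rcases hρ.1.eq_or_lt with h0 | h0
    · have h1 := hq ρ hρ
      rw [← h0] at h1 ⊢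
      rw [hs.src_zero one_pos, hd0] at h1
      simp at h1 ⊢
      have : h ≤ η := by nlinarith [hρ.1.trans hρ.2]
      have : 0 ≤ m / 2 * ω 0 := by have := hωp 0; positivity
      linarith
    · have h1 := hkm ρ hρ
      simp only [abs_mul, abs_of_pos h0] at h1
      have h4 := hr1 ρ hρ
      have h2 : (r ρ)⁻¹ ≤ 1 := inv_le_one_of_one_le₀ h4
      have h3 : 0 < (r ρ)⁻¹ := inv_pos.2 (hrp ρ hρ)
      have h6 : (1 + ρ) * ((r ρ)⁻¹ * (r ρ)⁻¹) = 1 := by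
        have := hrp ρ hρ
        rw [hr2 ρ hρ]; field_simp
      have h7 : (1 + ρ) * (1 - (r ρ)⁻¹) ≤ ρ := by
        have : (1 + ρ) * ((r ρ)⁻¹ * (r ρ)⁻¹) ≤ (1 + ρ) * (r ρ)⁻¹ := by
          have := hup ρ hρ
          gcongr
          exact mul_le_of_le_one_left h3.le h2
        linarith
      have h8 : h * (1 + ρ) ≤ η := by nlinarith [hρ.2]
      refine le_of_mul_le_mul_left ?_ h0
      calc ρ * ((1 + ρ) * |A ρ|) = (1 + ρ) * (ρ * |A ρ|) := by ring
        _ ≤ (1 + ρ) * (m / 2 * ((1 - (r ρ)⁻¹ * (r ρ)⁻¹) * ω ρ) + 2 * η * (1 - (r ρ)⁻¹) + h * ρ) :=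
          mul_le_mul_of_nonneg_left h1 (hup ρ hρ).le
        _ = m / 2 * ω ρ * ((1 + ρ) - (1 + ρ) * ((r ρ)⁻¹ * (r ρ)⁻¹))
            + 2 * η * ((1 + ρ) * (1 - (r ρ)⁻¹)) + h * (1 + ρ) * ρ := by ring
        _ ≤ m / 2 * ω ρ * ((1 + ρ) - 1) + 2 * η * ρ + η * ρ := by
          rw [h6]; gcongr
        _ = _ := by ring
  -- At the maximum point the bound reads `m ω ≤ (m/2) ω + 3 η`, and `ω ≥ 1`.
  have hm6 : m ≤ 6 * η := by
    have h1 := hfin ρ₀ hρ₀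
    have h2 : m * ω ρ₀ = (1 + ρ₀) * |A ρ₀| := by rw [hm, div_mul_cancel₀ _ (hωp ρ₀).ne']
    nlinarith [hω1 ρ₀ hρ₀]
  have hmω : m * ω ρ₁ ≤ 6 * Real.exp 8 * η := by
    calc m * ω ρ₁ ≤ 6 * η * Real.exp 8 :=
          mul_le_mul hm6 (hω8 ρ₁ hρ₁) (hωp ρ₁).le (by positivity)
      _ = _ := by ring
  refine ⟨(hAm ρ₁ hρ₁).trans hmω, (hdm ρ₁ hρ₁).trans ?_⟩
  rw [← mul_assoc]
  exact mul_le_mul_of_nonneg_right hmω (hlog0 ρ₁ hρ₁)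

/-! ### Profiles of the linear equation -/

theorem exists_plane_norm_eq {r : ℝ} (hr : 0 ≤ r) : ∃ x : Plane, ‖x‖ = r :=
  ⟨r • EuclideanSpace.single 0 1, by simp [norm_smul, abs_of_nonneg hr]⟩

theorem exp_neg_two_T₀ (r : ℝ) : Real.exp (-2 * T₀ r) = 1 / (1 + r ^ 2) ^ 2 := by
  have h : 0 < 1 + r ^ 2 := by positivity
  rw [T₀, show -2 * Real.log (1 + r ^ 2) = -((2 : ℕ) * Real.log (1 + r ^ 2)) by push_cast; ring,
    ← Real.log_pow, Real.exp_neg, Real.exp_log (by positivity), one_div]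

theorem FluxSol.isProfile {a : ℝ} {w A q G : ℝ → ℝ} (h : FluxSol a w A q) (ha : 0 < a)
    (h0 : w 0 = 0) (hq : ∀ ρ, 0 ≤ ρ → q ρ = -(2 * w ρ + G ρ) / (1 + ρ) ^ 2) :
    IsProfile (fun r => G (r ^ 2)) fun r => w (r ^ 2) where
  contDiff := h.contDiff ha
  zero := by simpa using h0
  eqn x := by
    rw [h.lap_eq ha, hq _ (by positivity), exp_neg_two_T₀]
    ring

/-- The difference of two profiles solves the homogeneous equation with zero value at the centre,
and `(1 + ρ)² ≥ 1` bounds its source by `2 |d|`. Regularity at the origin excludes the logarithmic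
solution. -/
theorem IsProfile.eqOn {G v w : ℝ → ℝ} (hv : IsProfile G v) (hw : IsProfile G w) :
    Set.EqOn v w (Set.Ici 0) := by
  intro r hr
  have hr : 0 ≤ r := hr
  have hR : 0 < r + 1 := by linarith
  obtain ⟨A, q, hc, hk, hd, hl⟩ := exists_flux_of_contDiffOn hR hv.contDiff.contDiffOn
  obtain ⟨A', q', hc', hk', hd', hl'⟩ := exists_flux_of_contDiffOn hR hw.contDiff.contDiffOn
  have hsub : Set.Icc 0 (r ^ 2) ⊆ Set.Ico 0 ((r + 1) ^ 2) := fun ρ hρ =>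
    ⟨hρ.1, hρ.2.trans_lt (by nlinarith)⟩
  have hsub' : Set.Ioo 0 (r ^ 2) ⊆ Set.Ioo 0 ((r + 1) ^ 2) := fun ρ hρ =>
    ⟨hρ.1, (hsub ⟨hρ.1.le, hρ.2.le⟩).2⟩
  have := eqOn_zero_of_flux (d := fun ρ => v (√ρ) - w (√ρ)) (A := fun ρ => A ρ - A' ρ)
    (q := fun ρ => q ρ - q' ρ) (L := 2) (b := r ^ 2) ((hc.sub hc').mono hsub)
    (by simp [hv.zero, hw.zero])
    (((hk.sub hk').mono hsub).congr fun ρ _ => by simp only [Pi.sub_apply]; ring)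
    (fun ρ hρ => (hd ρ (hsub' hρ)).1.sub (hd' ρ (hsub' hρ)).1)
    (fun ρ hρ => ((hd ρ (hsub' hρ)).2.sub (hd' ρ (hsub' hρ)).2).congr_of_eventuallyEq
      (Eventually.of_forall fun σ => by simp only [Pi.sub_apply]; ring))
    (fun ρ hρ => ?_) (r ^ 2) ⟨by positivity, le_rfl⟩
  · simp only [Real.sqrt_sq hr] at this
    linarith
  · obtain ⟨x, hx⟩ := exists_plane_norm_eq (Real.sqrt_nonneg ρ)
    have hx2 : ‖x‖ ^ 2 = ρ := by rw [hx, Real.sq_sqrt hρ.1.le]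
    have hxR : x ∈ Metric.ball (0 : Plane) (r + 1) := by
      rw [mem_ball_zero_iff, hx, Real.sqrt_lt' hR]
      exact (hsub' hρ).2
    have hx0 : x ≠ 0 := by
      rw [← norm_pos_iff, hx]; exact Real.sqrt_pos.2 hρ.1
    have e1 := hl x hxR hx0
    have e2 := hl' x hxR hx0
    rw [hv.eqn, exp_neg_two_T₀, hx2, hx] at e1
    rw [hw.eqn, exp_neg_two_T₀, hx2, hx] at e2
    have h1 : 1 ≤ (1 + ρ) ^ 2 := by nlinarith [hρ.1]
    have h2 : q ρ - q' ρ = -(2 * (v (√ρ) - w (√ρ)) / (1 + ρ) ^ 2) := by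
      linear_combination (1 / 4 : ℝ) * e1 - (1 / 4 : ℝ) * e2
    rw [h2, abs_neg, abs_div, abs_mul, abs_two, abs_of_pos (zero_lt_one.trans_le h1)]
    exact div_le_self (by positivity) h1

theorem FluxSol.isUniqueProfile {a : ℝ} {w A q G : ℝ → ℝ} (h : FluxSol a w A q) (ha : 0 < a)
    (h0 : w 0 = 0) (hq : ∀ ρ, 0 ≤ ρ → q ρ = -(2 * w ρ + G ρ) / (1 + ρ) ^ 2) :
    IsUniqueProfile (fun r => G (r ^ 2)) fun r => w (r ^ 2) :=
  ⟨h.isProfile ha h0 hq, fun _ hv => hv.eqOn (h.isProfile ha h0 hq)⟩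

/-! ### The first correction -/

/-- The dilogarithmic integral `∫₁^{1+ρ} log t / (1 - t) dt`. -/
def dil (ρ : ℝ) : ℝ := ∫ t in (1 : ℝ)..(1 + ρ), Real.log t / (1 - t)

/-- `w₀` in the variable `ρ = r²`. -/
def W₀ (ρ : ℝ) : ℝ :=
  -Real.log (1 + ρ) + 2 * ρ / (1 + ρ) - 1 / 2 * Real.log (1 + ρ) ^ 2
    + (1 - ρ) / (1 + ρ) * dil ρ

/-- The derivative of `W₀`. -/
def A₀ (ρ : ℝ) : ℝ :=
  -(1 / (1 + ρ)) + 2 / (1 + ρ) ^ 2 - Real.log (1 + ρ) / (1 + ρ) - 2 / (1 + ρ) ^ 2 * dil ρ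
    - (1 - ρ) / (1 + ρ) * dslope Real.log 1 (1 + ρ)

theorem w₀_eq : w₀ = fun r => W₀ (r ^ 2) := rfl

theorem mul_dslope_log (ρ : ℝ) : ρ * dslope Real.log 1 (1 + ρ) = Real.log (1 + ρ) := by
  simpa using sub_smul_dslope Real.log 1 (1 + ρ)

theorem continuousOn_dslope_log : ContinuousOn (dslope Real.log 1) (Set.Ioi 0) := by
  rw [continuousOn_dslope (Ioi_mem_nhds one_pos)]
  exact ⟨fun x hx => (Real.continuousAt_log (ne_of_gt hx)).continuousWithinAt,
    Real.differentiableAt_log one_ne_zero⟩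

/-- The quotient `log t / (1 - t)` takes the default value `0` at `t = 1`, where its continuous
extension is `-1`. One point does not affect the integral, and the divided slope is continuous
there. -/
theorem dil_eq (ρ : ℝ) : dil ρ = ∫ t in (1 : ℝ)..(1 + ρ), -dslope Real.log 1 t := by
  refine intervalIntegral.integral_congr_ae ?_
  filter_upwards [MeasureTheory.Measure.ae_ne MeasureTheory.volume (1 : ℝ)] with t ht _
  rw [dslope_of_ne _ ht, slope_def_field, Real.log_one, sub_zero, ← div_neg, neg_sub]

theorem dil_zero : dil 0 = 0 := by simp [dil]

theorem hasDerivAt_dil {ρ : ℝ} (hρ : -1 < ρ) :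
    HasDerivAt dil (-dslope Real.log 1 (1 + ρ)) ρ := by
  have hu : 0 < 1 + ρ := by linarith
  have hc : ContinuousOn (fun t => -dslope Real.log 1 t) (Set.Ioi 0) := continuousOn_dslope_log.neg
  have hi : IntervalIntegrable (fun t => -dslope Real.log 1 t) MeasureTheory.volume 1 (1 + ρ) := by
    refine (hc.mono fun t ht => ?_).intervalIntegrable
    exact lt_of_lt_of_le (lt_min one_pos hu) ht.1
  have h1 := intervalIntegral.integral_hasDerivAt_right hi
    (hc.stronglyMeasurableAtFilter isOpen_Ioi _ hu) (hc.continuousAt (Ioi_mem_nhds hu))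
  have h2 := h1.comp ρ ((hasDerivAt_id ρ).const_add 1)
  rw [mul_one] at h2
  exact h2.congr_of_eventuallyEq (Eventually.of_forall dil_eq)

theorem hasDerivAt_log_one_add {ρ : ℝ} (hρ : -1 < ρ) :
    HasDerivAt (fun ρ => Real.log (1 + ρ)) (1 / (1 + ρ)) ρ :=
  ((hasDerivAt_id ρ).const_add 1).log (by simp; linarith)

theorem hasDerivAt_W₀ {ρ : ℝ} (hρ : -1 < ρ) : HasDerivAt W₀ (A₀ ρ) ρ := by
  have hu : 1 + ρ ≠ 0 := by linarith
  have hl := hasDerivAt_log_one_add hρ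
  have hid := hasDerivAt_id ρ
  have h1u := hid.const_add 1
  have h := ((hl.neg.add ((hid.const_mul 2).div h1u hu)).sub ((hl.pow 2).const_mul (1 / 2))).add
    (((hid.const_sub 1).div h1u hu).mul (hasDerivAt_dil hρ))
  refine (h.congr_of_eventuallyEq (Eventually.of_forall fun σ => ?_)).congr_deriv ?_
  · simp [W₀]
  · simp only [A₀, id, Nat.cast_ofNat, Pi.div_apply]
    field_simp
    ring

/-- The flux `ρ W₀'`. -/
def P₀ (ρ : ℝ) : ℝ :=
  -(ρ / (1 + ρ)) + 2 * ρ / (1 + ρ) ^ 2 - 2 * ρ / (1 + ρ) ^ 2 * dil ρ - Real.log (1 + ρ) / (1 + ρ)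

/-- Multiplication by `ρ` turns the divided slope into `log (1 + ρ)`, so the flux has a form with no
removable singularity to differentiate. -/
theorem P₀_eq {ρ : ℝ} (hρ : -1 < ρ) : ρ * A₀ ρ = P₀ ρ := by
  have hu : 1 + ρ ≠ 0 := by linarith
  have h := mul_dslope_log ρ
  simp only [A₀, P₀]
  field_simp
  linear_combination (-(1 - ρ) * (1 + ρ)) * h

theorem hasDerivAt_P₀ {ρ : ℝ} (hρ : -1 < ρ) :
    HasDerivAt P₀ (-(2 * W₀ ρ + (Real.log (1 + ρ) ^ 2 - Real.log (1 + ρ))) / (1 + ρ) ^ 2) ρ := by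
  have hu : 1 + ρ ≠ 0 := by linarith
  have hl := hasDerivAt_log_one_add hρ
  have hid := hasDerivAt_id ρ
  have h1u := hid.const_add 1
  have hs := mul_dslope_log ρ
  have e := ((hid.const_mul 2).div (h1u.pow 2) (pow_ne_zero 2 hu))
  have h := (((hid.div h1u hu).neg.add e).sub (e.mul (hasDerivAt_dil hρ))).sub (hl.div h1u hu)
  refine (h.congr_of_eventuallyEq (Eventually.of_forall fun σ => ?_)).congr_deriv ?_
  · simp [P₀]
  · simp only [W₀, id, Nat.cast_ofNat, Pi.div_apply, Pi.pow_apply]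
    field_simp
    linear_combination (2 * (1 + ρ) ^ 2) * hs

theorem continuousOn_A₀ : ContinuousOn A₀ (Set.Ioi (-1)) := by
  have hu : ∀ ρ ∈ Set.Ioi (-1 : ℝ), 1 + ρ ≠ 0 := fun ρ hρ => by
    have : -1 < ρ := hρ
    linarith
  have hl : ContinuousOn (fun ρ => Real.log (1 + ρ)) (Set.Ioi (-1)) := fun ρ hρ =>
    (hasDerivAt_log_one_add hρ).continuousAt.continuousWithinAt
  have hd : ContinuousOn dil (Set.Ioi (-1)) := fun ρ hρ =>
    (hasDerivAt_dil hρ).continuousAt.continuousWithinAt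
  have hs : ContinuousOn (fun ρ : ℝ => dslope Real.log 1 (1 + ρ)) (Set.Ioi (-1)) :=
    continuousOn_dslope_log.comp (by fun_prop) fun ρ hρ => by
      have : -1 < ρ := hρ
      simp; linarith
  unfold A₀
  have h1 : ContinuousOn (fun ρ : ℝ => 1 / (1 + ρ)) (Set.Ioi (-1)) :=
    ContinuousOn.div (by fun_prop) (by fun_prop) hu
  have h2 : ContinuousOn (fun ρ : ℝ => 2 / (1 + ρ) ^ 2) (Set.Ioi (-1)) :=
    ContinuousOn.div (by fun_prop) (by fun_prop) fun ρ hρ => pow_ne_zero 2 (hu ρ hρ)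
  have h3 : ContinuousOn (fun ρ : ℝ => (1 - ρ) / (1 + ρ)) (Set.Ioi (-1)) :=
    ContinuousOn.div (by fun_prop) (by fun_prop) hu
  have h4 : ContinuousOn (fun ρ : ℝ => Real.log (1 + ρ) / (1 + ρ)) (Set.Ioi (-1)) :=
    hl.div (by fun_prop) hu
  exact (((h1.neg.add h2).sub h4).sub (h2.mul hd)).sub (h3.mul hs)

theorem fluxSol_W₀ : FluxSol 1 W₀ A₀
    fun ρ => -(2 * W₀ ρ + (Real.log (1 + ρ) ^ 2 - Real.log (1 + ρ))) / (1 + ρ) ^ 2 where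
  deriv _ hρ := hasDerivAt_W₀ hρ
  flux ρ hρ := (hasDerivAt_P₀ hρ).congr_of_eventuallyEq <| by
    filter_upwards [lt_mem_nhds hρ] with σ hσ using P₀_eq hσ
  cont ρ hρ := continuousOn_A₀.continuousAt (Ioi_mem_nhds hρ)
  cont_src ρ hρ := by
    have hl := (hasDerivAt_log_one_add hρ).continuousAt
    have hu : (1 + ρ) ^ 2 ≠ 0 := pow_ne_zero 2 (by linarith)
    exact ((((hasDerivAt_W₀ hρ).continuousAt.const_mul 2).add ((hl.pow 2).sub hl)).neg).div
      (by fun_prop) hu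

theorem W₀_zero : W₀ 0 = 0 := by simp [W₀, dil_zero]

theorem isUniqueProfile_w₀ : IsUniqueProfile (fun r => T₀ r ^ 2 - T₀ r) w₀ :=
  fluxSol_W₀.isUniqueProfile (G := fun ρ => Real.log (1 + ρ) ^ 2 - Real.log (1 + ρ)) one_pos
    W₀_zero fun _ _ => rfl

/-! ### Growth bounds -/

/-- Apply `xⁿ / n! ≤ eˣ` with `x = (1 + log (1 + ρ)) / 2`. Trading all powers of logarithms for `√(1
+ ρ)` is the source of the factor `e^(t/2)` in the final error. -/
theorem exists_one_add_log_pow_le (n : ℕ) :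
    ∃ C : ℝ, 0 < C ∧ ∀ ρ : ℝ, 0 ≤ ρ → (1 + Real.log (1 + ρ)) ^ n ≤ C * √(1 + ρ) := by
  refine ⟨2 ^ n * n.factorial * Real.exp (1 / 2), by positivity, fun ρ hρ => ?_⟩
  have hu : 0 < 1 + ρ := by linarith
  have hL : 0 ≤ Real.log (1 + ρ) := Real.log_nonneg (by linarith)
  have h := Real.pow_div_factorial_le_exp ((1 + Real.log (1 + ρ)) / 2) (by positivity) n
  have h2 : Real.exp ((1 + Real.log (1 + ρ)) / 2) = Real.exp (1 / 2) * √(1 + ρ) := by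
    rw [add_div, Real.exp_add, Real.exp_half, Real.exp_half, Real.exp_log hu]
  rw [h2, div_le_iff₀ (by positivity), div_pow, div_le_iff₀ (by positivity)] at h
  calc _ ≤ _ := h
    _ = _ := by ring

/-- A solution of `(ρ g')' = -(2 g + G)/(1+ρ)²` with `|G| ≤ M √(1+ρ)` grows at most
logarithmically. -/
theorem FluxSol.log_growth {w A q G : ℝ → ℝ} {M : ℝ} (h : FluxSol 1 w A q) (h0 : w 0 = 0)
    (hq : ∀ ρ, 0 ≤ ρ → q ρ = -(2 * w ρ + G ρ) / (1 + ρ) ^ 2)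
    (hG : ∀ ρ, 0 ≤ ρ → |G ρ| ≤ M * √(1 + ρ)) :
    ∃ C : ℝ, 0 < C ∧ ∀ ρ, 0 ≤ ρ → (1 + ρ) * |A ρ| ≤ C ∧ |w ρ| ≤ C * Real.log (1 + ρ) := by
  have hM : 0 ≤ M := by
    have := (abs_nonneg _).trans (hG 0 le_rfl)
    simpa using this
  refine ⟨6 * Real.exp 8 * (M + 1), by positivity, fun ρ hρ => ?_⟩
  refine h.bound (b := ρ) (η := M + 1) (h := 0) (by linarith) (by simp; linarith) le_rfl h0
    (fun σ hσ => ?_) ρ ⟨hρ, le_rfl⟩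
  have hu : 0 < 1 + σ := by linarith [hσ.1]
  have hs : 0 < √(1 + σ) := Real.sqrt_pos.2 hu
  have h1 := hG σ hσ.1
  rw [hq σ hσ.1, abs_div, abs_neg, abs_of_pos (pow_pos hu 2), add_zero]
  have h2 : |2 * w σ + G σ| ≤ 2 * |w σ| + (M + 1) * √(1 + σ) := by
    refine (abs_add_le _ _).trans ?_
    rw [abs_mul, abs_two]
    nlinarith
  calc |2 * w σ + G σ| / (1 + σ) ^ 2 ≤ (2 * |w σ| + (M + 1) * √(1 + σ)) / (1 + σ) ^ 2 := by gcongr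
    _ = 2 * |w σ| / (1 + σ) ^ 2 + (M + 1) / ((1 + σ) * √(1 + σ)) := by
      rw [add_div]
      congr 1
      rw [div_eq_div_iff (by positivity) (by positivity)]
      linear_combination (M + 1) * (1 + σ) * Real.sq_sqrt hu.le

theorem exists_W₀_growth : ∃ C : ℝ, 0 < C ∧ ∀ ρ, 0 ≤ ρ →
    (1 + ρ) * |A₀ ρ| ≤ C ∧ |W₀ ρ| ≤ C * Real.log (1 + ρ) := by
  obtain ⟨C, hC, hCb⟩ := exists_one_add_log_pow_le 2
  refine fluxSol_W₀.log_growth (G := fun ρ => Real.log (1 + ρ) ^ 2 - Real.log (1 + ρ)) (M := C)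
    W₀_zero (fun _ _ => rfl) fun ρ hρ => ?_
  refine le_trans ?_ (hCb ρ hρ)
  have hL : 0 ≤ Real.log (1 + ρ) := Real.log_nonneg (by linarith)
  rw [abs_le]
  constructor <;> nlinarith

/-! ### The second correction -/

/-- `F` in the variable `ρ = r²`. -/
def F₁ (p ρ : ℝ) : ℝ :=
  2 * (p - 1) * W₀ ρ + (p - 2) * Real.log (1 + ρ) ^ 2 - 8 * (p - 1) * Real.log (1 + ρ) * W₀ ρ
    - (8 * p - 10) / 3 * Real.log (1 + ρ) ^ 3
    + 4 * (p - 1) * W₀ ρ ^ 2 + 4 * (p - 1) * Real.log (1 + ρ) ^ 2 * W₀ ρ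
    + (p - 1) * Real.log (1 + ρ) ^ 4

theorem exists_F₁_growth (p : ℝ) :
    ∃ C : ℝ, 0 < C ∧ ∀ ρ, 0 ≤ ρ → |F₁ p ρ| ≤ C * (1 + Real.log (1 + ρ)) ^ 4 := by
  obtain ⟨K, hK, hb⟩ := exists_W₀_growth
  refine ⟨2 * |p - 1| * K + |p - 2| + 8 * |p - 1| * K + |8 * p - 10| / 3 + 4 * |p - 1| * K ^ 2
    + 4 * |p - 1| * K + |p - 1| + 1, by positivity, fun ρ hρ => ?_⟩
  have hL : 0 ≤ Real.log (1 + ρ) := Real.log_nonneg (by linarith)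
  have hw := (hb ρ hρ).2
  simp only [F₁]
  generalize Real.log (1 + ρ) = L at *
  generalize W₀ ρ = w at *
  have hΛ : 1 ≤ 1 + L := by linarith
  have hLΛ : L ≤ 1 + L := by linarith
  have hwΛ : |w| ≤ K * (1 + L) := hw.trans (by gcongr)
  have q1 : 1 + L ≤ (1 + L) ^ 4 := le_self_pow₀ hΛ (by norm_num)
  have q2 : (1 + L) ^ 2 ≤ (1 + L) ^ 4 := pow_le_pow_right₀ hΛ (by norm_num)
  have q3 : (1 + L) ^ 3 ≤ (1 + L) ^ 4 := pow_le_pow_right₀ hΛ (by norm_num)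
  have t1 : |2 * (p - 1) * w| ≤ 2 * |p - 1| * K * (1 + L) ^ 4 := by
    rw [abs_mul, abs_mul, abs_two]
    calc 2 * |p - 1| * |w| ≤ 2 * |p - 1| * (K * (1 + L) ^ 4) := by
          gcongr; exact hwΛ.trans (by gcongr)
      _ = _ := by ring
  have t2 : |(p - 2) * L ^ 2| ≤ |p - 2| * (1 + L) ^ 4 := by
    rw [abs_mul, abs_of_nonneg (by positivity : 0 ≤ L ^ 2)]
    gcongr
    exact (pow_le_pow_left₀ hL hLΛ 2).trans q2
  have t3 : |8 * (p - 1) * L * w| ≤ 8 * |p - 1| * K * (1 + L) ^ 4 := by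
    rw [abs_mul, abs_mul, abs_mul, abs_of_nonneg hL, abs_of_pos (by norm_num : (0 : ℝ) < 8)]
    calc 8 * |p - 1| * L * |w| ≤ 8 * |p - 1| * (1 + L) * (K * (1 + L)) := by gcongr
      _ = 8 * |p - 1| * K * (1 + L) ^ 2 := by ring
      _ ≤ _ := by gcongr
  have t4 : |(8 * p - 10) / 3 * L ^ 3| ≤ |8 * p - 10| / 3 * (1 + L) ^ 4 := by
    rw [abs_mul, abs_of_nonneg (by positivity : 0 ≤ L ^ 3), abs_div,
      abs_of_pos (by norm_num : (0 : ℝ) < 3)]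
    gcongr
    exact (pow_le_pow_left₀ hL hLΛ 3).trans q3
  have t5 : |4 * (p - 1) * w ^ 2| ≤ 4 * |p - 1| * K ^ 2 * (1 + L) ^ 4 := by
    rw [abs_mul, abs_mul, abs_pow, abs_of_pos (by norm_num : (0 : ℝ) < 4)]
    calc 4 * |p - 1| * |w| ^ 2 ≤ 4 * |p - 1| * (K * (1 + L)) ^ 2 := by gcongr
      _ = 4 * |p - 1| * K ^ 2 * (1 + L) ^ 2 := by ring
      _ ≤ _ := by gcongr
  have t6 : |4 * (p - 1) * L ^ 2 * w| ≤ 4 * |p - 1| * K * (1 + L) ^ 4 := by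
    rw [abs_mul, abs_mul, abs_mul, abs_of_nonneg (by positivity : 0 ≤ L ^ 2),
      abs_of_pos (by norm_num : (0 : ℝ) < 4)]
    calc 4 * |p - 1| * L ^ 2 * |w| ≤ 4 * |p - 1| * (1 + L) ^ 2 * (K * (1 + L)) := by gcongr
      _ = 4 * |p - 1| * K * (1 + L) ^ 3 := by ring
      _ ≤ _ := by gcongr
  have t7 : |(p - 1) * L ^ 4| ≤ |p - 1| * (1 + L) ^ 4 := by
    rw [abs_mul, abs_of_nonneg (by positivity : 0 ≤ L ^ 4)]
    gcongr
  have t8 : 0 ≤ (1 + L) ^ 4 := by positivity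
  rw [abs_le] at *
  constructor <;> nlinarith [t1.1, t1.2, t2.1, t2.2]

theorem exists_second_profile (p k : ℝ) : ∃ W A q : ℝ → ℝ, FluxSol 1 W A q ∧ W 0 = 0 ∧
    (∀ ρ, 0 ≤ ρ → q ρ = -(2 * W ρ + k * F₁ p ρ) / (1 + ρ) ^ 2) ∧
    ∃ C : ℝ, 0 < C ∧ ∀ ρ, 0 ≤ ρ → (1 + ρ) * |A ρ| ≤ C ∧ |W ρ| ≤ C * Real.log (1 + ρ) := by
  obtain ⟨K, hK, hF⟩ := exists_F₁_growth p
  obtain ⟨C, hC, hCb⟩ := exists_one_add_log_pow_le 4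
  have hFb : ∀ ρ, 0 ≤ ρ → |k * F₁ p ρ| ≤ |k| * K * C * √(1 + ρ) := fun ρ hρ => by
    rw [abs_mul]
    calc |k| * |F₁ p ρ| ≤ |k| * (K * (C * √(1 + ρ))) := by
          gcongr; exact (hF ρ hρ).trans (by gcongr; exact hCb ρ hρ)
      _ = _ := by ring
  -- For negative `τ` the coefficients are frozen at their values at `0`, which makes them bounded
  -- on the whole line as `exists_fluxSol` requires. The equation is only wanted for `ρ ≥ 0`.
  set f : ℝ → ℝ → ℝ := fun τ y => -(2 * y + k * F₁ p (max τ 0)) / (1 + max τ 0) ^ 2 with hf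
  have hu : ∀ τ : ℝ, 1 ≤ 1 + max τ 0 := fun τ => by linarith [le_max_right τ 0]
  have hFc : Continuous fun τ : ℝ => F₁ p (max τ 0) := by
    have hm : Continuous fun τ : ℝ => max τ 0 := by fun_prop
    have hdom : ∀ τ : ℝ, -1 < max τ 0 := fun τ => by linarith [le_max_right τ 0]
    have hl : Continuous fun τ : ℝ => Real.log (1 + max τ 0) :=
      Continuous.log (by fun_prop) fun τ => by linarith [hu τ]
    have hW : Continuous fun τ : ℝ => W₀ (max τ 0) := continuous_iff_continuousAt.2 fun τ =>
      ContinuousAt.comp (f := fun τ : ℝ => max τ 0) (hasDerivAt_W₀ (hdom τ)).continuousAt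
        hm.continuousAt
    unfold F₁
    fun_prop
  obtain ⟨W, A, hW0, hW⟩ := exists_fluxSol (f := f) (L := 2) (M := |k| * K * C)
    (by
      refine Continuous.div ?_ (by fun_prop) fun x => (pow_pos (by linarith [hu x.1]) 2).ne'
      exact ((continuous_const.mul continuous_snd).add
        (continuous_const.mul (hFc.comp continuous_fst))).neg)
    two_pos
    (fun τ y z => by
      have h1 : 1 ≤ (1 + max τ 0) ^ 2 := one_le_pow₀ (hu τ)
      rw [hf, show -(2 * y + k * F₁ p (max τ 0)) / (1 + max τ 0) ^ 2
        - -(2 * z + k * F₁ p (max τ 0)) / (1 + max τ 0) ^ 2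
        = -(2 * (y - z)) / (1 + max τ 0) ^ 2 by ring, abs_div, abs_neg, abs_mul, abs_two,
        abs_of_pos (zero_lt_one.trans_le h1)]
      exact div_le_self (by positivity) h1)
    (fun τ => by
      have h1 := hu τ
      simp only [hf, mul_zero, zero_add]
      rw [abs_div, abs_neg, abs_of_pos (by positivity : 0 < (1 + max τ 0) ^ 2),
        div_le_iff₀ (by positivity)]
      refine (hFb _ (le_max_right τ 0)).trans ?_
      gcongr
      rw [Real.sqrt_le_left (by positivity)]
      calc 1 + max τ 0 ≤ (1 + max τ 0) ^ 4 := le_self_pow₀ h1 (by norm_num)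
        _ = _ := by ring)
  have hq : ∀ ρ, 0 ≤ ρ → f ρ (W ρ) = -(2 * W ρ + k * F₁ p ρ) / (1 + ρ) ^ 2 := fun ρ hρ => by
    simp only [hf, max_eq_left hρ]
  exact ⟨W, A, _, hW 1, hW0, hq, (hW 1).log_growth (G := fun ρ => k * F₁ p ρ) hW0 hq hFb⟩

/-! ### Taylor expansions with bounded remainders -/

/-- The mean value inequality on the ball of radius `|x|` gains one power. Each Taylor estimate for
`(1 - x)^q` below then follows from the previous one with exponent `q - 1`. -/
theorem isBigO_pow_succ_of_deriv {f f' : ℝ → ℝ} {n : ℕ} (h0 : f 0 = 0)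
    (hd : ∀ᶠ x in 𝓝 (0 : ℝ), HasDerivAt f (f' x) x)
    (hf' : f' =O[𝓝 0] fun x => x ^ n) : f =O[𝓝 0] fun x => x ^ (n + 1) := by
  obtain ⟨C, hC⟩ := hf'.bound
  obtain ⟨r, hr, hb⟩ := Metric.eventually_nhds_iff_ball.1 (hd.and hC)
  refine IsBigO.of_bound C ?_
  filter_upwards [Metric.ball_mem_nhds (0 : ℝ) hr] with x hx
  have hsub : Metric.closedBall (0 : ℝ) |x| ⊆ Metric.ball 0 r := by
    intro y hy
    simp only [Metric.mem_closedBall, Metric.mem_ball, dist_zero_right, Real.norm_eq_abs] at *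
    linarith
  have := (convex_closedBall (0 : ℝ) |x|).norm_image_sub_le_of_norm_hasDerivWithin_le
    (f := f) (f' := f') (C := C * |x| ^ n) (x := 0) (y := x)
    (fun y hy => (hb y (hsub hy)).1.hasDerivWithinAt) (fun y hy => ?_) (by simp) (by simp)
  · rw [h0, sub_zero, sub_zero] at this
    simpa [pow_succ, mul_assoc] using this
  · have h1 := (hb y (hsub hy)).2
    have h2 : |y| ≤ |x| := by simpa using hy
    -- The constant from the `O`-bound may be negative; that is only compatible with points where
    -- the power vanishes.
    have hC0 : 0 ≤ C ∨ y = 0 := by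
      by_contra! h
      have : 0 < ‖y ^ n‖ := norm_pos_iff.2 (pow_ne_zero n h.2)
      nlinarith [norm_nonneg (f' y)]
    rw [norm_pow, Real.norm_eq_abs y] at h1
    rcases le_or_gt 0 C with hC' | hC'
    · exact h1.trans (by gcongr)
    · rcases hC0 with h | h
      · linarith
      · have hx0 : x ≠ 0 ∨ x = 0 := (em _).symm
        rcases hx0 with h3 | h3
        · have h4 := (hb x (by simpa using hx)).2
          have : 0 < ‖x ^ n‖ := norm_pos_iff.2 (pow_ne_zero n h3)
          nlinarith [norm_nonneg (f' x)]
        · rw [h3, ← abs_zero, ← h]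
          simpa using h1

theorem hasDerivAt_one_sub_rpow (q : ℝ) :
    ∀ᶠ x in 𝓝 (0 : ℝ), HasDerivAt (fun x : ℝ => (1 - x) ^ q) (-q * (1 - x) ^ (q - 1)) x := by
  filter_upwards [gt_mem_nhds (one_pos : (0 : ℝ) < 1)] with x hx
  have := ((hasDerivAt_id x).const_sub 1).rpow_const (p := q) (Or.inl (by simp; linarith))
  refine this.congr_deriv ?_
  simp

theorem one_sub_rpow_taylor_one (q : ℝ) :
    (fun x : ℝ => (1 - x) ^ q - 1) =O[𝓝 0] fun x => x ^ 1 := by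
  refine isBigO_pow_succ_of_deriv (n := 0) (by simp)
    ((hasDerivAt_one_sub_rpow q).mono fun x hx => hx.sub_const 1) ?_
  have : ContinuousAt (fun x : ℝ => -q * (1 - x) ^ (q - 1)) 0 := by
    refine continuousAt_const.mul (ContinuousAt.rpow_const (by fun_prop) (Or.inl (by simp)))
  simpa using this.isBigO_one ℝ

theorem one_sub_rpow_taylor_two (q : ℝ) :
    (fun x : ℝ => (1 - x) ^ q - (1 - q * x)) =O[𝓝 0] fun x => x ^ 2 := by
  refine isBigO_pow_succ_of_deriv (n := 1) (by simp)
    ((hasDerivAt_one_sub_rpow q).mono fun x hx =>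
      hx.sub (((hasDerivAt_id x).const_mul q).const_sub 1)) ?_
  refine ((one_sub_rpow_taylor_one (q - 1)).const_mul_left (-q)).congr_left fun x => ?_
  ring

theorem one_sub_rpow_taylor_three (q : ℝ) :
    (fun x : ℝ => (1 - x) ^ q - (1 - q * x + q * (q - 1) / 2 * x ^ 2))
      =O[𝓝 0] fun x => x ^ 3 := by
  refine isBigO_pow_succ_of_deriv (n := 2) (by simp)
    ((hasDerivAt_one_sub_rpow q).mono fun x hx =>
      hx.sub ((((hasDerivAt_id x).const_mul q).const_sub 1).add
        (((hasDerivAt_id x).pow 2).const_mul (q * (q - 1) / 2)))) ?_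
  refine ((one_sub_rpow_taylor_two (q - 1)).const_mul_left (-q)).congr_left fun x => ?_
  simp
  ring

theorem one_sub_rpow_taylor_four (q : ℝ) :
    (fun x : ℝ => (1 - x) ^ q - (1 - q * x + q * (q - 1) / 2 * x ^ 2
      - q * (q - 1) * (q - 2) / 6 * x ^ 3)) =O[𝓝 0] fun x => x ^ 4 := by
  refine isBigO_pow_succ_of_deriv (n := 3) (by simp)
    ((hasDerivAt_one_sub_rpow q).mono fun x hx =>
      hx.sub (((((hasDerivAt_id x).const_mul q).const_sub 1).add
        (((hasDerivAt_id x).pow 2).const_mul (q * (q - 1) / 2))).sub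
        (((hasDerivAt_id x).pow 3).const_mul (q * (q - 1) * (q - 2) / 6)))) ?_
  refine ((one_sub_rpow_taylor_three (q - 1)).const_mul_left (-q)).congr_left fun x => ?_
  simp
  ring

theorem exp_taylor_three :
    (fun x : ℝ => Real.exp x - (1 + x + x ^ 2 / 2)) =O[𝓝 0] fun x => x ^ 3 := by
  refine (Real.exp_sub_sum_range_isBigO_pow 3).congr_left fun x => ?_
  simp [Finset.sum_range_succ, Nat.factorial]

variable {α : Type*} {l : Filter α}

/-- Along `l`, a quantity `f = O(xⁿ)` in a small parameter `x` is `xⁿ` times a bounded function. -/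
theorem exists_bounded_factor {f : ℝ → ℝ} {n : ℕ} (hf : f =O[𝓝 0] fun x => x ^ n) {x : α → ℝ}
    (hx : Tendsto x l (𝓝 0)) :
    ∃ g : α → ℝ, g =O[l] (fun _ => (1 : ℝ)) ∧ ∀ᶠ a in l, f (x a) = x a ^ n * g a := by
  obtain ⟨C, hC⟩ := (hf.comp_tendsto hx).bound
  refine ⟨fun a => f (x a) / x a ^ n, IsBigO.of_bound |C| ?_, ?_⟩
  · filter_upwards [hC] with a ha
    simp only [Function.comp] at ha
    rw [norm_div, norm_one, mul_one]
    refine div_le_of_le_mul₀ (norm_nonneg _) (abs_nonneg _) (ha.trans ?_)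
    gcongr
    exact le_abs_self C
  · filter_upwards [hC] with a ha
    simp only [Function.comp] at ha
    by_cases h : x a ^ n = 0
    · rw [h, norm_zero, mul_zero] at ha
      simp [h, norm_le_zero_iff.1 ha]
    · field_simp

theorem isBigO_one_mul {f g : α → ℝ} (hf : f =O[l] fun _ => (1 : ℝ))
    (hg : g =O[l] fun _ => (1 : ℝ)) : (fun a => f a * g a) =O[l] fun _ => (1 : ℝ) := by
  simpa using hf.mul hg

/-! ### Second order expansion of the normalized nonlinearity -/

/-- The normalized nonlinearity `(1 - εv)^q exp(((1 - εv)^p - 1)/ε + 2L)`. -/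
def Phi (p q ε L v : ℝ) : ℝ :=
  (1 - ε * v) ^ q * Real.exp (((1 - ε * v) ^ p - 1) / ε + 2 * L)

/-- First order coefficient of `Phi`. -/
def coeff₁ (p q L w : ℝ) : ℝ := 2 * (p - 1) / p * (2 * w + L ^ 2) - 2 * q * L / p

/-- Second order coefficient of `Phi`. -/
def coeff₂ (p q L w z : ℝ) : ℝ :=
  p * z - 8 * (p - 1) ^ 2 / p ^ 2 * L * w - 4 * (p - 1) * (p - 2) / (3 * p ^ 2) * L ^ 3
    + 2 * (p - 1) ^ 2 / p ^ 2 * (2 * w + L ^ 2) ^ 2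
    - 2 * q * L / p * (2 * (p - 1) / p * (2 * w + L ^ 2))
    + 4 * (p - 1) * q / p ^ 2 * w + 2 * q * (q - 1) * L ^ 2 / p ^ 2

/-- The exponent expanded to second order in `ε`. -/
def profileArg (p ε L w z : ℝ) : ℝ := 2 / p * L - ε * (4 * (p - 1) / p ^ 2 * w) - ε ^ 2 * z

theorem profileArg_scaled {p δ η l ω ζ : ℝ} (hη : η ≠ 0) :
    δ * η ^ 2 * profileArg p (δ * η ^ 2) (l / η) (ω / η) (ζ / η)
      = δ * (η * (2 / p * l - δ * η ^ 2 * (4 * (p - 1) / p ^ 2 * ω + δ * η ^ 2 * ζ))) := by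
  rw [profileArg]
  generalize 2 / p = c
  generalize 4 * (p - 1) / p ^ 2 = k
  field_simp
  ring

/-- The term `p * (c * l) / η` is `2 * L` in scaled variables. It cancels the leading linear part of
the exponent, so everything left is divisible by `δ`. -/
theorem exponent_identity {p c k δ η l ω ζ κ S V : ℝ} (hδ : δ ≠ 0) (hη : η ≠ 0)
    (hS : S = k * ω + δ * η ^ 2 * ζ) (hV : V = c * l - δ * η ^ 2 * S) :
    ((δ * (η * V)) ^ 4 * κ + (1 - p * (δ * (η * V)) + p * (p - 1) / 2 * (δ * (η * V)) ^ 2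
      - p * (p - 1) * (p - 2) / 6 * (δ * (η * V)) ^ 3) - 1) / (δ * η ^ 2) + p * (c * l) / η
    = δ * ((p * k * η * ω + p * (p - 1) / 2 * c ^ 2 * l ^ 2)
      + δ * (p * η ^ 3 * ζ - p * (p - 1) * c * k * η ^ 2 * l * ω
        - p * (p - 1) * (p - 2) / 6 * c ^ 3 * η * l ^ 3)
      + δ ^ 2 * (p * (p - 1) / 2 * (η ^ 4 * S ^ 2 - 2 * c * η ^ 4 * l * ζ)
        + p * (p - 1) * (p - 2) / 6 * η ^ 3 * S * (V ^ 2 + V * c * l + c ^ 2 * l ^ 2)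
        + η ^ 2 * V ^ 4 * κ)) := by
  -- Eliminating `c * l` and `k * ω` in favour of `V` and `S` keeps the polynomial identity small.
  have hX : c * l = V + δ * η ^ 2 * S := by rw [hV]; ring
  have hY : k * ω = S - δ * η ^ 2 * ζ := by rw [hS]; ring
  rw [show p * k * η * ω + p * (p - 1) / 2 * c ^ 2 * l ^ 2
      = p * η * (k * ω) + p * (p - 1) / 2 * (c * l) ^ 2 by ring,
    show p * η ^ 3 * ζ - p * (p - 1) * c * k * η ^ 2 * l * ω
      - p * (p - 1) * (p - 2) / 6 * c ^ 3 * η * l ^ 3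
      = p * η ^ 3 * ζ - p * (p - 1) * η ^ 2 * (c * l) * (k * ω)
      - p * (p - 1) * (p - 2) / 6 * η * (c * l) ^ 3 by ring,
    show η ^ 4 * S ^ 2 - 2 * c * η ^ 4 * l * ζ = η ^ 4 * S ^ 2 - 2 * η ^ 4 * (c * l) * ζ by ring,
    show V ^ 2 + V * c * l + c ^ 2 * l ^ 2 = V ^ 2 + V * (c * l) + (c * l) ^ 2 by ring, hX, hY]
  clear hX hY hS hV
  field_simp
  ring

theorem prefactor_identity {q c k δ η l ω ζ g S V : ℝ}
    (hS : S = k * ω + δ * η ^ 2 * ζ) (hV : V = c * l - δ * η ^ 2 * S) :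
    (δ * (η * V)) ^ 3 * g + (1 - q * (δ * (η * V)) + q * (q - 1) / 2 * (δ * (η * V)) ^ 2)
    = 1 + δ * (-q * η * c * l)
      + δ ^ 2 * (q * η ^ 3 * k * ω + q * (q - 1) / 2 * η ^ 2 * c ^ 2 * l ^ 2)
      + δ ^ 3 * (q * η ^ 5 * ζ
        + q * (q - 1) / 2 * (δ * η ^ 6 * S ^ 2 - 2 * η ^ 4 * c * l * S) + η ^ 3 * V ^ 3 * g) := by
  rw [show (δ * (η * V)) ^ 3 * g = δ ^ 3 * (η ^ 3 * V ^ 3 * g) by ring, hV]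
  generalize η ^ 3 * (c * l - δ * η ^ 2 * S) ^ 3 * g = Z
  have hY : k * ω = S - δ * η ^ 2 * ζ := by rw [hS]; ring
  linear_combination (-δ ^ 2 * q * η ^ 3) * hY

theorem exp_identity {δ e₁ e₂ G h : ℝ} :
    (δ * (e₁ + δ * e₂ + δ ^ 2 * G)) ^ 3 * h + (1 + δ * (e₁ + δ * e₂ + δ ^ 2 * G)
      + (δ * (e₁ + δ * e₂ + δ ^ 2 * G)) ^ 2 / 2)
    = 1 + δ * e₁ + δ ^ 2 * (e₂ + e₁ ^ 2 / 2) + δ ^ 3 * (G + e₁ * (e₂ + δ * G)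
      + δ * (e₂ + δ * G) ^ 2 * (1 / 2) + (e₁ + δ * e₂ + δ ^ 2 * G) ^ 3 * h) := by
  rw [mul_pow δ (e₁ + δ * e₂ + δ ^ 2 * G) 3, mul_assoc (δ ^ 3)]
  generalize (e₁ + δ * e₂ + δ ^ 2 * G) ^ 3 * h = Z
  ring

theorem product_identity {δ a₁ a₂ a₃ b₁ b₂ b₃ : ℝ} :
    δ ^ 3 * (a₃ + b₃ + a₁ * b₂ + a₂ * b₁ + δ * (a₁ * b₃ + a₂ * b₂ + a₃ * b₁)
      + δ ^ 2 * (a₂ * b₃ + a₃ * b₂) + δ ^ 3 * a₃ * b₃)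
    = (1 + δ * a₁ + δ ^ 2 * a₂ + δ ^ 3 * a₃) * (1 + δ * b₁ + δ ^ 2 * b₂ + δ ^ 3 * b₃)
      - (1 + δ * (a₁ + b₁) + δ ^ 2 * (a₂ + b₂ + a₁ * b₁)) := by
  ring

theorem coeff₁_scaled {p q η l ω δ : ℝ} (hp : p ≠ 0) (hη : η ≠ 0) :
    δ * η ^ 2 * coeff₁ p q (l / η) (ω / η) = δ * (-q * η * (2 / p) * l
      + (p * (4 * (p - 1) / p ^ 2) * η * ω + p * (p - 1) / 2 * (2 / p) ^ 2 * l ^ 2)) := by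
  rw [coeff₁]
  field_simp
  ring

theorem coeff₂_scaled {p q η l ω ζ δ : ℝ} (hp : p ≠ 0) (hη : η ≠ 0) :
    (δ * η ^ 2) ^ 2 * coeff₂ p q (l / η) (ω / η) (ζ / η) = δ ^ 2 *
      ((q * η ^ 3 * (4 * (p - 1) / p ^ 2) * ω + q * (q - 1) / 2 * η ^ 2 * (2 / p) ^ 2 * l ^ 2)
      + ((p * η ^ 3 * ζ - p * (p - 1) * (2 / p) * (4 * (p - 1) / p ^ 2) * η ^ 2 * l * ω
        - p * (p - 1) * (p - 2) / 6 * (2 / p) ^ 3 * η * l ^ 3)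
        + (p * (4 * (p - 1) / p ^ 2) * η * ω + p * (p - 1) / 2 * (2 / p) ^ 2 * l ^ 2) ^ 2 / 2)
      + (-q * η * (2 / p) * l)
        * (p * (4 * (p - 1) / p ^ 2) * η * ω + p * (p - 1) / 2 * (2 / p) ^ 2 * l ^ 2)) := by
  rw [coeff₂]
  field_simp
  ring

/-- In the scaled variables `δ = ε Λ²`, `η = 1/Λ`, `L/Λ`, `w/Λ`, `z/Λ`, prefactor and exponential
are polynomials in `δ` with bounded coefficients. All terms beyond second order therefore collect
into `δ³` times a bounded function, and `δ³ = ε³ Λ⁶`. -/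
theorem Phi_expansion {p : ℝ} (hp : p ≠ 0) (q : ℝ) {ε Λ L w z : α → ℝ}
    (hε : ∀ᶠ a in l, 0 < ε a) (hΛ : ∀ᶠ a in l, 1 ≤ Λ a)
    (hδ : Tendsto (fun a => ε a * Λ a ^ 2) l (𝓝 0)) (hL : L =O[l] Λ) (hw : w =O[l] Λ)
    (hz : z =O[l] Λ) :
    (fun a => Phi p q (ε a) (L a) (profileArg p (ε a) (L a) (w a) (z a))
      - (1 + ε a * coeff₁ p q (L a) (w a) + ε a ^ 2 * coeff₂ p q (L a) (w a) (z a)))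
      =O[l] fun a => ε a ^ 3 * Λ a ^ 6 := by
  set δ : α → ℝ := fun a => ε a * Λ a ^ 2 with hδd
  set η : α → ℝ := fun a => (Λ a)⁻¹ with hη
  have norm_one' : ∀ f : α → ℝ, f =O[l] Λ → (fun a => f a * η a) =O[l] fun _ => (1 : ℝ) := by
    intro f hf
    have h1 := hf.mul (isBigO_refl η l)
    refine h1.trans (IsBigO.of_bound 1 ?_)
    filter_upwards [hΛ] with a ha
    rw [hη, mul_inv_cancel₀ (by linarith)]; simp
  have bl := norm_one' L hL
  have bw := norm_one' w hw
  have bz := norm_one' z hz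
  set lL : α → ℝ := fun a => L a * η a
  set lw : α → ℝ := fun a => w a * η a
  set lz : α → ℝ := fun a => z a * η a
  have bη : η =O[l] fun _ => (1 : ℝ) := by
    refine IsBigO.of_bound 1 ?_
    filter_upwards [hΛ] with a ha
    rw [hη, norm_inv, norm_one, mul_one, Real.norm_eq_abs, abs_of_pos (by linarith)]
    exact inv_le_one_of_one_le₀ ha
  have bδ : δ =O[l] fun _ => (1 : ℝ) := hδ.isBigO_one ℝ
  have bc : ∀ c : ℝ, (fun _ : α => c) =O[l] fun _ => (1 : ℝ) := fun c =>
    isBigO_const_const c one_ne_zero l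
  set c : ℝ := 2 / p with hc
  set k : ℝ := 4 * (p - 1) / p ^ 2 with hk
  let S : α → ℝ := fun a => k * lw a + δ a * η a ^ 2 * lz a
  have bS : S =O[l] fun _ => (1 : ℝ) := by
    repeat
      first | assumption | apply bc | apply IsBigO.sub | apply IsBigO.add | apply isBigO_one_mul
  let V : α → ℝ := fun a => c * lL a - δ a * η a ^ 2 * S a
  have bV : V =O[l] fun _ => (1 : ℝ) := by
    repeat
      first | assumption | apply bc | apply IsBigO.sub | apply IsBigO.add | apply isBigO_one_mul
  let x : α → ℝ := fun a => δ a * (η a * V a)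
  have hx : Tendsto x l (𝓝 0) := by
    have h1 : x =O[l] δ := by
      simpa using (isBigO_refl δ l).mul (isBigO_one_mul bη bV)
    exact h1.trans_tendsto hδ
  -- Third order suffices for the prefactor, but the exponent needs fourth order, because it is
  -- divided by `ε`.
  obtain ⟨g, bg, hg⟩ := exists_bounded_factor (one_sub_rpow_taylor_three q) hx
  obtain ⟨k', bk', hk'⟩ := exists_bounded_factor (one_sub_rpow_taylor_four p) hx
  let e1 : α → ℝ := fun a => p * k * η a * lw a + p * (p - 1) / 2 * c ^ 2 * lL a ^ 2
  let e2 : α → ℝ := fun a => p * η a ^ 3 * lz a - p * (p - 1) * c * k * η a ^ 2 * lL a * lw a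
    - p * (p - 1) * (p - 2) / 6 * c ^ 3 * η a * lL a ^ 3
  let G : α → ℝ := fun a => p * (p - 1) / 2 * (η a ^ 4 * S a ^ 2 - 2 * c * η a ^ 4 * lL a * lz a)
    + p * (p - 1) * (p - 2) / 6 * η a ^ 3 * S a * (V a ^ 2 + V a * c * lL a + c ^ 2 * lL a ^ 2)
    + η a ^ 2 * V a ^ 4 * k' a
  have be1 : e1 =O[l] fun _ => (1 : ℝ) := by
    repeat
      first | assumption | apply bc | apply IsBigO.sub | apply IsBigO.add | apply isBigO_one_mul
  have be2 : e2 =O[l] fun _ => (1 : ℝ) := by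
    repeat
      first | assumption | apply bc | apply IsBigO.sub | apply IsBigO.add | apply isBigO_one_mul
  have bG : G =O[l] fun _ => (1 : ℝ) := by
    repeat
      first | assumption | apply bc | apply IsBigO.sub | apply IsBigO.add | apply isBigO_one_mul
  let E1 : α → ℝ := fun a => e1 a + δ a * e2 a + δ a ^ 2 * G a
  have bE1 : E1 =O[l] fun _ => (1 : ℝ) := by
    repeat
      first | assumption | apply bc | apply IsBigO.sub | apply IsBigO.add | apply isBigO_one_mul
  have hE : Tendsto (fun a => δ a * E1 a) l (𝓝 0) := by
    have h1 : (fun a => δ a * E1 a) =O[l] δ := by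
      simpa using (isBigO_refl δ l).mul bE1
    exact h1.trans_tendsto hδ
  obtain ⟨h, bh, hh⟩ := exists_bounded_factor exp_taylor_three hE
  -- The `a`'s are the coefficients of `δ, δ², δ³` in the prefactor; `e1`, `b2`, `b3` are those of
  -- the exponential. Only `a3` and `b3` contain Taylor remainders.
  let a1 : α → ℝ := fun a => -q * η a * c * lL a
  let a2 : α → ℝ := fun a => q * η a ^ 3 * k * lw a + q * (q - 1) / 2 * η a ^ 2 * c ^ 2 * lL a ^ 2
  let a3 : α → ℝ := fun a => q * η a ^ 5 * lz a
    + q * (q - 1) / 2 * (δ a * η a ^ 6 * S a ^ 2 - 2 * η a ^ 4 * c * lL a * S a)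
    + η a ^ 3 * V a ^ 3 * g a
  let b2 : α → ℝ := fun a => e2 a + e1 a ^ 2 / 2
  let b3 : α → ℝ := fun a => G a + e1 a * (e2 a + δ a * G a)
    + δ a * (e2 a + δ a * G a) ^ 2 * (1 / 2) + E1 a ^ 3 * h a
  have ba1 : a1 =O[l] fun _ => (1 : ℝ) := by
    repeat
      first | assumption | apply bc | apply IsBigO.sub | apply IsBigO.add | apply isBigO_one_mul
  have ba2 : a2 =O[l] fun _ => (1 : ℝ) := by
    repeat
      first | assumption | apply bc | apply IsBigO.sub | apply IsBigO.add | apply isBigO_one_mul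
  have ba3 : a3 =O[l] fun _ => (1 : ℝ) := by
    repeat
      first | assumption | apply bc | apply IsBigO.sub | apply IsBigO.add | apply isBigO_one_mul
  have bb2 : b2 =O[l] fun _ => (1 : ℝ) := by
    simp only [b2, div_eq_mul_inv]
    repeat
      first | assumption | apply bc | apply IsBigO.sub | apply IsBigO.add | apply isBigO_one_mul
  have bb3 : b3 =O[l] fun _ => (1 : ℝ) := by
    repeat
      first | assumption | apply bc | apply IsBigO.sub | apply IsBigO.add | apply isBigO_one_mul
  let r : α → ℝ := fun a => a3 a + b3 a + a1 a * b2 a + a2 a * e1 a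
    + δ a * (a1 a * b3 a + a2 a * b2 a + a3 a * e1 a)
    + δ a ^ 2 * (a2 a * b3 a + a3 a * b2 a) + δ a ^ 3 * a3 a * b3 a
  have br : r =O[l] fun _ => (1 : ℝ) := by
    repeat
      first | assumption | apply bc | apply IsBigO.sub | apply IsBigO.add | apply isBigO_one_mul
  have key : ∀ᶠ a in l, δ a ^ 3 * r a = Phi p q (ε a) (L a) (profileArg p (ε a) (L a) (w a) (z a))
      - (1 + ε a * coeff₁ p q (L a) (w a) + ε a ^ 2 * coeff₂ p q (L a) (w a) (z a)) := by
    filter_upwards [hε, hΛ, hg, hk', hh] with a hεa hΛa hga hka hha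
    have hΛ0 : Λ a ≠ 0 := by linarith
    have hη0 : η a ≠ 0 := inv_ne_zero hΛ0
    have hε0 : ε a ≠ 0 := hεa.ne'
    have eδ : ε a = δ a * η a ^ 2 := by simp only [hδd, hη]; field_simp
    have hδ0 : δ a ≠ 0 := fun h0 => hε0 (by rw [eδ, h0, zero_mul])
    have eL : L a = lL a / η a := by simp only [lL]; field_simp
    have ew : w a = lw a / η a := by simp only [lw]; field_simp
    have ez : z a = lz a / η a := by simp only [lz]; field_simp
    have ex : ε a * profileArg p (ε a) (L a) (w a) (z a) = x a := by
      rw [eL, ew, ez, eδ]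
      exact profileArg_scaled hη0
    have eE : ((1 - x a) ^ p - 1) / ε a + 2 * L a = δ a * E1 a := by
      have hcp : 2 * L a = p * (c * lL a) / η a := by rw [hc, eL]; field_simp
      rw [sub_eq_iff_eq_add] at hka
      rw [hka, hcp, eδ]
      exact exponent_identity hδ0 hη0 rfl rfl
    rw [sub_eq_iff_eq_add] at hga hha
    have hA : x a ^ 3 * g a + (1 - q * x a + q * (q - 1) / 2 * x a ^ 2)
        = 1 + δ a * a1 a + δ a ^ 2 * a2 a + δ a ^ 3 * a3 a := prefactor_identity rfl rfl
    have hB : (δ a * E1 a) ^ 3 * h a + (1 + δ a * E1 a + (δ a * E1 a) ^ 2 / 2)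
        = 1 + δ a * e1 a + δ a ^ 2 * b2 a + δ a ^ 3 * b3 a := exp_identity
    have hc1 : ε a * coeff₁ p q (L a) (w a) = δ a * (a1 a + e1 a) := by
      rw [eL, ew, eδ]
      exact coeff₁_scaled hp hη0
    have hc2 : ε a ^ 2 * coeff₂ p q (L a) (w a) (z a) = δ a ^ 2 * (a2 a + b2 a + a1 a * e1 a) := by
      rw [eL, ew, ez, eδ]
      exact coeff₂_scaled hp hη0
    rw [Phi, ex, eE, hga, hha, hA, hB, hc1, hc2]
    exact product_identity
  refine (IsBigO.congr' ((isBigO_refl (fun a => δ a ^ 3) l).mul br) key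
    (Eventually.of_forall fun a => ?_))
  simp only [hδd]; ring

/-! ### Uniform expansion of the nonlinearity near the approximate solution -/

/-- The triples `(γ, ρ, y)` with `γ → ∞`, `log (1 + ρ) ≤ √γ + 1` and `|y| ≤ 1`. -/
def tubeFilter : Filter (ℝ × ℝ × ℝ) :=
  comap Prod.fst atTop ⊓
    𝓟 {x | 0 ≤ x.2.1 ∧ Real.log (1 + x.2.1) ≤ √x.1 + 1 ∧ |x.2.2| ≤ 1}

/-- Along this filter an ordinary `O`-bound is a bound uniform in `ρ` and `y`, so the uniform
expansion follows from `Phi_expansion`. -/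
theorem eventually_tubeFilter {P : ℝ → ℝ → ℝ → Prop} :
    (∀ᶠ x in tubeFilter, P x.1 x.2.1 x.2.2) ↔ ∀ᶠ γ in atTop, ∀ ρ y : ℝ, 0 ≤ ρ →
      Real.log (1 + ρ) ≤ √γ + 1 → |y| ≤ 1 → P γ ρ y := by
  rw [tubeFilter, eventually_inf_principal, eventually_comap]
  refine eventually_congr (Eventually.of_forall fun γ => ?_)
  constructor
  · intro h ρ y h1 h2 h3
    exact h (γ, ρ, y) rfl ⟨h1, h2, h3⟩
  · rintro h ⟨γ', ρ, y⟩ rfl ⟨h1, h2, h3⟩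
    exact h ρ y h1 h2 h3

/-- Here `p > 1` meets the cutoff `t ≤ √γ`: the square is at most `9 γ`, leaving a multiple of
`γ^(-(p-1))`. The `2` is the unit in `Λ = 1 + log (1 + ρ)` plus the unit of room in the tube. -/
theorem tendsto_rpow_mul_sqrt {p : ℝ} (hp : 1 < p) :
    Tendsto (fun γ : ℝ => γ ^ (-p) * (√γ + 2) ^ 2) atTop (𝓝 0) := by
  have h1 : Tendsto (fun γ : ℝ => 9 * γ ^ (-(p - 1))) atTop (𝓝 0) := by
    simpa using (tendsto_rpow_neg_atTop (by linarith : 0 < p - 1)).const_mul 9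
  refine squeeze_zero' ?_ ?_ h1
  · filter_upwards [eventually_gt_atTop 0] with γ hγ
    positivity
  · filter_upwards [eventually_ge_atTop 1] with γ hγ
    have hs : 1 ≤ √γ := Real.one_le_sqrt.2 hγ
    have h2 : (√γ + 2) ^ 2 ≤ 9 * γ := by
      have := Real.sq_sqrt (by linarith : 0 ≤ γ)
      nlinarith
    have h3 : γ ^ (-(p - 1)) = γ ^ (-p) * γ := by
      rw [← Real.rpow_add_one (by linarith)]; ring_nf
    rw [h3]
    have : 0 ≤ γ ^ (-p) := by positivity
    nlinarith

section Tube

variable {p : ℝ} {W : ℝ → ℝ} {C : ℝ}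

theorem tube_log_nonneg : ∀ᶠ x in tubeFilter, 0 ≤ Real.log (1 + x.2.1) :=
  eventually_tubeFilter (P := fun _ ρ _ => 0 ≤ Real.log (1 + ρ)).2 <|
    Eventually.of_forall fun _ _ _ h _ _ => Real.log_nonneg (by linarith)

theorem tube_eps_pos : ∀ᶠ x in tubeFilter, 0 < x.1 ^ (-p) :=
  eventually_tubeFilter (P := fun γ _ _ => 0 < γ ^ (-p)).2 <| by
    filter_upwards [eventually_gt_atTop 0] with γ hγ _ _ _ _ _
    positivity

theorem tube_tendsto (hp : 1 < p) :
    Tendsto (fun x : ℝ × ℝ × ℝ => x.1 ^ (-p) * (1 + Real.log (1 + x.2.1)) ^ 2) tubeFilter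
      (𝓝 0) := by
  have h1 : Tendsto (fun x : ℝ × ℝ × ℝ => x.1) tubeFilter atTop :=
    tendsto_comap.mono_left inf_le_left
  refine squeeze_zero' ?_ ?_ ((tendsto_rpow_mul_sqrt hp).comp h1)
  · filter_upwards [tube_eps_pos (p := p)] with x hx
    positivity
  · refine eventually_tubeFilter (P := fun γ ρ _ => γ ^ (-p) * (1 + Real.log (1 + ρ)) ^ 2
      ≤ γ ^ (-p) * (√γ + 2) ^ 2).2 ?_
    filter_upwards [eventually_gt_atTop 0] with γ hγ ρ y h0 h1 _
    have h2 := Real.log_nonneg (by linarith : 1 ≤ 1 + ρ)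
    have h3 : 1 + Real.log (1 + ρ) ≤ √γ + 2 := by linarith
    gcongr

theorem tube_isBigO_log : (fun x : ℝ × ℝ × ℝ => Real.log (1 + x.2.1)) =O[tubeFilter]
    fun x => 1 + Real.log (1 + x.2.1) := by
  refine IsBigO.of_bound 1 ?_
  filter_upwards [tube_log_nonneg] with x hx
  rw [Real.norm_eq_abs, Real.norm_eq_abs, abs_of_nonneg hx, abs_of_nonneg (by linarith)]
  linarith

theorem tube_isBigO_of_growth (hW : ∀ ρ, 0 ≤ ρ → |W ρ| ≤ C * Real.log (1 + ρ)) :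
    (fun x : ℝ × ℝ × ℝ => W x.2.1) =O[tubeFilter] fun x => 1 + Real.log (1 + x.2.1) := by
  refine IsBigO.trans (IsBigO.of_bound C ?_) tube_isBigO_log
  refine eventually_tubeFilter (P := fun _ ρ _ => ‖W ρ‖ ≤ C * ‖Real.log (1 + ρ)‖).2 ?_
  filter_upwards with γ ρ y h0 _ _
  rw [Real.norm_eq_abs, Real.norm_eq_abs,
    abs_of_nonneg (Real.log_nonneg (by linarith : 1 ≤ 1 + ρ))]
  exact hW ρ h0

theorem tube_isBigO_add (hW : ∀ ρ, 0 ≤ ρ → |W ρ| ≤ C * Real.log (1 + ρ)) :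
    (fun x : ℝ × ℝ × ℝ => W x.2.1 + x.2.2) =O[tubeFilter]
      fun x => 1 + Real.log (1 + x.2.1) := by
  refine (tube_isBigO_of_growth hW).add (IsBigO.of_bound 1 ?_)
  refine eventually_tubeFilter (P := fun _ ρ y => ‖y‖ ≤ 1 * ‖1 + Real.log (1 + ρ)‖).2 ?_
  filter_upwards with γ ρ y h0 _ hy
  have := Real.log_nonneg (by linarith : 1 ≤ 1 + ρ)
  rw [Real.norm_eq_abs, Real.norm_eq_abs,
    abs_of_nonneg (by linarith : 0 ≤ 1 + Real.log (1 + ρ))]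
  linarith

/-- Uniform second order expansion of the nonlinearity in the tube around the approximate
solution. -/
theorem exists_uniform_expansion (hp : 1 < p) (q : ℝ)
    (hW : ∀ ρ, 0 ≤ ρ → |W ρ| ≤ C * Real.log (1 + ρ)) :
    ∃ K : ℝ, 0 < K ∧ ∀ᶠ γ in atTop, ∀ ρ y : ℝ, 0 ≤ ρ → Real.log (1 + ρ) ≤ √γ + 1 → |y| ≤ 1 →
      |Phi p q (γ ^ (-p)) (Real.log (1 + ρ))
          (profileArg p (γ ^ (-p)) (Real.log (1 + ρ)) (W₀ ρ) (W ρ + y))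
        - (1 + γ ^ (-p) * coeff₁ p q (Real.log (1 + ρ)) (W₀ ρ)
          + (γ ^ (-p)) ^ 2 * coeff₂ p q (Real.log (1 + ρ)) (W₀ ρ) (W ρ + y))|
        ≤ K * (γ ^ (-p)) ^ 3 * √(1 + ρ) := by
  obtain ⟨C₀, -, hC₀⟩ := exists_W₀_growth
  have h := Phi_expansion (l := tubeFilter) (by linarith : p ≠ 0) q
    (ε := fun x => x.1 ^ (-p)) (Λ := fun x => 1 + Real.log (1 + x.2.1))
    (L := fun x => Real.log (1 + x.2.1)) (w := fun x => W₀ x.2.1) (z := fun x => W x.2.1 + x.2.2)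
    tube_eps_pos (tube_log_nonneg.mono fun x hx => by linarith) (tube_tendsto hp)
    tube_isBigO_log (tube_isBigO_of_growth fun ρ hρ => (hC₀ ρ hρ).2) (tube_isBigO_add hW)
  obtain ⟨K, hK0, hK⟩ := h.exists_pos
  obtain ⟨M, hM, hMb⟩ := exists_one_add_log_pow_le 6
  refine ⟨K * M, by positivity, ?_⟩
  have := eventually_tubeFilter (P := fun γ ρ y => ‖Phi p q (γ ^ (-p)) (Real.log (1 + ρ))
          (profileArg p (γ ^ (-p)) (Real.log (1 + ρ)) (W₀ ρ) (W ρ + y))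
        - (1 + γ ^ (-p) * coeff₁ p q (Real.log (1 + ρ)) (W₀ ρ)
          + (γ ^ (-p)) ^ 2 * coeff₂ p q (Real.log (1 + ρ)) (W₀ ρ) (W ρ + y))‖
          ≤ K * ‖(γ ^ (-p)) ^ 3 * (1 + Real.log (1 + ρ)) ^ 6‖).1 hK.bound
  filter_upwards [this, eventually_gt_atTop 0] with γ h1 hγ ρ y h2 h3 h4
  refine (h1 ρ y h2 h3 h4).trans ?_
  have := Real.log_nonneg (by linarith : 1 ≤ 1 + ρ)
  have hε : 0 < γ ^ (-p) := by positivity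
  rw [Real.norm_eq_abs, abs_of_nonneg (by positivity)]
  calc K * ((γ ^ (-p)) ^ 3 * (1 + Real.log (1 + ρ)) ^ 6)
      ≤ K * ((γ ^ (-p)) ^ 3 * (M * √(1 + ρ))) := by gcongr; exact hMb ρ h2
    _ = _ := by ring

/-- This keeps the approximate solution between `γ/2` and `3γ/2`, where real powers are smooth and
solutions stay positive. -/
theorem eventually_profileArg_small (hp : 1 < p)
    (hW : ∀ ρ, 0 ≤ ρ → |W ρ| ≤ C * Real.log (1 + ρ)) :
    ∀ᶠ γ in atTop, ∀ ρ y : ℝ, 0 ≤ ρ → Real.log (1 + ρ) ≤ √γ + 1 → |y| ≤ 1 →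
      |γ ^ (-p) * profileArg p (γ ^ (-p)) (Real.log (1 + ρ)) (W₀ ρ) (W ρ + y)| ≤ 1 / 2 := by
  obtain ⟨C₀, -, hC₀⟩ := exists_W₀_growth
  have hε : Tendsto (fun x : ℝ × ℝ × ℝ => x.1 ^ (-p)) tubeFilter (𝓝 0) :=
    (tendsto_rpow_neg_atTop (by linarith : 0 < p)).comp
      (tendsto_comap.mono_left inf_le_left)
  have bε : (fun x : ℝ × ℝ × ℝ => x.1 ^ (-p)) =O[tubeFilter] fun _ => (1 : ℝ) := hε.isBigO_one ℝ
  have h1 : (fun x : ℝ × ℝ × ℝ => profileArg p (x.1 ^ (-p)) (Real.log (1 + x.2.1)) (W₀ x.2.1)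
      (W x.2.1 + x.2.2)) =O[tubeFilter] fun x => 1 + Real.log (1 + x.2.1) := by
    refine IsBigO.sub (IsBigO.sub (tube_isBigO_log.const_mul_left _) ?_) ?_
    · simpa using bε.mul ((tube_isBigO_of_growth fun ρ hρ => (hC₀ ρ hρ).2).const_mul_left
        (4 * (p - 1) / p ^ 2))
    · simpa using (bε.pow 2).mul (tube_isBigO_add hW)
  have h2 : (fun x : ℝ × ℝ × ℝ => x.1 ^ (-p) * profileArg p (x.1 ^ (-p)) (Real.log (1 + x.2.1))
      (W₀ x.2.1) (W x.2.1 + x.2.2)) =O[tubeFilter]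
      fun x => x.1 ^ (-p) * (1 + Real.log (1 + x.2.1)) ^ 2 := by
    refine (isBigO_refl _ _).mul (h1.trans (IsBigO.of_bound 1 ?_))
    filter_upwards [tube_log_nonneg] with x hx
    rw [one_mul, norm_pow, Real.norm_eq_abs, abs_of_nonneg (by linarith)]
    exact le_self_pow₀ (by linarith) (by norm_num)
  have h3 := (h2.trans_tendsto (tube_tendsto hp)).abs
  rw [abs_zero] at h3
  exact eventually_tubeFilter (P := fun γ ρ y => |γ ^ (-p) * profileArg p (γ ^ (-p))
    (Real.log (1 + ρ)) (W₀ ρ) (W ρ + y)| ≤ 1 / 2).1 (h3.eventually_le_const (by norm_num))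

end Tube

/-! ### The nonlinear equation in the variable `ρ` -/

/-- Expressing powers of `γ` through `γ` and `ε = γ^(-p)` turns the later verifications into
rational identities. -/
theorem rpow_sub_one_eq {γ p : ℝ} (hγ : 0 < γ) (n : ℕ) :
    γ ^ (n * p - 1) = (γ * (γ ^ (-p)) ^ n)⁻¹ := by
  rw [← Real.rpow_natCast, ← Real.rpow_mul hγ.le, Real.rpow_sub hγ, Real.rpow_one,
    show -p * (n : ℝ) = -(n * p) by ring, Real.rpow_neg hγ.le, mul_inv, inv_inv]
  ring

theorem rpow_nat_mul_eq {γ p : ℝ} (hγ : 0 < γ) (n : ℕ) :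
    γ ^ (n * p) = ((γ ^ (-p)) ^ n)⁻¹ := by
  rw [← Real.rpow_natCast, ← Real.rpow_mul hγ.le,
    show -p * (n : ℝ) = -(n * p) by ring, Real.rpow_neg hγ.le, inv_inv]

/-- The right hand side of the radial equation, `h₀ b - λ p b^{p-1} e^{b^p}`. -/
def nonlin (p h₀ lam b : ℝ) : ℝ := h₀ * b - lam * p * b ^ (p - 1) * Real.exp (b ^ p)

theorem contDiffOn_nonlin (p h₀ lam : ℝ) :
    ContDiffOn ℝ 1 (nonlin p h₀ lam) (Set.Ioi 0) := by
  have h : ∀ q : ℝ, ContDiffOn ℝ 1 (fun b : ℝ => b ^ q) (Set.Ioi 0) := fun q b hb =>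
    (Real.contDiffAt_rpow_const_of_ne (ne_of_gt hb)).contDiffWithinAt
  exact (contDiffOn_const.mul contDiffOn_id).sub
    ((contDiffOn_const.mul (h _)).mul (h p).exp)

theorem exists_nonlin_lipschitz (p h₀ lam : ℝ) {m M : ℝ} (hm : 0 < m) :
    ∃ K : ℝ, 0 < K ∧ ∀ x ∈ Set.Icc m M, ∀ y ∈ Set.Icc m M,
      |nonlin p h₀ lam x - nonlin p h₀ lam y| ≤ K * |x - y| := by
  have h1 : ContDiffOn ℝ 1 (nonlin p h₀ lam) (Set.Icc m M) :=
    (contDiffOn_nonlin p h₀ lam).mono fun x hx => hm.trans_le hx.1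
  obtain ⟨K, hK⟩ := h1.exists_lipschitzOnWith one_ne_zero (convex_Icc m M) isCompact_Icc
  refine ⟨K + 1, by positivity, fun x hx y hy => ?_⟩
  have := hK.dist_le_mul x hx y hy
  rw [Real.dist_eq, Real.dist_eq] at this
  nlinarith [abs_nonneg (x - y)]

/-- The exponential nonlinearity at `γ (1 - ε v)`, `ε = γ^{-p}`. -/
theorem exp_nonlinearity_eq {γ p q ρ v : ℝ} (hγ : 0 < γ) (hρ : 0 ≤ ρ)
    (hv : 0 < 1 - γ ^ (-p) * v) :
    (γ * (1 - γ ^ (-p) * v)) ^ q * Real.exp ((γ * (1 - γ ^ (-p) * v)) ^ p)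
      = γ ^ q * Real.exp (γ ^ p) / (1 + ρ) ^ 2
        * Phi p q (γ ^ (-p)) (Real.log (1 + ρ)) v := by
  have hu : 0 < 1 + ρ := by linarith
  have hε : 0 < γ ^ (-p) := by positivity
  have hγp : γ ^ p = (γ ^ (-p))⁻¹ := by rw [Real.rpow_neg hγ.le, inv_inv]
  rw [Phi, Real.mul_rpow hγ.le hv.le, Real.mul_rpow hγ.le hv.le, Real.exp_add,
    show 2 * Real.log (1 + ρ) = Real.log ((1 + ρ) ^ 2) by rw [Real.log_pow]; push_cast; ring,
    Real.exp_log (by positivity)]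
  have h1 : γ ^ p * (1 - γ ^ (-p) * v) ^ p
      = γ ^ p + ((1 - γ ^ (-p) * v) ^ p - 1) / γ ^ (-p) := by
    rw [hγp]; field_simp; ring
  rw [h1, Real.exp_add]
  field_simp

/-- On a closed subinterval both solutions take values in a compact subset of `(0, ∞)`, where the
nonlinearity is Lipschitz. The uniqueness lemma then applies, with the constant divided by `4` from
`Δ = -4 (ρ g')'`. -/
theorem IsBubble.eqOn {p h₀ lam γ R R' : ℝ} {b b' : ℝ → ℝ} (hb : IsBubble p h₀ lam γ R b)
    (hb' : IsBubble p h₀ lam γ R' b') : Set.EqOn b' b (Set.Ico 0 (min R' R)) := by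
  intro r hr
  set S := min R' R with hS
  have hS0 : 0 < S := lt_min hb'.radius_pos hb.radius_pos
  have hSR : Metric.ball (0 : Plane) S ⊆ Metric.ball 0 R :=
    Metric.ball_subset_ball (min_le_right _ _)
  have hSR' : Metric.ball (0 : Plane) S ⊆ Metric.ball 0 R' :=
    Metric.ball_subset_ball (min_le_left _ _)
  obtain ⟨A, q, hc, hk, hd, hl⟩ := exists_flux_of_contDiffOn hS0 (hb.contDiffOn.mono hSR)
  obtain ⟨A', q', hc', hk', hd', hl'⟩ := exists_flux_of_contDiffOn hS0 (hb'.contDiffOn.mono hSR')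
  have hr2 : r ^ 2 < S ^ 2 := pow_lt_pow_left₀ hr.2 hr.1 two_ne_zero
  have hsub : Set.Icc 0 (r ^ 2) ⊆ Set.Ico 0 (S ^ 2) := fun ρ hρ => ⟨hρ.1, hρ.2.trans_lt hr2⟩
  have hsub' : Set.Ioo 0 (r ^ 2) ⊆ Set.Ioo 0 (S ^ 2) := fun ρ hρ => ⟨hρ.1, hρ.2.trans hr2⟩
  have hpt : ∀ ρ ∈ Set.Ico 0 (S ^ 2), ∃ x ∈ Metric.ball (0 : Plane) S, ‖x‖ = √ρ ∧ ‖x‖ ^ 2 = ρ :=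
    fun ρ hρ => by
      obtain ⟨x, hx⟩ := exists_plane_norm_eq (Real.sqrt_nonneg ρ)
      refine ⟨x, ?_, hx, by rw [hx, Real.sq_sqrt hρ.1]⟩
      rw [mem_ball_zero_iff, hx, Real.sqrt_lt' hS0]
      exact hρ.2
  have hpos : ∀ ρ ∈ Set.Ico 0 (S ^ 2), 0 < b (√ρ) ∧ 0 < b' (√ρ) := fun ρ hρ => by
    obtain ⟨x, hx, hx1, -⟩ := hpt ρ hρ
    rw [← hx1]
    exact ⟨hb.pos x (hSR hx), hb'.pos x (hSR' hx)⟩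
  have hne : (Set.Icc 0 (r ^ 2)).Nonempty := ⟨0, le_rfl, by positivity⟩
  have hcI := hc.mono hsub
  have hcI' := hc'.mono hsub
  obtain ⟨ρ₁, h₁, hmin⟩ := isCompact_Icc.exists_isMinOn hne (hcI.inf hcI')
  obtain ⟨ρ₂, h₂, hmax⟩ := isCompact_Icc.exists_isMaxOn hne (hcI.sup hcI')
  obtain ⟨K, -, hK⟩ := exists_nonlin_lipschitz p h₀ lam (M := b (√ρ₂) ⊔ b' (√ρ₂))
    (lt_min (hpos ρ₁ (hsub h₁)).1 (hpos ρ₁ (hsub h₁)).2)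
  have hval : ∀ ρ ∈ Set.Icc 0 (r ^ 2),
      b (√ρ) ∈ Set.Icc (min (b (√ρ₁)) (b' (√ρ₁))) (b (√ρ₂) ⊔ b' (√ρ₂)) ∧
      b' (√ρ) ∈ Set.Icc (min (b (√ρ₁)) (b' (√ρ₁))) (b (√ρ₂) ⊔ b' (√ρ₂)) := fun ρ hρ => by
    have e1 : min (b (√ρ₁)) (b' (√ρ₁)) ≤ min (b (√ρ)) (b' (√ρ)) := hmin hρ
    have e2 : max (b (√ρ)) (b' (√ρ)) ≤ max (b (√ρ₂)) (b' (√ρ₂)) := hmax hρ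
    exact ⟨⟨e1.trans (min_le_left _ _), (le_max_left _ _).trans e2⟩,
      ⟨e1.trans (min_le_right _ _), (le_max_right _ _).trans e2⟩⟩
  have := eqOn_zero_of_flux (d := fun ρ => b' (√ρ) - b (√ρ)) (A := fun ρ => A' ρ - A ρ)
    (q := fun ρ => q' ρ - q ρ) (L := K / 4) (b := r ^ 2) (hcI'.sub hcI)
    (by simp [hb.center, hb'.center])
    (((hk'.sub hk).mono hsub).congr fun ρ _ => by simp only [Pi.sub_apply]; ring)
    (fun ρ hρ => (hd' ρ (hsub' hρ)).1.sub (hd ρ (hsub' hρ)).1)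
    (fun ρ hρ => ((hd' ρ (hsub' hρ)).2.sub (hd ρ (hsub' hρ)).2).congr_of_eventuallyEq
      (Eventually.of_forall fun σ => by simp only [Pi.sub_apply]; ring))
    (fun ρ hρ => ?_) (r ^ 2) ⟨by positivity, le_rfl⟩
  · simp only [Real.sqrt_sq hr.1] at this
    linarith
  · have hρI := Set.Ioo_subset_Icc_self hρ
    obtain ⟨x, hx, hx1, hx2⟩ := hpt ρ (hsub hρI)
    have hx0 : x ≠ 0 := by
      rw [← norm_pos_iff, hx1]; exact Real.sqrt_pos.2 hρ.1
    have e1 := hl x hx hx0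
    have e2 := hl' x hx hx0
    have f1 := hb.eqn x (hSR hx)
    have f2 := hb'.eqn x (hSR' hx)
    rw [e1, hx2, hx1] at f1
    rw [e2, hx2, hx1] at f2
    have h2 : q' ρ - q ρ = (nonlin p h₀ lam (b' (√ρ)) - nonlin p h₀ lam (b (√ρ))) / 4 := by
      simp only [nonlin]
      linear_combination (1 / 4 : ℝ) * f1 - (1 / 4 : ℝ) * f2
    rw [h2, abs_div, abs_of_pos (by norm_num : (0 : ℝ) < 4)]
    have := hK _ (hval ρ hρI).2 _ (hval ρ hρI).1
    linarith

/-- The factor `μ² / 4` is the Jacobian of `ρ = |x|² / μ²`, for which `Δ = -(4/μ²) (ρ g')'`. -/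
theorem FluxSol.isBubble {β A q : ℝ → ℝ} (h : FluxSol 1 β A q) {p h₀ lam γ μ b : ℝ} (hμ : 0 < μ)
    (hb : 0 < b) (h0 : β 0 = γ)
    (hpos : ∀ ρ ∈ Set.Icc 0 b, 0 < β ρ)
    (hq : ∀ ρ ∈ Set.Icc 0 b, q ρ = μ ^ 2 / 4 * nonlin p h₀ lam (β ρ)) :
    IsBubble p h₀ lam γ (μ * √b) fun r => β (r ^ 2 / μ ^ 2) := by
  have hs := h.comp_mul (κ := (μ ^ 2)⁻¹) (by positivity)
  have heq : (fun r : ℝ => β (r ^ 2 / μ ^ 2)) = fun r => β ((μ ^ 2)⁻¹ * r ^ 2) := by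
    ext r; rw [div_eq_inv_mul]
  have hdom : ∀ x ∈ Metric.ball (0 : Plane) (μ * √b), ‖x‖ ^ 2 / μ ^ 2 ∈ Set.Icc 0 b := by
    intro x hx
    rw [mem_ball_zero_iff] at hx
    refine ⟨by positivity, ?_⟩
    rw [div_le_iff₀ (by positivity)]
    calc ‖x‖ ^ 2 ≤ (μ * √b) ^ 2 := by gcongr
      _ = b * μ ^ 2 := by rw [mul_pow, Real.sq_sqrt hb.le]; ring
  refine ⟨by positivity, ?_, by simpa using h0, fun x hx => hpos _ (hdom x hx), fun x hx => ?_⟩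
  · rw [heq]
    exact (hs.contDiff (by positivity)).contDiffOn
  · rw [heq, hs.lap_eq (g := fun ρ => β ((μ ^ 2)⁻¹ * ρ)) (by positivity)]
    have h1 := hq _ (hdom x hx)
    rw [div_eq_inv_mul] at h1
    rw [h1, nonlin]
    field_simp
    ring

/-! ### The corrected approximate solution -/

/-- The approximate solution `γ - (2/p) γ^{1-p} L + … + γ^{1-3p} (W + y)` in the variable `ρ`. -/
def approx (p : ℝ) (W : ℝ → ℝ) (γ ρ y : ℝ) : ℝ :=
  γ * (1 - γ ^ (-p) * profileArg p (γ ^ (-p)) (Real.log (1 + ρ)) (W₀ ρ) (W ρ + y))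

/-- The flux density of the approximate solution with `y = 0`. -/
def approxSrc (p : ℝ) (qW : ℝ → ℝ) (γ ρ : ℝ) : ℝ :=
  -(γ * γ ^ (-p) * (2 / p)) * (1 / (1 + ρ) ^ 2)
    + γ * (γ ^ (-p)) ^ 2 * (4 * (p - 1) / p ^ 2)
      * (-(2 * W₀ ρ + (Real.log (1 + ρ) ^ 2 - Real.log (1 + ρ))) / (1 + ρ) ^ 2)
    + γ * (γ ^ (-p)) ^ 3 * qW ρ

theorem fluxSol_log : FluxSol 1 (fun ρ => Real.log (1 + ρ)) (fun ρ => 1 / (1 + ρ))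
    fun ρ => 1 / (1 + ρ) ^ 2 where
  deriv _ hρ := hasDerivAt_log_one_add hρ
  flux ρ hρ := by
    have hu : 1 + ρ ≠ 0 := by linarith
    have h := (hasDerivAt_id ρ).div ((hasDerivAt_id ρ).const_add 1) hu
    refine (h.congr_of_eventuallyEq (Eventually.of_forall fun σ => ?_)).congr_deriv ?_
    · simp [div_eq_mul_inv]
    · simp
  cont ρ hρ := continuousAt_const.div (by fun_prop) (by linarith)
  cont_src ρ hρ := continuousAt_const.div (by fun_prop) (pow_ne_zero 2 (by linarith))

theorem fluxSol_approx {p γ : ℝ} {W AW qW w A q : ℝ → ℝ} (hW : FluxSol 1 W AW qW)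
    (hw : FluxSol 1 w A q) : ∃ A', FluxSol 1 (fun ρ => approx p W γ ρ (w ρ)) A'
      fun ρ => approxSrc p qW γ ρ + γ * (γ ^ (-p)) ^ 3 * q ρ := by
  have h := ((((FluxSol.const 1 γ).add (fluxSol_log.const_mul (-(γ * γ ^ (-p) * (2 / p))))).add
    (fluxSol_W₀.const_mul (γ * (γ ^ (-p)) ^ 2 * (4 * (p - 1) / p ^ 2)))).add
    (hW.const_mul (γ * (γ ^ (-p)) ^ 3))).add (hw.const_mul (γ * (γ ^ (-p)) ^ 3))
  have e1 : (fun ρ => approx p W γ ρ (w ρ)) = fun ρ => γ + -(γ * γ ^ (-p) * (2 / p))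
      * Real.log (1 + ρ) + γ * (γ ^ (-p)) ^ 2 * (4 * (p - 1) / p ^ 2) * W₀ ρ
      + γ * (γ ^ (-p)) ^ 3 * W ρ + γ * (γ ^ (-p)) ^ 3 * w ρ := by
    ext ρ
    simp only [approx, profileArg]
    ring
  have e2 : (fun ρ => approxSrc p qW γ ρ + γ * (γ ^ (-p)) ^ 3 * q ρ) = fun ρ =>
      0 + -(γ * γ ^ (-p) * (2 / p)) * (1 / (1 + ρ) ^ 2)
      + γ * (γ ^ (-p)) ^ 2 * (4 * (p - 1) / p ^ 2)
      * (-(2 * W₀ ρ + (Real.log (1 + ρ) ^ 2 - Real.log (1 + ρ))) / (1 + ρ) ^ 2)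
      + γ * (γ ^ (-p)) ^ 3 * qW ρ + γ * (γ ^ (-p)) ^ 3 * q ρ := by
    ext ρ
    simp only [approxSrc]
    ring
  rw [e1, e2]
  exact ⟨_, h⟩

theorem lam_relation {p γ μ lam : ℝ} (hγ : 0 < γ)
    (hlam : lam * p ^ 2 * γ ^ (2 * (p - 1)) * μ ^ 2 * Real.exp (γ ^ p) = 8) :
    lam * p ^ 2 * μ ^ 2 * Real.exp (γ ^ p) = 8 * (γ * γ ^ (-p)) ^ 2 ∧
      γ ^ (p - 1) = (γ * γ ^ (-p))⁻¹ := by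
  have h1 : γ ^ (p - 1) = (γ * γ ^ (-p))⁻¹ := by
    simpa using rpow_sub_one_eq (p := p) hγ 1
  have h2 : γ ^ (2 * (p - 1)) = (γ ^ (p - 1)) ^ 2 := by
    rw [← Real.rpow_natCast, ← Real.rpow_mul hγ.le]; ring_nf
  have hε : 0 < γ ^ (-p) := by positivity
  refine ⟨?_, h1⟩
  rw [h2, h1] at hlam
  field_simp at hlam
  linear_combination hlam

/-- The rescaled defect of the approximate solution. -/
theorem defect_eq {p h₀ γ μ lam ρ y : ℝ} {W qW : ℝ → ℝ} (hp : 1 < p) (hγ : 0 < γ) (hρ : 0 ≤ ρ)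
    (hlam : lam * p ^ 2 * γ ^ (2 * (p - 1)) * μ ^ 2 * Real.exp (γ ^ p) = 8)
    (hqW : qW ρ = -(2 * W ρ + 4 * (p - 1) / p ^ 3 * F₁ p ρ) / (1 + ρ) ^ 2)
    (hpos : 0 < 1 - γ ^ (-p)
      * profileArg p (γ ^ (-p)) (Real.log (1 + ρ)) (W₀ ρ) (W ρ + y)) :
    (γ * (γ ^ (-p)) ^ 3)⁻¹ * (μ ^ 2 / 4 * nonlin p h₀ lam (approx p W γ ρ y) - approxSrc p qW γ ρ)
    = (γ * (γ ^ (-p)) ^ 3)⁻¹ * (μ ^ 2 / 4 * h₀ * approx p W γ ρ y) - 2 * y / (1 + ρ) ^ 2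
      - 2 / p * ((γ ^ (-p)) ^ 2)⁻¹ / (1 + ρ) ^ 2
        * (Phi p (p - 1) (γ ^ (-p)) (Real.log (1 + ρ))
          (profileArg p (γ ^ (-p)) (Real.log (1 + ρ)) (W₀ ρ) (W ρ + y))
        - (1 + γ ^ (-p) * coeff₁ p (p - 1) (Real.log (1 + ρ)) (W₀ ρ)
          + (γ ^ (-p)) ^ 2 * coeff₂ p (p - 1) (Real.log (1 + ρ)) (W₀ ρ) (W ρ + y))) := by
  obtain ⟨h1, h2⟩ := lam_relation hγ hlam
  have hu : 0 < 1 + ρ := by linarith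
  have hε : 0 < γ ^ (-p) := by positivity
  have h3 := exp_nonlinearity_eq (q := p - 1) hγ hρ hpos
  have hp0 : p ≠ 0 := by linarith
  have h4 : μ ^ 2 / 4 * nonlin p h₀ lam (approx p W γ ρ y) = μ ^ 2 / 4 * h₀ * approx p W γ ρ y
      - 2 / p * (γ * γ ^ (-p)) / (1 + ρ) ^ 2 * Phi p (p - 1) (γ ^ (-p)) (Real.log (1 + ρ))
          (profileArg p (γ ^ (-p)) (Real.log (1 + ρ)) (W₀ ρ) (W ρ + y)) := by
    rw [nonlin, mul_assoc (lam * p)]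
    conv_lhs => rw [show approx p W γ ρ y ^ (p - 1) * Real.exp (approx p W γ ρ y ^ p) = _ from h3]
    rw [h2]
    generalize Phi p (p - 1) _ _ _ = Φ
    generalize γ ^ (-p) = ε at *
    have h5 : lam * μ ^ 2 * Real.exp (γ ^ p) = 8 * (γ * ε) ^ 2 / p ^ 2 := by
      rw [eq_div_iff (by positivity)]; linear_combination h1
    have : μ ^ 2 / 4 * (lam * p * ((γ * ε)⁻¹ * Real.exp (γ ^ p) / (1 + ρ) ^ 2 * Φ))
        = (lam * μ ^ 2 * Real.exp (γ ^ p)) * p * (γ * ε)⁻¹ / (1 + ρ) ^ 2 * Φ / 4 := by ring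
    rw [mul_sub, this, h5]
    field_simp
    ring
  -- The orders `1`, `ε`, `ε²` of the expansion cancel against the sources of `log (1 + ρ)`, `W₀`
  -- and `W`. The only trace of `y` outside the error is the linear term from `p * y` in `coeff₂`.
  rw [h4, approxSrc, hqW]
  generalize Phi p (p - 1) _ _ _ = Φ
  generalize approx p W γ ρ y = b
  simp only [coeff₁, coeff₂, F₁]
  generalize γ ^ (-p) = ε at *
  generalize Real.log (1 + ρ) = L
  generalize W₀ ρ = w
  generalize W ρ = z
  field_simp
  ring

theorem lipschitz_clamp (y z : ℝ) : |max (-1) (min 1 y) - max (-1) (min 1 z)| ≤ |y - z| := by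
  have := ((LipschitzWith.id (α := ℝ)).const_min 1).const_max (-1)
  simpa [Real.dist_eq] using this.dist_le_mul y z

open Set in
/-- Existence of the remainder, with its bounds, by solving the equation with the remainder
truncated to `[-1, 1]`; the bounds show that the truncation is inactive. -/
theorem exists_remainder {p h₀ γ μ lam b K H : ℝ} {W AW qW : ℝ → ℝ} (hp : 1 < p) (hh₀ : 0 < h₀)
    (hγ : 0 < γ) (hμ : 0 < μ) (hb : 0 ≤ b) (hK : 0 < K) (hH : 0 < H)
    (hlam : lam * p ^ 2 * γ ^ (2 * (p - 1)) * μ ^ 2 * Real.exp (γ ^ p) = 8)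
    (hWs : FluxSol 1 W AW qW)
    (hqW : ∀ ρ, 0 ≤ ρ → qW ρ = -(2 * W ρ + 4 * (p - 1) / p ^ 3 * F₁ p ρ) / (1 + ρ) ^ 2)
    (hexp : ∀ ρ ∈ Icc 0 b, ∀ y : ℝ, |y| ≤ 1 →
      |Phi p (p - 1) (γ ^ (-p)) (Real.log (1 + ρ))
          (profileArg p (γ ^ (-p)) (Real.log (1 + ρ)) (W₀ ρ) (W ρ + y))
        - (1 + γ ^ (-p) * coeff₁ p (p - 1) (Real.log (1 + ρ)) (W₀ ρ)
          + (γ ^ (-p)) ^ 2 * coeff₂ p (p - 1) (Real.log (1 + ρ)) (W₀ ρ) (W ρ + y))|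
        ≤ K * (γ ^ (-p)) ^ 3 * √(1 + ρ))
    (hsmall : ∀ ρ ∈ Icc 0 b, ∀ y : ℝ, |y| ≤ 1 →
      |γ ^ (-p) * profileArg p (γ ^ (-p)) (Real.log (1 + ρ)) (W₀ ρ) (W ρ + y)| ≤ 1 / 2)
    (hscale : h₀ * μ ^ 2 * (1 + b) ≤ H * (γ ^ (-p)) ^ 4)
    (hone : 6 * Real.exp 8 * ((2 / p * K + H) * γ ^ (-p)) * Real.log (1 + b) ≤ 1) :
    ∃ w A q : ℝ → ℝ, FluxSol 1 w A q ∧ w 0 = 0 ∧ ∀ ρ ∈ Icc 0 b, |w ρ| ≤ 1 ∧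
      (1 + ρ) * |A ρ| ≤ 6 * Real.exp 8 * ((2 / p * K + H) * γ ^ (-p)) ∧
      |w ρ| ≤ 6 * Real.exp 8 * ((2 / p * K + H) * γ ^ (-p)) * Real.log (1 + ρ) ∧
      q ρ = (γ * (γ ^ (-p)) ^ 3)⁻¹
        * (μ ^ 2 / 4 * nonlin p h₀ lam (approx p W γ ρ (w ρ)) - approxSrc p qW γ ρ) := by
  set ε := γ ^ (-p) with hεd
  have hε : 0 < ε := by positivity
  have hrange : ∀ ρ ∈ Icc 0 b, ∀ y : ℝ, |y| ≤ 1 →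
      approx p W γ ρ y ∈ Icc (γ / 2) (3 * γ / 2) := fun ρ hρ y hy => by
    have := abs_le.1 (hsmall ρ hρ y hy)
    simp only [approx, ← hεd]
    constructor <;> nlinarith [this.1, this.2]
  obtain ⟨KN, hKN, hLip⟩ := exists_nonlin_lipschitz p h₀ lam (M := 3 * γ / 2) (half_pos hγ)
  -- Clamping `ρ` to `[0, b]` and `y` to `[-1, 1]` makes the right hand side bounded in `ρ` and
  -- globally Lipschitz in `y`.
  let P : ℝ → ℝ := fun τ => max 0 (min b τ)
  let cl : ℝ → ℝ := fun y => max (-1) (min 1 y)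
  have hP : ∀ τ, P τ ∈ Icc 0 b := fun τ => ⟨le_max_left _ _, max_le hb (min_le_left _ _)⟩
  have hPid : ∀ ρ ∈ Icc 0 b, P ρ = ρ := fun ρ hρ => by
    simp only [P, min_eq_right hρ.2, max_eq_right hρ.1]
  have hcl : ∀ y, |cl y| ≤ 1 := fun y =>
    abs_le.2 ⟨le_max_left _ _, max_le (by norm_num) (min_le_left _ _)⟩
  have hclid : ∀ y : ℝ, |y| ≤ 1 → cl y = y := fun y hy => by
    have := abs_le.1 hy
    simp only [cl, min_eq_right this.2, max_eq_right this.1]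
  have hclle : ∀ y, |cl y| ≤ |y| := fun y => by
    simpa [cl] using lipschitz_clamp y 0
  let f : ℝ → ℝ → ℝ := fun ρ y =>
    (γ * ε ^ 3)⁻¹ * (μ ^ 2 / 4 * nonlin p h₀ lam (approx p W γ ρ y) - approxSrc p qW γ ρ)
  have hPc : Continuous P := by fun_prop
  have hclc : Continuous cl := by fun_prop
  have hdom : ∀ τ, -1 < P τ := fun τ => by linarith [(hP τ).1]
  have cL : Continuous fun τ => Real.log (1 + P τ) :=
    Continuous.log (by fun_prop) fun τ => by linarith [hdom τ]
  have cW₀ : Continuous fun τ => W₀ (P τ) := continuous_iff_continuousAt.2 fun τ =>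
    ContinuousAt.comp (f := P) (fluxSol_W₀.deriv _ (hdom τ)).continuousAt hPc.continuousAt
  have cW : Continuous fun τ => W (P τ) := continuous_iff_continuousAt.2 fun τ =>
    ContinuousAt.comp (f := P) (hWs.deriv _ (hdom τ)).continuousAt hPc.continuousAt
  have cq : Continuous fun τ => qW (P τ) := continuous_iff_continuousAt.2 fun τ =>
    ContinuousAt.comp (f := P) (hWs.cont_src _ (hdom τ)) hPc.continuousAt
  have cS : Continuous fun τ => approxSrc p qW γ (P τ) := by
    have hu : ∀ τ, (1 + P τ) ^ 2 ≠ 0 := fun τ => pow_ne_zero 2 (by linarith [hdom τ])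
    unfold approxSrc
    refine ((continuous_const.mul (continuous_const.div (by fun_prop) hu)).add
      (continuous_const.mul (Continuous.div ?_ (by fun_prop) hu))).add (continuous_const.mul cq)
    fun_prop
  have cA : Continuous fun x : ℝ × ℝ => approx p W γ (P x.1) (cl x.2) := by
    have c1 := cL.comp (continuous_fst (X := ℝ) (Y := ℝ))
    have c2 := cW₀.comp (continuous_fst (X := ℝ) (Y := ℝ))
    have c3 := cW.comp (continuous_fst (X := ℝ) (Y := ℝ))
    have c4 := hclc.comp (continuous_snd (X := ℝ) (Y := ℝ))
    simp only [Function.comp_def] at c1 c2 c3 c4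
    exact continuous_const.mul (continuous_const.sub (continuous_const.mul
      (((continuous_const.mul c1).sub (continuous_const.mul (continuous_const.mul c2))).sub
        (continuous_const.mul (c3.add c4)))))
  have cf : Continuous (Function.uncurry fun τ y => f (P τ) (cl y)) := by
    have c1 : Continuous fun x : ℝ × ℝ => nonlin p h₀ lam (approx p W γ (P x.1) (cl x.2)) :=
      (contDiffOn_nonlin p h₀ lam).continuousOn.comp_continuous cA fun x =>
        (half_pos hγ).trans_le (hrange _ (hP _) _ (hcl _)).1
    have c2 := cS.comp (continuous_fst (X := ℝ) (Y := ℝ))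
    exact continuous_const.mul ((continuous_const.mul c1).sub c2)
  -- The three terms match the hypotheses of `FluxSol.bound`. The `3/8` is `1/4` times the bound
  -- `3γ/2` on the approximate solution, divided by `γ`.
  have hfb : ∀ ρ ∈ Icc 0 b, ∀ y, |y| ≤ 1 → |f ρ y| ≤ 2 * |y| / (1 + ρ) ^ 2
      + (2 / p * K + H) * ε / ((1 + ρ) * √(1 + ρ)) + 3 / 8 * h₀ * μ ^ 2 * (ε ^ 3)⁻¹ := by
    intro ρ hρ y hy
    have hu : 0 < 1 + ρ := by linarith [hρ.1]
    have hs : 0 < √(1 + ρ) := Real.sqrt_pos.2 hu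
    have h1 := abs_le.1 (hsmall ρ hρ y hy)
    have h2 : f ρ y = _ := defect_eq (h₀ := h₀) hp hγ hρ.1 hlam (hqW ρ hρ.1) (by linarith)
    have h3 := hexp ρ hρ y hy
    rw [h2]
    refine (abs_sub _ _).trans ?_
    refine (add_le_add (abs_sub _ _) le_rfl).trans ?_
    have e1 : |(γ * ε ^ 3)⁻¹ * (μ ^ 2 / 4 * h₀ * approx p W γ ρ y)|
        ≤ 3 / 8 * h₀ * μ ^ 2 * (ε ^ 3)⁻¹ := by
      have h4 := hrange ρ hρ y hy
      have h5 : 0 ≤ approx p W γ ρ y := by linarith [h4.1]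
      rw [abs_of_nonneg (by positivity)]
      calc (γ * ε ^ 3)⁻¹ * (μ ^ 2 / 4 * h₀ * approx p W γ ρ y)
          ≤ (γ * ε ^ 3)⁻¹ * (μ ^ 2 / 4 * h₀ * (3 * γ / 2)) := by gcongr; exact h4.2
        _ = _ := by field_simp; ring
    have e2 : |2 * y / (1 + ρ) ^ 2| = 2 * |y| / (1 + ρ) ^ 2 := by
      rw [abs_div, abs_mul, abs_two, abs_of_pos (pow_pos hu 2)]
    have e3 : |2 / p * (ε ^ 2)⁻¹ / (1 + ρ) ^ 2
        * (Phi p (p - 1) ε (Real.log (1 + ρ))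
          (profileArg p ε (Real.log (1 + ρ)) (W₀ ρ) (W ρ + y))
        - (1 + ε * coeff₁ p (p - 1) (Real.log (1 + ρ)) (W₀ ρ)
          + ε ^ 2 * coeff₂ p (p - 1) (Real.log (1 + ρ)) (W₀ ρ) (W ρ + y)))|
        ≤ (2 / p * K + H) * ε / ((1 + ρ) * √(1 + ρ)) := by
      rw [abs_mul, abs_of_pos (by positivity : 0 < 2 / p * (ε ^ 2)⁻¹ / (1 + ρ) ^ 2)]
      calc _ ≤ 2 / p * (ε ^ 2)⁻¹ / (1 + ρ) ^ 2 * (K * ε ^ 3 * √(1 + ρ)) := by gcongr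
        _ = 2 / p * K * ε / ((1 + ρ) * √(1 + ρ)) := by
          have hsq : (1 + ρ) = √(1 + ρ) ^ 2 := (Real.sq_sqrt hu.le).symm
          rw [hsq, Real.sqrt_sq hs.le]
          field_simp
        _ ≤ _ := by gcongr; linarith
    linarith
  obtain ⟨M, hM⟩ := (isCompact_Icc (a := (0 : ℝ)) (b := b)).exists_bound_of_continuousOn
    (f := fun ρ => f (P ρ) (cl 0))
    (cf.comp (f := fun ρ : ℝ => (ρ, (0 : ℝ))) (by fun_prop)).continuousOn
  obtain ⟨w, A, hw0, hw⟩ := exists_fluxSol (f := fun τ y => f (P τ) (cl y)) cf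
    (L := μ ^ 2 / 4 * KN) (M := M) (by positivity)
    (fun τ y z => by
      have h1 := hLip _ (hrange _ (hP τ) _ (hcl y)) _ (hrange _ (hP τ) _ (hcl z))
      have h2 : approx p W γ (P τ) (cl y) - approx p W γ (P τ) (cl z)
          = γ * ε ^ 3 * (cl y - cl z) := by
        simp only [approx, profileArg, ← hεd]; ring
      have h3 : f (P τ) (cl y) - f (P τ) (cl z) = (γ * ε ^ 3)⁻¹ * (μ ^ 2 / 4)
          * (nonlin p h₀ lam (approx p W γ (P τ) (cl y))
            - nonlin p h₀ lam (approx p W γ (P τ) (cl z))) := by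
        simp only [f]; ring
      rw [h2, abs_mul, abs_of_pos (by positivity : 0 < γ * ε ^ 3)] at h1
      rw [h3, abs_mul, abs_of_pos (by positivity : 0 < (γ * ε ^ 3)⁻¹ * (μ ^ 2 / 4))]
      calc _ ≤ (γ * ε ^ 3)⁻¹ * (μ ^ 2 / 4) * (KN * (γ * ε ^ 3 * |cl y - cl z|)) := by gcongr
        _ = μ ^ 2 / 4 * KN * |cl y - cl z| := by field_simp
        _ ≤ _ := mul_le_mul_of_nonneg_left (lipschitz_clamp y z) (by positivity))
    (fun τ => by
      have := hM (P τ) (hP τ)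
      rwa [hPid _ (hP τ), Real.norm_eq_abs] at this)
  have hest := (hw 1).bound (b := b) (η := (2 / p * K + H) * ε)
    (h := 3 / 8 * h₀ * μ ^ 2 * (ε ^ 3)⁻¹) (by positivity)
    (by
      calc 3 / 8 * h₀ * μ ^ 2 * (ε ^ 3)⁻¹ * (1 + b)
          = 3 / 8 * (ε ^ 3)⁻¹ * (h₀ * μ ^ 2 * (1 + b)) := by ring
        _ ≤ 3 / 8 * (ε ^ 3)⁻¹ * (H * ε ^ 4) := by gcongr
        _ = 3 / 8 * H * ε := by field_simp
        _ ≤ (2 / p * K + H) * ε := by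
          gcongr
          have : 0 < 2 / p * K := by positivity
          linarith)
    (by positivity) hw0
    (fun ρ hρ => by
      have h1 := hfb ρ hρ (cl (w ρ)) (hcl _)
      have h2 := hclle (w ρ)
      have hu : 0 < 1 + ρ := by linarith [hρ.1]
      simp only [hPid ρ hρ]
      refine h1.trans ?_
      gcongr)
  refine ⟨w, A, _, hw 1, hw0, fun ρ hρ => ?_⟩
  -- The a priori bound holds for the truncated problem; with `hone` it shows that the clamp on `y`
  -- was never active.
  have h1 : |w ρ| ≤ 1 := by
    refine (hest ρ hρ).2.trans (le_trans ?_ hone)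
    have : 0 < 1 + ρ := by linarith [hρ.1]
    gcongr
    exact hρ.2
  refine ⟨h1, (hest ρ hρ).1, (hest ρ hρ).2, ?_⟩
  simp only [hPid ρ hρ, hclid _ h1, f]

/-! ### The family of bubbles -/

/-- The standing assumptions on the scales `μ`, `rbar` and the parameter `lam`. -/
structure IsScaling (p : ℝ) (μ lam rbar : ℝ → ℝ) : Prop where
  μ_pos : ∀ᶠ γ in atTop, 0 < μ γ
  lam_eq : ∀ᶠ γ in atTop,
    lam γ * p ^ 2 * γ ^ (2 * (p - 1)) * μ γ ^ 2 * Real.exp (γ ^ p) = 8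
  rbar_pos : ∀ᶠ γ in atTop, 0 < rbar γ
  ratio : Tendsto (fun γ => μ γ / rbar γ) atTop (𝓝 0)
  tlog_le : ∀ᶠ γ in atTop, tlog (μ γ) (rbar γ) ≤ Real.sqrt γ
  rbar_small : (fun γ : ℝ => γ ^ (4 * p) * rbar γ ^ 2) =O[atTop] fun _ => (1 : ℝ)

theorem exists_bubble_family {p h₀ CW : ℝ} {W AW qW μ lam rbar : ℝ → ℝ} (hp : 1 < p)
    (hh₀ : 0 < h₀) (hWs : FluxSol 1 W AW qW) (hW0 : W 0 = 0)
    (hqW : ∀ ρ, 0 ≤ ρ → qW ρ = -(2 * W ρ + 4 * (p - 1) / p ^ 3 * F₁ p ρ) / (1 + ρ) ^ 2)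
    (hWg : ∀ ρ, 0 ≤ ρ → |W ρ| ≤ CW * Real.log (1 + ρ)) (hs : IsScaling p μ lam rbar) :
    ∃ C : ℝ, 0 < C ∧ ∀ᶠ γ in atTop, ∃ w A q : ℝ → ℝ, FluxSol 1 w A q ∧
      (∀ ρ ∈ Set.Icc 0 (rbar γ ^ 2 / μ γ ^ 2), |w ρ| ≤ 1 ∧ (1 + ρ) * |A ρ| ≤ C * γ ^ (-p) ∧
        |w ρ| ≤ C * γ ^ (-p) * Real.log (1 + ρ)) ∧
      ∃ R > rbar γ, IsBubble p h₀ (lam γ) γ R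
        fun r => approx p W γ (r ^ 2 / μ γ ^ 2) (w (r ^ 2 / μ γ ^ 2)) := by
  obtain ⟨K, hK, hexp⟩ := exists_uniform_expansion hp (p - 1) hWg
  obtain ⟨C', hC', hbig⟩ := hs.rbar_small.exists_pos
  set H : ℝ := 2 * h₀ * Real.exp 1 * C' with hH
  have hH0 : 0 < H := by positivity
  refine ⟨6 * Real.exp 8 * (2 / p * K + H), by positivity, ?_⟩
  -- This limit provides `hone`: the bound on the remainder over the whole interval drops below `1`.
  have hlim := (tendsto_rpow_mul_sqrt hp).const_mul (6 * Real.exp 8 * (2 / p * K + H))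
  rw [mul_zero] at hlim
  filter_upwards [hexp, eventually_profileArg_small hp hWg, hbig.bound, hs.μ_pos, hs.lam_eq,
    hs.rbar_pos, hs.tlog_le, hs.ratio.eventually_le_const (one_pos), eventually_gt_atTop 0,
    hlim.eventually_le_const (one_pos)] with γ hexp hsm hb hμ hlam hr ht hrat hγ hone
  have hε : 0 < γ ^ (-p) := by positivity
  -- The factor `e` extends the interval strictly beyond `r̄` while raising the logarithm by exactly
  -- `1`, the room left in the tube.
  set b : ℝ := Real.exp 1 * (1 + rbar γ ^ 2 / μ γ ^ 2) - 1 with hbd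
  have he : 1 < Real.exp 1 := Real.one_lt_exp_iff.2 one_pos
  have hq0 : 0 < rbar γ ^ 2 / μ γ ^ 2 := by positivity
  have hbgt : rbar γ ^ 2 / μ γ ^ 2 < b := by rw [hbd]; nlinarith
  have hb0 : 0 < b := hq0.trans hbgt
  have hlogb : Real.log (1 + b) = 1 + tlog (μ γ) (rbar γ) := by
    rw [hbd, add_sub_cancel, Real.log_mul (Real.exp_pos 1).ne' (by positivity), Real.log_exp, tlog]
  have hlogle : ∀ ρ ∈ Set.Icc 0 b, Real.log (1 + ρ) ≤ √γ + 1 := fun ρ hρ => by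
    have : Real.log (1 + ρ) ≤ Real.log (1 + b) :=
      Real.log_le_log (by linarith [hρ.1]) (by linarith [hρ.2])
    linarith
  have hμr : μ γ ≤ rbar γ := by rwa [div_le_one hr] at hrat
  have hscale : h₀ * μ γ ^ 2 * (1 + b) ≤ H * (γ ^ (-p)) ^ 4 := by
    have h1 : γ ^ (4 * p) * rbar γ ^ 2 ≤ C' := by
      rw [norm_one, mul_one, Real.norm_eq_abs] at hb
      exact (le_abs_self _).trans hb
    have h2 : γ ^ (4 * p) = ((γ ^ (-p)) ^ 4)⁻¹ := by
      simpa using rpow_nat_mul_eq (p := p) hγ 4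
    rw [h2, inv_mul_le_iff₀ (by positivity)] at h1
    calc h₀ * μ γ ^ 2 * (1 + b) = h₀ * Real.exp 1 * (μ γ ^ 2 + rbar γ ^ 2) := by
          rw [hbd]; field_simp; ring
      _ ≤ h₀ * Real.exp 1 * (rbar γ ^ 2 + rbar γ ^ 2) := by gcongr
      _ = 2 * h₀ * Real.exp 1 * rbar γ ^ 2 := by ring
      _ ≤ 2 * h₀ * Real.exp 1 * ((γ ^ (-p)) ^ 4 * C') := by gcongr
      _ = _ := by rw [hH]; ring
  obtain ⟨w, A, q, hw, hw0, hest⟩ := exists_remainder hp hh₀ hγ hμ hb0.le hK hH0 hlam hWs hqW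
    (fun ρ hρ y hy => hexp ρ y hρ.1 (hlogle ρ hρ) hy)
    (fun ρ hρ y hy => hsm ρ y hρ.1 (hlogle ρ hρ) hy) hscale
    (by
      refine le_trans ?_ hone
      have h1 := hlogle b ⟨hb0.le, le_rfl⟩
      have h2 : √γ + 1 ≤ (√γ + 2) ^ 2 := by nlinarith [Real.sqrt_nonneg γ]
      have h3 : 0 ≤ 6 * Real.exp 8 * (2 / p * K + H) * γ ^ (-p) := by positivity
      calc _ = 6 * Real.exp 8 * (2 / p * K + H) * γ ^ (-p) * Real.log (1 + b) := by ring
        _ ≤ 6 * Real.exp 8 * (2 / p * K + H) * γ ^ (-p) * (√γ + 2) ^ 2 :=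
          mul_le_mul_of_nonneg_left (h1.trans h2) h3
        _ = _ := by ring)
  refine ⟨w, A, q, hw, fun ρ hρ => ?_, μ γ * √b, ?_, ?_⟩
  · obtain ⟨h1, h2, h3, -⟩ := hest ρ ⟨hρ.1, hρ.2.trans hbgt.le⟩
    exact ⟨h1, h2.trans (le_of_eq (by ring)), h3.trans (le_of_eq (by ring))⟩
  · refine lt_of_pow_lt_pow_left₀ 2 (by positivity) ?_
    rw [mul_pow, Real.sq_sqrt hb0.le]
    rw [div_lt_iff₀ (by positivity)] at hbgt
    linarith
  · obtain ⟨A', hA'⟩ := fluxSol_approx (p := p) (γ := γ) hWs hw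
    refine hA'.isBubble hμ hb0 ?_ (fun ρ hρ => ?_) fun ρ hρ => ?_
    · simp [approx, profileArg, W₀_zero, hW0, hw0]
    · have h1 := abs_le.1 (hsm ρ (w ρ) hρ.1 (hlogle ρ hρ) (hest ρ hρ).1)
      exact mul_pos hγ (by linarith [h1.2])
    · rw [(hest ρ hρ).2.2.2]
      field_simp
      ring

/-! ### Pointwise estimates for the bubble -/

section Pointwise

variable {p γ μ lam : ℝ} {W AW qW w A q : ℝ → ℝ}

theorem remainder_approx (hp : 1 < p) (hγ : 0 < γ) (r : ℝ) :
    remainder p (fun r => W (r ^ 2)) γ μ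
      (fun r => approx p W γ (r ^ 2 / μ ^ 2) (w (r ^ 2 / μ ^ 2))) r = w (r ^ 2 / μ ^ 2) := by
  have e1 : γ ^ (p - 1) = (γ * γ ^ (-p))⁻¹ := by simpa using rpow_sub_one_eq (p := p) hγ 1
  have e2 : γ ^ (2 * p - 1) = (γ * (γ ^ (-p)) ^ 2)⁻¹ := by
    simpa using rpow_sub_one_eq (p := p) hγ 2
  have e3 : γ ^ (3 * p - 1) = (γ * (γ ^ (-p)) ^ 3)⁻¹ := by
    simpa using rpow_sub_one_eq (p := p) hγ 3
  have hε : 0 < γ ^ (-p) := by positivity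
  have hp0 : p ≠ 0 := by linarith
  simp only [remainder, w₀_eq, div_pow, tlog, approx, profileArg]
  rw [e1, e2, e3]
  field_simp
  ring

theorem hasDerivAt_sq_div (μ r : ℝ) :
    HasDerivAt (fun r : ℝ => r ^ 2 / μ ^ 2) (2 * r / μ ^ 2) r := by
  simpa using (hasDerivAt_pow 2 r).div_const (μ ^ 2)

theorem radialDeriv_tlog (μ : ℝ) {r : ℝ} (hr : 0 ≤ r) :
    radialDeriv (tlog μ) r = 1 / (1 + r ^ 2 / μ ^ 2) * (2 * r / μ ^ 2) := by
  have h0 : 0 ≤ r ^ 2 / μ ^ 2 := by positivity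
  have h := (hasDerivAt_log_one_add (by linarith : -1 < r ^ 2 / μ ^ 2)).comp r
    (hasDerivAt_sq_div μ r)
  exact h.hasDerivWithinAt.derivWithin (uniqueDiffOn_Ici 0 r hr)

/-- Since `t' = (2r/μ²) / (1 + ρ)`, the bound on `(1 + ρ) |A|` is exactly a bound of `w'` by `t'`.
Agreement slightly beyond `r` is needed for the derivative at `r`. -/
theorem remainder_bounds {C ρb : ℝ} {b : ℝ → ℝ} (hp : 1 < p) (hγ : 0 < γ)
    (hw : FluxSol 1 w A q)
    (hest : ∀ ρ ∈ Set.Icc 0 ρb, (1 + ρ) * |A ρ| ≤ C * γ ^ (-p) ∧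
        |w ρ| ≤ C * γ ^ (-p) * Real.log (1 + ρ)) {r S : ℝ} (hr : 0 ≤ r)
    (hrb : r ^ 2 / μ ^ 2 ≤ ρb) (hrS : r < S)
    (hB : Set.EqOn b (fun r => approx p W γ (r ^ 2 / μ ^ 2) (w (r ^ 2 / μ ^ 2)))
      (Set.Ico 0 S)) :
    |remainder p (fun r => W (r ^ 2)) γ μ b r| ≤ C * (γ ^ (-p) * tlog μ r) ∧
      |radialDeriv (remainder p (fun r => W (r ^ 2)) γ μ b) r|
        ≤ C * (γ ^ (-p) * radialDeriv (tlog μ) r) := by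
  have heq : ∀ s ∈ Set.Ico 0 S, remainder p (fun r => W (r ^ 2)) γ μ b s = w (s ^ 2 / μ ^ 2) :=
    fun s hs => by
      rw [← remainder_approx (W := W) (w := w) (μ := μ) hp hγ s]
      simp only [remainder]
      rw [hB hs]
  have h0 : 0 ≤ r ^ 2 / μ ^ 2 := by positivity
  obtain ⟨h1, h2⟩ := hest _ ⟨h0, hrb⟩
  constructor
  · rw [heq r ⟨hr, hrS⟩, tlog]
    linarith
  · have hd := (hw.deriv (r ^ 2 / μ ^ 2) (by linarith)).comp r (hasDerivAt_sq_div μ r)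
    have hd' : radialDeriv (remainder p (fun r => W (r ^ 2)) γ μ b) r
        = A (r ^ 2 / μ ^ 2) * (2 * r / μ ^ 2) := by
      refine HasDerivWithinAt.derivWithin (hd.hasDerivWithinAt.congr_of_eventuallyEq ?_
        (heq r ⟨hr, hrS⟩)) (uniqueDiffOn_Ici 0 r hr)
      filter_upwards [inter_mem_nhdsWithin (Set.Ici 0) (Iio_mem_nhds hrS)] with s hs
      exact heq s ⟨hs.1, hs.2⟩
    rw [hd', radialDeriv_tlog μ hr, abs_mul, abs_of_nonneg (by positivity : 0 ≤ 2 * r / μ ^ 2)]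
    calc |A (r ^ 2 / μ ^ 2)| * (2 * r / μ ^ 2)
        ≤ (C * γ ^ (-p) / (1 + r ^ 2 / μ ^ 2)) * (2 * r / μ ^ 2) := by
          gcongr
          rw [le_div_iff₀ (by linarith)]
          linarith
      _ = _ := by ring

theorem lap_comp_div {a : ℝ} {g A q : ℝ → ℝ} (h : FluxSol a g A q) (ha : 0 < a) (hμ : 0 < μ)
    (x : Plane) : lap (fun r => g (r ^ 2 / μ ^ 2)) x = -4 * q (‖x‖ ^ 2 / μ ^ 2) / μ ^ 2 := by
  have hs := h.comp_mul (κ := (μ ^ 2)⁻¹) (by positivity)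
  have heq : (fun r : ℝ => g (r ^ 2 / μ ^ 2)) = fun r => g ((μ ^ 2)⁻¹ * r ^ 2) := by
    ext r; rw [div_eq_inv_mul]
  rw [heq, hs.lap_eq (g := fun ρ => g ((μ ^ 2)⁻¹ * ρ)) (by positivity)]
  rw [div_eq_inv_mul (‖x‖ ^ 2)]
  field_simp

theorem coeff₂_add (p q L w z y : ℝ) : coeff₂ p q L w (z + y) = coeff₂ p q L w z + p * y := by
  rw [coeff₂, coeff₂]; ring

/-- Dropping `y` from the second coefficient costs `ε² p |y|`. As `y = O(ε log (1 + ρ))`, this has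
the size of the third order error. -/
theorem Phi_expansion_center {C K ρ Φ c y : ℝ} (hp : 1 < p) (hγ : 0 < γ) (hρ : 0 ≤ ρ)
    (hC : 0 < C)
    {L z v : ℝ} {q : ℝ}
    (h : |Φ - (1 + γ ^ (-p) * c + (γ ^ (-p)) ^ 2 * coeff₂ p q L v (z + y))|
      ≤ K * (γ ^ (-p)) ^ 3 * √(1 + ρ))
    (hy : |y| ≤ C * γ ^ (-p) * Real.log (1 + ρ)) :
    |Φ - (1 + γ ^ (-p) * c + (γ ^ (-p)) ^ 2 * coeff₂ p q L v z)|
      ≤ (K + p * C) * (γ ^ (-p)) ^ 3 * √(1 + ρ) := by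
  have hε : 0 < γ ^ (-p) := by positivity
  have hu : 0 < 1 + ρ := by linarith
  have hs : 0 < √(1 + ρ) := Real.sqrt_pos.2 hu
  have hlog : Real.log (1 + ρ) ≤ √(1 + ρ) := by
    refine (log_one_add_le_div_sqrt hρ).trans ?_
    rw [div_le_iff₀ hs, Real.mul_self_sqrt hu.le]
    linarith
  rw [coeff₂_add] at h
  have e : Φ - (1 + γ ^ (-p) * c + (γ ^ (-p)) ^ 2 * coeff₂ p q L v z)
      = Φ - (1 + γ ^ (-p) * c + (γ ^ (-p)) ^ 2 * (coeff₂ p q L v z + p * y))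
        + (γ ^ (-p)) ^ 2 * p * y := by ring
  rw [e]
  refine (abs_add_le _ _).trans ?_
  rw [abs_mul, abs_of_pos (by positivity : 0 < (γ ^ (-p)) ^ 2 * p)]
  calc _ ≤ K * (γ ^ (-p)) ^ 3 * √(1 + ρ)
        + (γ ^ (-p)) ^ 2 * p * (C * γ ^ (-p) * √(1 + ρ)) := by
        refine add_le_add h (mul_le_mul_of_nonneg_left (hy.trans ?_) (by positivity))
        gcongr
    _ = _ := by ring

theorem nonlinearity_expansion {C K : ℝ} {b : ℝ → ℝ} (hp : 1 < p) (hγ : 0 < γ) (hμ : 0 < μ)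
    (hC : 0 < C)
    (hlam : lam * p ^ 2 * γ ^ (2 * (p - 1)) * μ ^ 2 * Real.exp (γ ^ p) = 8)
    (hWs : FluxSol 1 W AW qW)
    (hqW : ∀ ρ, 0 ≤ ρ → qW ρ = -(2 * W ρ + 4 * (p - 1) / p ^ 3 * F₁ p ρ) / (1 + ρ) ^ 2)
    (x : Plane)
    (hexp : ∀ y : ℝ, |y| ≤ 1 →
      |Phi p (p - 1) (γ ^ (-p)) (Real.log (1 + ‖x‖ ^ 2 / μ ^ 2))
          (profileArg p (γ ^ (-p)) (Real.log (1 + ‖x‖ ^ 2 / μ ^ 2)) (W₀ (‖x‖ ^ 2 / μ ^ 2))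
            (W (‖x‖ ^ 2 / μ ^ 2) + y))
        - (1 + γ ^ (-p) * coeff₁ p (p - 1) (Real.log (1 + ‖x‖ ^ 2 / μ ^ 2)) (W₀ (‖x‖ ^ 2 / μ ^ 2))
          + (γ ^ (-p)) ^ 2 * coeff₂ p (p - 1) (Real.log (1 + ‖x‖ ^ 2 / μ ^ 2))
            (W₀ (‖x‖ ^ 2 / μ ^ 2)) (W (‖x‖ ^ 2 / μ ^ 2) + y))|
        ≤ K * (γ ^ (-p)) ^ 3 * √(1 + ‖x‖ ^ 2 / μ ^ 2))
    (hsmall : ∀ y : ℝ, |y| ≤ 1 →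
      |γ ^ (-p) * profileArg p (γ ^ (-p)) (Real.log (1 + ‖x‖ ^ 2 / μ ^ 2)) (W₀ (‖x‖ ^ 2 / μ ^ 2))
        (W (‖x‖ ^ 2 / μ ^ 2) + y)| ≤ 1 / 2)
    (hw1 : |w (‖x‖ ^ 2 / μ ^ 2)| ≤ 1)
    (hw : |w (‖x‖ ^ 2 / μ ^ 2)| ≤ C * γ ^ (-p) * Real.log (1 + ‖x‖ ^ 2 / μ ^ 2))
    (hB : b ‖x‖ = approx p W γ (‖x‖ ^ 2 / μ ^ 2) (w (‖x‖ ^ 2 / μ ^ 2))) :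
    ∃ θ : ℝ, |θ| ≤ (K + p * C) * (Real.exp (tlog μ ‖x‖ / 2) / γ ^ (3 * p)) ∧
      lam * p * b ‖x‖ ^ (p - 1) * Real.exp (b ‖x‖ ^ p) =
        -(2 / (p * γ ^ (p - 1))) * lap (tlog μ) x * (1 + θ)
          + 4 * (p - 1) / (p ^ 2 * γ ^ (2 * p - 1)) * lap (fun r => w₀ (r / μ)) x
          + lap (fun r => W ((r / μ) ^ 2)) x / γ ^ (3 * p - 1) := by
  have hlap1 : lap (tlog μ) x = _ := lap_comp_div fluxSol_log one_pos hμ x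
  have hlap2 : lap (fun r => w₀ (r / μ)) x = -4 * (-(2 * W₀ (‖x‖ ^ 2 / μ ^ 2)
      + (Real.log (1 + ‖x‖ ^ 2 / μ ^ 2) ^ 2 - Real.log (1 + ‖x‖ ^ 2 / μ ^ 2)))
      / (1 + ‖x‖ ^ 2 / μ ^ 2) ^ 2) / μ ^ 2 := by
    simp only [w₀_eq, div_pow]
    exact lap_comp_div fluxSol_W₀ one_pos hμ x
  have hlap3 : lap (fun r => W ((r / μ) ^ 2)) x = -4 * qW (‖x‖ ^ 2 / μ ^ 2) / μ ^ 2 := by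
    simp only [div_pow]
    exact lap_comp_div hWs one_pos hμ x
  have hρ : 0 ≤ ‖x‖ ^ 2 / μ ^ 2 := by positivity
  have ht : tlog μ ‖x‖ = Real.log (1 + ‖x‖ ^ 2 / μ ^ 2) := rfl
  rw [hlap1, hlap2, hlap3, hqW _ hρ, hB, ht]
  generalize ‖x‖ ^ 2 / μ ^ 2 = ρ at *
  have hu : 0 < 1 + ρ := by linarith
  have hε : 0 < γ ^ (-p) := by positivity
  have hpos : 0 < 1 - γ ^ (-p)
      * profileArg p (γ ^ (-p)) (Real.log (1 + ρ)) (W₀ ρ) (W ρ + w ρ) := by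
    linarith [(abs_le.1 (hsmall _ hw1)).2]
  have hcen := Phi_expansion_center (y := w ρ) hp hγ hρ hC (hexp _ hw1) hw
  have h3 := exp_nonlinearity_eq (q := p - 1) hγ hρ hpos
  obtain ⟨h1, h2⟩ := lam_relation hγ hlam
  have e2 : γ ^ (2 * p - 1) = (γ * (γ ^ (-p)) ^ 2)⁻¹ := by
    simpa using rpow_sub_one_eq (p := p) hγ 2
  have e3 : γ ^ (3 * p - 1) = (γ * (γ ^ (-p)) ^ 3)⁻¹ := by
    simpa using rpow_sub_one_eq (p := p) hγ 3
  have e4 : γ ^ (3 * p) = ((γ ^ (-p)) ^ 3)⁻¹ := by simpa using rpow_nat_mul_eq (p := p) hγ 3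
  -- The whole error of the expansion of `Phi` is attributed to the leading term `Δ t`. The
  -- coefficients of orders `ε` and `ε²` are the sources of `w₀` and `w₁`, corrected by lower order
  -- terms that their equations contain.
  refine ⟨Phi p (p - 1) (γ ^ (-p)) (Real.log (1 + ρ))
      (profileArg p (γ ^ (-p)) (Real.log (1 + ρ)) (W₀ ρ) (W ρ + w ρ))
      - (1 + γ ^ (-p) * coeff₁ p (p - 1) (Real.log (1 + ρ)) (W₀ ρ)
        + (γ ^ (-p)) ^ 2 * coeff₂ p (p - 1) (Real.log (1 + ρ)) (W₀ ρ) (W ρ)), ?_, ?_⟩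
  · refine hcen.trans (le_of_eq ?_)
    rw [Real.exp_half, Real.exp_log hu, e4]
    field_simp
  · rw [mul_assoc (lam * p)]
    conv_lhs => rw [show approx p W γ ρ (w ρ) ^ (p - 1) * Real.exp (approx p W γ ρ (w ρ) ^ p)
      = _ from h3]
    rw [h2, e2, e3]
    generalize Phi p (p - 1) _ _ _ = Φ
    simp only [coeff₁, coeff₂, F₁]
    generalize γ ^ (-p) = ε at *
    have h5 : lam * Real.exp (γ ^ p) = 8 * (γ * ε) ^ 2 / (p ^ 2 * μ ^ 2) := by
      rw [eq_div_iff (by positivity)]; linear_combination h1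
    have h6 : lam * p * ((γ * ε)⁻¹ * Real.exp (γ ^ p) / (1 + ρ) ^ 2 * Φ)
        = (lam * Real.exp (γ ^ p)) * p * (γ * ε)⁻¹ / (1 + ρ) ^ 2 * Φ := by ring
    rw [h6, h5]
    generalize Real.log (1 + ρ) = L
    generalize W₀ ρ = v
    generalize W ρ = z
    field_simp
    ring

end Pointwise

/-! ### Improper integrals on the half line -/

/-- `f` has an antiderivative on `[0, ∞)` that vanishes at `0` and tends to `ℓ` at infinity. -/
def HasImproperIntegral (f : ℝ → ℝ) (ℓ : ℝ) : Prop :=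
  ∃ Ψ : ℝ → ℝ, (∀ ρ, 0 ≤ ρ → HasDerivAt Ψ (f ρ) ρ) ∧ Ψ 0 = 0 ∧ Tendsto Ψ atTop (𝓝 ℓ)

theorem HasImproperIntegral.of_hasDerivAt {f G : ℝ → ℝ} {ℓ : ℝ}
    (hG : ∀ ρ, 0 ≤ ρ → HasDerivAt G (f ρ) ρ) (hlim : Tendsto G atTop (𝓝 ℓ)) :
    HasImproperIntegral f (ℓ - G 0) :=
  ⟨fun ρ => G ρ - G 0, fun ρ hρ => (hG ρ hρ).sub_const _, sub_self _, hlim.sub_const _⟩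

theorem HasImproperIntegral.add {f g : ℝ → ℝ} {a b : ℝ} (hf : HasImproperIntegral f a)
    (hg : HasImproperIntegral g b) : HasImproperIntegral (fun ρ => f ρ + g ρ) (a + b) := by
  obtain ⟨Φ, h1, h2, h3⟩ := hf
  obtain ⟨Ψ, k1, k2, k3⟩ := hg
  exact ⟨fun ρ => Φ ρ + Ψ ρ, fun ρ hρ => (h1 ρ hρ).add (k1 ρ hρ), by simp [h2, k2], h3.add k3⟩

theorem HasImproperIntegral.const_mul {f : ℝ → ℝ} {a : ℝ} (c : ℝ)
    (hf : HasImproperIntegral f a) : HasImproperIntegral (fun ρ => c * f ρ) (c * a) := by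
  obtain ⟨Φ, h1, h2, h3⟩ := hf
  exact ⟨fun ρ => c * Φ ρ, fun ρ hρ => (h1 ρ hρ).const_mul c, by simp [h2], h3.const_mul c⟩

theorem HasImproperIntegral.congr {f g : ℝ → ℝ} {a b : ℝ} (hf : HasImproperIntegral f a)
    (h : ∀ ρ, 0 ≤ ρ → g ρ = f ρ) (hab : b = a) : HasImproperIntegral g b := by
  obtain ⟨Φ, h1, h2, h3⟩ := hf
  exact ⟨Φ, fun ρ hρ => h ρ hρ ▸ h1 ρ hρ, h2, hab ▸ h3⟩

theorem hasDerivAt_inv_sqrt_one_add {ρ : ℝ} (hρ : 0 ≤ ρ) :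
    HasDerivAt (fun ρ : ℝ => (√(1 + ρ))⁻¹) (-(√(1 + ρ) / (1 + ρ) ^ 2) / 2) ρ := by
  have hu : 0 < 1 + ρ := by linarith
  have hs : √(1 + ρ) ≠ 0 := (Real.sqrt_pos.2 hu).ne'
  have h := ((Real.hasDerivAt_sqrt hu.ne').comp ρ ((hasDerivAt_id ρ).const_add 1)).fun_inv hs
  refine h.congr_deriv ?_
  have h2 : (1 + ρ) = √(1 + ρ) ^ 2 := (Real.sq_sqrt hu.le).symm
  simp only [Function.comp]
  rw [show (1 + ρ) ^ 2 = (√(1 + ρ) ^ 2) ^ 2 by rw [← h2]]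
  field_simp

/-- For each sign `σ`, the function `σ Ψ + 2 C (1 + ρ)^(-1/2)` is antitone, so its value at `b`
dominates its limit. -/
theorem HasImproperIntegral.tail_le {f : ℝ → ℝ} {ℓ C : ℝ} (hf : HasImproperIntegral f ℓ)
    (hcont : ContinuousOn f (Set.Ici 0))
    (hC : ∀ ρ, 0 ≤ ρ → |f ρ| ≤ C * (√(1 + ρ) / (1 + ρ) ^ 2)) {b : ℝ} (hb : 0 ≤ b) :
    |(∫ ρ in (0 : ℝ)..b, f ρ) - ℓ| ≤ 2 * C * (√(1 + b))⁻¹ := by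
  obtain ⟨Ψ, h1, h2, h3⟩ := hf
  have hint : ∫ ρ in (0 : ℝ)..b, f ρ = Ψ b := by
    rw [intervalIntegral.integral_eq_sub_of_hasDerivAt (f := Ψ), h2, sub_zero]
    · intro ρ hρ
      rw [Set.uIcc_of_le hb] at hρ
      exact h1 ρ hρ.1
    · refine ContinuousOn.intervalIntegrable (hcont.mono ?_)
      rw [Set.uIcc_of_le hb]
      exact Set.Icc_subset_Ici_self
  have hs : Tendsto (fun ρ : ℝ => (√(1 + ρ))⁻¹) atTop (𝓝 0) :=
    (Real.tendsto_sqrt_atTop.comp (tendsto_atTop_add_const_left _ 1 tendsto_id)).inv_tendsto_atTop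
  have key : ∀ σ : ℝ, |σ| = 1 → σ * (ℓ - Ψ b) ≤ 2 * C * (√(1 + b))⁻¹ := fun σ hσ => by
    have hd : ∀ ρ, 0 ≤ ρ → HasDerivAt (fun ρ => σ * Ψ ρ + 2 * C * (√(1 + ρ))⁻¹)
        (σ * f ρ + 2 * C * (-(√(1 + ρ) / (1 + ρ) ^ 2) / 2)) ρ := fun ρ hρ =>
      ((h1 ρ hρ).const_mul σ).add ((hasDerivAt_inv_sqrt_one_add hρ).const_mul _)
    have hanti : AntitoneOn (fun ρ => σ * Ψ ρ + 2 * C * (√(1 + ρ))⁻¹) (Set.Ici 0) := by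
      refine antitoneOn_of_hasDerivWithinAt_nonpos (convex_Ici 0)
        (fun ρ hρ => (hd ρ hρ).continuousAt.continuousWithinAt)
        (fun ρ hρ => (hd ρ (interior_subset hρ)).hasDerivWithinAt) fun ρ hρ => ?_
      have h := hC ρ (interior_subset hρ)
      have h' : σ * f ρ ≤ |f ρ| := by
        refine (le_abs_self _).trans ?_
        rw [abs_mul, hσ, one_mul]
      linarith
    have hlim := (h3.const_mul σ).add (hs.const_mul (2 * C))
    have := le_of_tendsto hlim ((eventually_ge_atTop b).mono fun ρ hρ =>
      hanti (Set.mem_Ici.2 hb) (Set.mem_Ici.2 (hb.trans hρ)) hρ)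
    simp only at this
    linarith
  rw [hint, abs_le]
  have k1 := key 1 (by norm_num)
  have k2 := key (-1) (by norm_num)
  constructor <;> linarith

/-! ### Elementary limits and integrals -/

theorem tendsto_inv_one_add : Tendsto (fun ρ : ℝ => 1 / (1 + ρ)) atTop (𝓝 0) := by
  simp only [one_div]
  exact (tendsto_atTop_add_const_left _ (1 : ℝ) tendsto_id).inv_tendsto_atTop

theorem tendsto_div_one_add : Tendsto (fun ρ : ℝ => ρ / (1 + ρ)) atTop (𝓝 1) := by
  have h := tendsto_inv_one_add.const_sub 1
  rw [sub_zero] at h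
  refine h.congr' ((eventually_ge_atTop 0).mono fun ρ hρ => ?_)
  have : 1 + ρ ≠ 0 := by positivity
  field_simp
  ring

theorem tendsto_log_pow_div (n : ℕ) :
    Tendsto (fun ρ : ℝ => Real.log (1 + ρ) ^ n / (1 + ρ)) atTop (𝓝 0) := by
  have h := (Real.isLittleO_pow_log_id_atTop (n := n)).tendsto_div_nhds_zero
  exact h.comp (tendsto_atTop_add_const_left _ (1 : ℝ) tendsto_id)

theorem hasDerivAt_one_div_one_add {ρ : ℝ} (hρ : -1 < ρ) :
    HasDerivAt (fun ρ : ℝ => 1 / (1 + ρ)) (-(1 / (1 + ρ) ^ 2)) ρ := by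
  have h := ((hasDerivAt_id ρ).const_add 1).fun_inv (by simp; linarith : 1 + id ρ ≠ 0)
  simpa [neg_div] using h

theorem hasImproperIntegral_one : HasImproperIntegral (fun ρ => 1 / (1 + ρ) ^ 2) 1 := by
  refine (HasImproperIntegral.of_hasDerivAt (G := fun ρ => -(1 / (1 + ρ)))
    (fun ρ hρ => ((hasDerivAt_one_div_one_add (by linarith)).neg)) tendsto_inv_one_add.neg).congr
    (fun ρ _ => by ring) (by norm_num)

/-- With `s = log (1 + ρ)` this is `∫ sⁿ e^(-s) ds`, and the next family is `∫ sⁿ e^(-2s) ds`; both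
go by parts. -/
theorem hasImproperIntegral_log_pow (n : ℕ) :
    HasImproperIntegral (fun ρ => Real.log (1 + ρ) ^ n / (1 + ρ) ^ 2) n.factorial := by
  induction n with
  | zero => simpa using hasImproperIntegral_one
  | succ n ih =>
    have h := HasImproperIntegral.of_hasDerivAt
      (G := fun ρ => -(Real.log (1 + ρ) ^ (n + 1) * (1 / (1 + ρ))))
      (fun ρ hρ => (((hasDerivAt_log_one_add (by linarith : -1 < ρ)).pow (n + 1)).mul
        (hasDerivAt_one_div_one_add (by linarith))).neg)
      (by simpa [← div_eq_mul_inv] using (tendsto_log_pow_div (n + 1)).neg)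
    refine (h.add (ih.const_mul (n + 1))).congr (fun ρ hρ => ?_) ?_
    · have hu : 1 + ρ ≠ 0 := by positivity
      simp only [Pi.pow_apply, Nat.add_sub_cancel]
      push_cast
      field_simp
      ring
    · simp [Nat.factorial_succ]

theorem hasImproperIntegral_log_pow_cube (n : ℕ) :
    HasImproperIntegral (fun ρ => Real.log (1 + ρ) ^ n / (1 + ρ) ^ 3)
      (n.factorial / 2 ^ (n + 1)) := by
  induction n with
  | zero =>
    have h := HasImproperIntegral.of_hasDerivAt
      (G := fun ρ => -(1 / 2 * (1 / (1 + ρ) * (1 / (1 + ρ)))))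
      (fun ρ hρ => (((hasDerivAt_one_div_one_add (by linarith)).mul
        (hasDerivAt_one_div_one_add (by linarith : -1 < ρ))).const_mul (1 / 2)).neg)
      (((tendsto_inv_one_add.mul tendsto_inv_one_add).const_mul (1 / 2)).neg)
    refine h.congr (fun ρ hρ => ?_) (by norm_num)
    have hu : 1 + ρ ≠ 0 := by positivity
    field_simp
    ring
  | succ n ih =>
    have h := HasImproperIntegral.of_hasDerivAt
      (G := fun ρ => -(1 / 2 * (Real.log (1 + ρ) ^ (n + 1) * (1 / (1 + ρ)) * (1 / (1 + ρ)))))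
      (fun ρ hρ => (((((hasDerivAt_log_one_add (by linarith : -1 < ρ)).pow (n + 1)).mul
        (hasDerivAt_one_div_one_add (by linarith))).mul
        (hasDerivAt_one_div_one_add (by linarith))).const_mul (1 / 2)).neg)
      (ℓ := 0) (by
        have := ((tendsto_log_pow_div (n + 1)).mul tendsto_inv_one_add).const_mul (1 / 2)
        simpa [← div_eq_mul_inv] using this.neg)
    refine (h.add (ih.const_mul ((n + 1) / 2))).congr (fun ρ hρ => ?_) ?_
    · have hu : 1 + ρ ≠ 0 := by positivity
      simp only [Pi.pow_apply, Pi.mul_apply, Nat.add_sub_cancel]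
      push_cast
      field_simp
      ring
    · simp [Nat.factorial_succ]
      ring

/-! ### The dilogarithm at infinity -/

theorem summable_one_div_succ_sq : Summable fun n : ℕ => 1 / ((n : ℝ) + 1) ^ 2 := by
  have h := (summable_nat_add_iff 1).2 (Real.summable_one_div_nat_pow.2 (one_lt_two))
  simpa using h

theorem tsum_one_div_succ_sq : ∑' n : ℕ, 1 / ((n : ℝ) + 1) ^ 2 = Real.pi ^ 2 / 6 := by
  rw [← hasSum_zeta_two.tsum_eq, (Real.summable_one_div_nat_pow.2 one_lt_two).tsum_eq_zero_add]
  simp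

theorem hasDerivAt_tsum_pow_div_sq {x : ℝ} (hx : |x| < 1) :
    HasDerivAt (fun y : ℝ => ∑' n : ℕ, y ^ (n + 1) / ((n : ℝ) + 1) ^ 2)
      (∑' n : ℕ, x ^ n / ((n : ℝ) + 1)) x := by
  obtain ⟨r, hr, hr1⟩ := exists_between hx
  have hr0 : 0 < r := (abs_nonneg x).trans_lt hr
  refine hasDerivAt_tsum_of_isPreconnected (u := fun n => r ^ n)
    (g := fun (n : ℕ) (y : ℝ) => y ^ (n + 1) / ((n : ℝ) + 1) ^ 2)
    (g' := fun (n : ℕ) (y : ℝ) => y ^ n / ((n : ℝ) + 1))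
    (summable_geometric_of_lt_one hr0.le hr1) (t := Metric.ball 0 r) Metric.isOpen_ball
    (convex_ball 0 r).isPreconnected (fun n y _ => ?_) (fun n y hy => ?_) (y₀ := 0)
    (by simpa using hr0) ?_ (by simpa using hr)
  · refine ((hasDerivAt_pow (n + 1) y).div_const _).congr_deriv ?_
    have : (n : ℝ) + 1 ≠ 0 := by positivity
    push_cast
    field_simp
  · have hy' : |y| < r := by simpa using hy
    rw [Real.norm_eq_abs, abs_div, abs_pow, abs_of_pos (by positivity : (0 : ℝ) < (n : ℝ) + 1)]
    refine (div_le_self (by positivity) (by linarith [(Nat.cast_nonneg n : (0 : ℝ) ≤ n)])).trans ?_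
    gcongr
  · simp

theorem mul_tsum_pow_div {x : ℝ} (hx : |x| < 1) :
    x * ∑' n : ℕ, x ^ n / ((n : ℝ) + 1) = -Real.log (1 - x) := by
  rw [← (Real.hasSum_pow_div_log_of_abs_lt_one hx).tsum_eq, ← tsum_mul_left]
  congr 1
  ext n
  ring

/-- Landen's identity: `dil ρ = Li₂(-ρ)` and the right side is `-Li₂(ρ/(1 + ρ))`, with an argument
inside the disc of convergence. The difference vanishes at `0` and has zero derivative for `s > 0`.
-/
theorem dil_add_log_sq {ρ : ℝ} (hρ : 0 ≤ ρ) : dil ρ + Real.log (1 + ρ) ^ 2 / 2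
    = -∑' n : ℕ, (ρ / (1 + ρ)) ^ (n + 1) / ((n : ℝ) + 1) ^ 2 := by
  set G : ℝ → ℝ := fun ρ => dil ρ + Real.log (1 + ρ) ^ 2 / 2
    + ∑' n : ℕ, (ρ / (1 + ρ)) ^ (n + 1) / ((n : ℝ) + 1) ^ 2 with hG
  have hx : ∀ s : ℝ, 0 ≤ s → |s / (1 + s)| < 1 := fun s hs => by
    rw [abs_of_nonneg (by positivity), div_lt_one (by positivity)]
    linarith
  have hd : ∀ s : ℝ, 0 ≤ s → HasDerivAt G (-dslope Real.log 1 (1 + s)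
      + Real.log (1 + s) / (1 + s)
      + (∑' n : ℕ, (s / (1 + s)) ^ n / ((n : ℝ) + 1)) * (1 / (1 + s) ^ 2)) s := fun s hs => by
    have hs1 : -1 < s := by linarith
    have hu : 1 + s ≠ 0 := by positivity
    have h1 : HasDerivAt (fun s : ℝ => s / (1 + s)) (1 / (1 + s) ^ 2) s := by
      refine ((hasDerivAt_id s).fun_div ((hasDerivAt_id s).const_add 1) hu).congr_deriv ?_
      simp
    have h2 := (hasDerivAt_tsum_pow_div_sq (hx s hs)).comp s h1
    refine (((hasDerivAt_dil hs1).add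
      (((hasDerivAt_log_one_add hs1).pow 2).div_const 2)).add h2).congr_deriv ?_
    simp only [Nat.add_one_sub_one]
    push_cast
    ring
  have hG0 : G 0 = 0 := by simp [hG, dil_zero]
  rcases hρ.eq_or_lt with rfl | hpos
  · simp only [hG] at hG0
    linarith
  · obtain ⟨s, hs, heq⟩ := exists_hasDerivAt_eq_slope G _ hpos
      (fun s hs => (hd s hs.1).continuousAt.continuousWithinAt) fun s hs => hd s hs.1.le
    have hs0 : 0 < s := hs.1
    have hu : 1 + s ≠ 0 := by positivity
    have h1 := mul_dslope_log s
    have h2 := mul_tsum_pow_div (hx s hs0.le)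
    have h3 : 1 - s / (1 + s) = (1 + s)⁻¹ := by field_simp; ring
    rw [h3, Real.log_inv, neg_neg] at h2
    have h4 : (-dslope Real.log 1 (1 + s) + Real.log (1 + s) / (1 + s)
      + (∑' n : ℕ, (s / (1 + s)) ^ n / ((n : ℝ) + 1)) * (1 / (1 + s) ^ 2)) = 0 := by
      generalize (∑' n : ℕ, (s / (1 + s)) ^ n / ((n : ℝ) + 1)) = S at *
      have h5 : s * S = Real.log (1 + s) * (1 + s) := by
        field_simp at h2; linear_combination h2
      refine (mul_eq_zero.1 ?_).resolve_left hs0.ne'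
      calc _ = -(s * dslope Real.log 1 (1 + s)) + s * Real.log (1 + s) / (1 + s)
            + s * S / (1 + s) ^ 2 := by ring
        _ = 0 := by
          rw [h1, h5]
          field_simp
          ring
    rw [h4, hG0, sub_zero, sub_zero, eq_comm, div_eq_zero_iff] at heq
    have : G ρ = 0 := heq.resolve_right hpos.ne'
    simp only [hG] at this
    linarith

/-- The series converges uniformly on `[0, 1]`, so the limit is its value at `1`, namely `ζ(2)`. -/
theorem tendsto_dil_add_log_sq :
    Tendsto (fun ρ => dil ρ + Real.log (1 + ρ) ^ 2 / 2) atTop (𝓝 (-(Real.pi ^ 2 / 6))) := by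
  have hc : ContinuousOn (fun y : ℝ => ∑' n : ℕ, y ^ (n + 1) / ((n : ℝ) + 1) ^ 2)
      (Set.Icc 0 1) := by
    refine continuousOn_tsum (fun n => by fun_prop) summable_one_div_succ_sq fun n y hy => ?_
    rw [Real.norm_eq_abs, abs_of_nonneg (div_nonneg (pow_nonneg hy.1 _) (by positivity))]
    gcongr
    exact pow_le_one₀ hy.1 hy.2
  have h1 : Tendsto (fun ρ : ℝ => ρ / (1 + ρ)) atTop (𝓝[Set.Icc 0 1] 1) := by
    refine tendsto_nhdsWithin_iff.2 ⟨tendsto_div_one_add,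
      (eventually_ge_atTop 0).mono fun ρ hρ => ⟨by positivity, ?_⟩⟩
    rw [div_le_one (by positivity)]
    linarith
  have h2 := ((hc 1 (by simp)).tendsto.comp h1).neg
  simp only [one_pow, tsum_one_div_succ_sq] at h2
  refine h2.congr' ((eventually_ge_atTop 0).mono fun ρ hρ => ?_)
  exact (dil_add_log_sq hρ).symm

/-! ### Integrals involving the correction profiles -/

/-- The logarithmic square is regrouped with `dil`, whose own growth it cancels at infinity. -/
theorem W₀_eq_of_dil {ρ : ℝ} (hρ : -1 < ρ) : W₀ ρ = -Real.log (1 + ρ) + 2 * (ρ / (1 + ρ))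
    - (dil ρ + Real.log (1 + ρ) ^ 2 / 2)
    + 2 * (dil ρ + Real.log (1 + ρ) ^ 2 / 2) * (1 / (1 + ρ))
    - Real.log (1 + ρ) ^ 2 * (1 / (1 + ρ)) := by
  have hu : 1 + ρ ≠ 0 := by linarith
  rw [W₀]
  field_simp
  ring

theorem tendsto_log_pow_mul_W₀_div (n : ℕ) :
    Tendsto (fun ρ : ℝ => Real.log (1 + ρ) ^ n * W₀ ρ / (1 + ρ)) atTop (𝓝 0) := by
  have h0 := tendsto_log_pow_div n
  have h1 := tendsto_log_pow_div (n + 1)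
  have h2 := tendsto_log_pow_div (n + 2)
  have h := ((((h1.neg).add ((tendsto_div_one_add.mul h0).const_mul 2)).sub
    (tendsto_dil_add_log_sq.mul h0)).add
    (((tendsto_dil_add_log_sq.mul h0).mul tendsto_inv_one_add).const_mul 2)).sub
    (h2.mul tendsto_inv_one_add)
  simp only [mul_zero, neg_zero, add_zero, sub_zero] at h
  refine h.congr' ((eventually_ge_atTop 0).mono fun ρ hρ => ?_)
  have hu : 1 + ρ ≠ 0 := by positivity
  beta_reduce
  rw [W₀_eq_of_dil (by linarith : -1 < ρ)]
  ring

theorem tendsto_W₀_sq_div :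
    Tendsto (fun ρ : ℝ => W₀ ρ ^ 2 / (1 + ρ)) atTop (𝓝 0) := by
  have h0 := tendsto_log_pow_mul_W₀_div 0
  have h1 := tendsto_log_pow_mul_W₀_div 1
  have h2 := tendsto_log_pow_mul_W₀_div 2
  have h := ((((h1.neg).add ((tendsto_div_one_add.mul h0).const_mul 2)).sub
    (tendsto_dil_add_log_sq.mul h0)).add
    (((tendsto_dil_add_log_sq.mul h0).mul tendsto_inv_one_add).const_mul 2)).sub
    (h2.mul tendsto_inv_one_add)
  simp only [mul_zero, neg_zero, add_zero, sub_zero] at h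
  refine h.congr' ((eventually_ge_atTop 0).mono fun ρ hρ => ?_)
  have hu : 1 + ρ ≠ 0 := by positivity
  linear_combination (-(W₀ ρ / (1 + ρ))) * W₀_eq_of_dil (by linarith : -1 < ρ)

theorem tendsto_P₀ : Tendsto P₀ atTop (𝓝 (-1)) := by
  have h1 := tendsto_log_pow_div 1
  have h2 := tendsto_log_pow_div 2
  have h := ((((tendsto_div_one_add.neg).add
    ((tendsto_div_one_add.mul tendsto_inv_one_add).const_mul 2)).sub
    (((tendsto_div_one_add.mul tendsto_inv_one_add).mul tendsto_dil_add_log_sq).const_mul 2)).add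
    (tendsto_div_one_add.mul h2)).sub h1
  simp only [mul_zero, zero_mul, add_zero, sub_zero] at h
  refine h.congr' ((eventually_ge_atTop 0).mono fun ρ hρ => ?_)
  have hu : 1 + ρ ≠ 0 := by positivity
  rw [P₀]
  field_simp
  ring

/-- `∫ (2 W₀ + L²) / (1 + ρ)² = 2`. -/
theorem hasImproperIntegral_profile :
    HasImproperIntegral (fun ρ => (2 * W₀ ρ + Real.log (1 + ρ) ^ 2) / (1 + ρ) ^ 2) 2 := by
  -- The equation of `W₀` gives `1` for the integrand with an extra `-L`, and `∫ L / (1 + ρ)² = 1`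
  -- is added back.
  have h := HasImproperIntegral.of_hasDerivAt (G := fun ρ => -P₀ ρ)
    (fun ρ hρ => (hasDerivAt_P₀ (by linarith : -1 < ρ)).neg) tendsto_P₀.neg
  refine (h.add (hasImproperIntegral_log_pow 1)).congr (fun ρ hρ => ?_) ?_
  · ring
  · simp [P₀]; norm_num

theorem hasImproperIntegral_W₀ :
    HasImproperIntegral (fun ρ => W₀ ρ / (1 + ρ) ^ 2) 0 := by
  refine ((hasImproperIntegral_profile.const_mul (1 / 2)).add
    ((hasImproperIntegral_log_pow 2).const_mul (-(1 / 2)))).congr (fun ρ hρ => ?_) ?_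
  · ring
  · norm_num [Nat.factorial]

/-- `∫ L W₀ / (1 + ρ)² = π² / 12 - 1`. -/
theorem hasImproperIntegral_log_mul_W₀ :
    HasImproperIntegral (fun ρ => Real.log (1 + ρ) * W₀ ρ / (1 + ρ) ^ 2)
      (Real.pi ^ 2 / 12 - 1) := by
  -- The bracket multiplying `dil` is the antiderivative of `(1 - ρ) L / (1 + ρ)³` that vanishes at
  -- infinity. The last summand cancels the `1/ρ` terms produced by `dil'`, and its limit supplies
  -- `π²/12`.
  have hd : ∀ ρ : ℝ, 0 ≤ ρ → HasDerivAt
      (fun ρ => (Real.log (1 + ρ) * (ρ * (1 / (1 + ρ) * (1 / (1 + ρ)))) + 1 / (1 + ρ)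
        - 1 / 2 * (1 / (1 + ρ) * (1 / (1 + ρ)))) * dil ρ
        - 1 / 2 * (dil ρ + Real.log (1 + ρ) ^ 2 / 2))
      ((2 / (1 + ρ) - 1) * Real.log (1 + ρ) * dil ρ / (1 + ρ) ^ 2
        - Real.log (1 + ρ) ^ 2 / (1 + ρ) ^ 2 - Real.log (1 + ρ) / (1 + ρ) ^ 2 / 2) ρ :=
      fun ρ hρ => by
    have hρ1 : -1 < ρ := by linarith
    have hu : 1 + ρ ≠ 0 := by positivity
    have hL := hasDerivAt_log_one_add hρ1
    have hi := hasDerivAt_one_div_one_add hρ1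
    have hD := hasDerivAt_dil hρ1
    have h := ((((hL.mul ((hasDerivAt_id ρ).mul (hi.mul hi))).add hi).sub
      ((hi.mul hi).const_mul (1 / 2))).mul hD).sub
      ((hD.add ((hL.pow 2).div_const 2)).const_mul (1 / 2))
    refine h.congr_deriv ?_
    have hδ := mul_dslope_log ρ
    simp only [Pi.mul_apply, Pi.add_apply, Pi.sub_apply, id, one_mul]
    generalize dslope Real.log 1 (1 + ρ) = δ at *
    rw [← hδ]
    push_cast
    field_simp
    ring
  have hlim : Tendsto
      (fun ρ => (Real.log (1 + ρ) * (ρ * (1 / (1 + ρ) * (1 / (1 + ρ)))) + 1 / (1 + ρ)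
        - 1 / 2 * (1 / (1 + ρ) * (1 / (1 + ρ)))) * dil ρ
        - 1 / 2 * (dil ρ + Real.log (1 + ρ) ^ 2 / 2)) atTop (𝓝 (Real.pi ^ 2 / 12)) := by
    have h1 := tendsto_log_pow_div 1
    have h2 := tendsto_log_pow_div 2
    have h3 := tendsto_log_pow_div 3
    have hE := tendsto_dil_add_log_sq
    have h := ((((h1.mul tendsto_div_one_add).add tendsto_inv_one_add).sub
      ((tendsto_inv_one_add.mul tendsto_inv_one_add).const_mul (1 / 2))).mul hE).sub
      ((((h3.mul tendsto_div_one_add).add h2).sub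
        ((h2.mul tendsto_inv_one_add).const_mul (1 / 2))).const_mul (1 / 2))
    have h' := h.sub (hE.const_mul (1 / 2))
    simp only [mul_zero, zero_mul, add_zero, sub_zero] at h'
    refine (h'.congr' ((eventually_ge_atTop 0).mono fun ρ hρ => ?_)).trans (le_of_eq ?_)
    · have hu : 1 + ρ ≠ 0 := by positivity
      field_simp
      ring
    · congr 1
      ring
  have h := HasImproperIntegral.of_hasDerivAt hd hlim
  refine (((((h.add ((hasImproperIntegral_log_pow 2).const_mul 1)).add
    ((hasImproperIntegral_log_pow 1).const_mul (1 / 2))).add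
    ((hasImproperIntegral_log_pow 2).const_mul (-1))).add
    ((hasImproperIntegral_log_pow 3).const_mul (-(1 / 2)))).add
    (((hasImproperIntegral_log_pow 1).const_mul 2).add
      ((hasImproperIntegral_log_pow_cube 1).const_mul (-2)))).congr (fun ρ hρ => ?_) ?_
  · have hu : 1 + ρ ≠ 0 := by positivity
    rw [W₀]
    field_simp
    ring
  · norm_num [Nat.factorial, dil_zero]
    ring

/-- The quadratic part of the second order coefficient, with the second profile eliminated
through its equation. -/
theorem hasImproperIntegral_quadratic {p : ℝ} :
    HasImproperIntegral (fun ρ => (p - 1) * (2 * W₀ ρ + Real.log (1 + ρ) ^ 2) ^ 2 / (1 + ρ) ^ 2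
      - 2 * (F₁ p ρ / (1 + ρ) ^ 3)) ((p - 1) * (10 + Real.pi ^ 2)) := by
  -- With `X = 2 W₀ + L²` one has `P₀' = -(X - L) / (1 + ρ)²`, and the three summands are chosen so
  -- that all terms containing `W₀'` cancel. Since `F₁` contains `(p - 1) X²`, the remaining square
  -- is the one in the integrand.
  have hd : ∀ ρ : ℝ, 0 ≤ ρ → HasDerivAt
      (fun ρ => -(ρ * (1 / (1 + ρ) * (1 / (1 + ρ))) * (2 * W₀ ρ + Real.log (1 + ρ) ^ 2) ^ 2)
        - 2 * P₀ ρ ^ 2 + 4 * (ρ * (1 / (1 + ρ) * (1 / (1 + ρ))) * Real.log (1 + ρ) * W₀ ρ))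
      ((2 * W₀ ρ + Real.log (1 + ρ) ^ 2) ^ 2 * (1 / (1 + ρ) ^ 2 - 2 / (1 + ρ) ^ 3)
        - 12 * (Real.log (1 + ρ) * W₀ ρ) / (1 + ρ) ^ 2
        + 16 * (Real.log (1 + ρ) * W₀ ρ) / (1 + ρ) ^ 3 + 4 * W₀ ρ / (1 + ρ) ^ 2
        - 4 * W₀ ρ / (1 + ρ) ^ 3
        - 4 * Real.log (1 + ρ) ^ 3 / (1 + ρ) ^ 2 + 4 * Real.log (1 + ρ) ^ 3 / (1 + ρ) ^ 3) ρ :=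
      fun ρ hρ => by
    have hρ1 : -1 < ρ := by linarith
    have hu : 1 + ρ ≠ 0 := by positivity
    have hL := hasDerivAt_log_one_add hρ1
    have hi := hasDerivAt_one_div_one_add hρ1
    have hW := hasDerivAt_W₀ hρ1
    have hP := hasDerivAt_P₀ hρ1
    have hH := (hasDerivAt_id ρ).mul (hi.mul hi)
    have h := (((hH.mul (((hW.const_mul 2).add (hL.pow 2)).pow 2)).neg).sub
      ((hP.pow 2).const_mul 2)).add (((hH.mul hL).mul hW).const_mul 4)
    refine h.congr_deriv ?_
    have hA := P₀_eq hρ1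
    simp only [Pi.mul_apply, Pi.add_apply, Pi.pow_apply, id, one_mul]
    rw [← hA]
    generalize A₀ ρ = A
    generalize W₀ ρ = w
    generalize Real.log (1 + ρ) = L
    push_cast
    field_simp
    ring
  have hlim : Tendsto
      (fun ρ => -(ρ * (1 / (1 + ρ) * (1 / (1 + ρ))) * (2 * W₀ ρ + Real.log (1 + ρ) ^ 2) ^ 2)
        - 2 * P₀ ρ ^ 2 + 4 * (ρ * (1 / (1 + ρ) * (1 / (1 + ρ))) * Real.log (1 + ρ) * W₀ ρ))
      atTop (𝓝 (-2)) := by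
    have h := (((tendsto_div_one_add.mul (((tendsto_W₀_sq_div.const_mul 4).add
      ((tendsto_log_pow_mul_W₀_div 2).const_mul 4)).add (tendsto_log_pow_div 4))).neg).sub
      ((tendsto_P₀.pow 2).const_mul 2)).add
      ((tendsto_div_one_add.mul (tendsto_log_pow_mul_W₀_div 1)).const_mul 4)
    norm_num at h
    refine h.congr' ((eventually_ge_atTop 0).mono fun ρ hρ => ?_)
    have hu : 1 + ρ ≠ 0 := by positivity
    field_simp
    ring
  have h := (HasImproperIntegral.of_hasDerivAt hd hlim).const_mul (p - 1)
  refine (((((h.add (hasImproperIntegral_log_mul_W₀.const_mul (12 * (p - 1)))).add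
    (hasImproperIntegral_W₀.const_mul (-4 * (p - 1)))).add
    ((hasImproperIntegral_log_pow 3).const_mul (4 * (p - 1)))).add
    ((hasImproperIntegral_log_pow_cube 3).const_mul (-4 * (p - 1) + 2 * ((8 * p - 10) / 3)))).add
    ((hasImproperIntegral_log_pow_cube 2).const_mul (-2 * (p - 2)))).congr (fun ρ hρ => ?_) ?_
  · have hu : 1 + ρ ≠ 0 := by positivity
    rw [F₁]
    generalize W₀ ρ = w
    generalize Real.log (1 + ρ) = L
    field_simp
    ring
  · norm_num [Nat.factorial, W₀_zero, P₀]
    ring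

/-- Green's identity against `g = 1/(1 + ρ)`, which solves `(ρ g')' + 2 g / (1 + ρ)² = 1 / (1 +
ρ)²`. The boundary terms vanish by the logarithmic growth of `W` and the decay of `A`. -/
theorem hasImproperIntegral_second_profile {p C : ℝ} {W A q : ℝ → ℝ} (hp : 0 < p)
    (hs : FluxSol 1 W A q) (hW0 : W 0 = 0)
    (hq : ∀ ρ, 0 ≤ ρ → q ρ = -(2 * W ρ + 4 * (p - 1) / p ^ 3 * F₁ p ρ) / (1 + ρ) ^ 2)
    (hg : ∀ ρ, 0 ≤ ρ → (1 + ρ) * |A ρ| ≤ C ∧ |W ρ| ≤ C * Real.log (1 + ρ)) :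
    HasImproperIntegral (fun ρ => W ρ / (1 + ρ) ^ 2 + 4 * (p - 1) / p ^ 3 * F₁ p ρ / (1 + ρ) ^ 3)
      0 := by
  have hd : ∀ ρ : ℝ, 0 ≤ ρ → HasDerivAt
      (fun ρ => -(1 / (1 + ρ) * (ρ * A ρ) + ρ * (1 / (1 + ρ) * (1 / (1 + ρ))) * W ρ))
      (W ρ / (1 + ρ) ^ 2 + 4 * (p - 1) / p ^ 3 * F₁ p ρ / (1 + ρ) ^ 3) ρ := fun ρ hρ => by
    have hρ1 : -1 < ρ := by linarith
    have hu : 1 + ρ ≠ 0 := by positivity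
    have hi := hasDerivAt_one_div_one_add hρ1
    have h := ((hi.mul (hs.flux ρ hρ1)).add
      (((hasDerivAt_id ρ).mul (hi.mul hi)).mul (hs.deriv ρ hρ1))).neg
    refine h.congr_deriv ?_
    rw [hq ρ hρ]
    simp only [Pi.mul_apply, id, one_mul]
    field_simp
    ring
  have hlim : Tendsto
      (fun ρ => -(1 / (1 + ρ) * (ρ * A ρ) + ρ * (1 / (1 + ρ) * (1 / (1 + ρ))) * W ρ))
      atTop (𝓝 0) := by
    have h := (tendsto_inv_one_add.const_mul C).add ((tendsto_log_pow_div 1).const_mul C)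
    simp only [mul_zero, add_zero] at h
    refine squeeze_zero_norm' ((eventually_ge_atTop 0).mono fun ρ hρ => ?_) h
    obtain ⟨h1, h2⟩ := hg ρ hρ
    have hu : 0 < 1 + ρ := by positivity
    have hle : ρ / (1 + ρ) ≤ 1 := by rw [div_le_one hu]; linarith
    rw [norm_neg, Real.norm_eq_abs]
    refine (abs_add_le _ _).trans (add_le_add ?_ ?_)
    · rw [show 1 / (1 + ρ) * (ρ * A ρ) = ρ / (1 + ρ) * A ρ by ring, abs_mul,
        abs_of_nonneg (by positivity : 0 ≤ ρ / (1 + ρ)), mul_one_div, le_div_iff₀ hu]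
      calc _ = ρ / (1 + ρ) * ((1 + ρ) * |A ρ|) := by ring
        _ ≤ 1 * ((1 + ρ) * |A ρ|) := by gcongr
        _ ≤ C := by linarith
    · rw [show ρ * (1 / (1 + ρ) * (1 / (1 + ρ))) * W ρ = ρ / (1 + ρ) * (W ρ / (1 + ρ)) by ring,
        abs_mul, abs_of_nonneg (by positivity : 0 ≤ ρ / (1 + ρ)), abs_div, abs_of_pos hu, pow_one]
      calc _ ≤ 1 * (|W ρ| / (1 + ρ)) := by gcongr
        _ ≤ 1 * (C * Real.log (1 + ρ) / (1 + ρ)) := by gcongr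
        _ = _ := by ring
  exact (HasImproperIntegral.of_hasDerivAt hd hlim).congr (fun _ _ => rfl) (by simp [hW0])

/-- The first order coefficient of the mass expansions. -/
def massCoeff₁ (p q : ℝ) : ℝ := 4 * (p - 1) / p - 2 * q / p

/-- The second order coefficient of the mass expansions. -/
def massCoeff₂ (p q : ℝ) : ℝ :=
  2 * (p - 1) / p ^ 2 * ((p - 1) * (2 * Real.pi ^ 2 / 3 + 8) + 2 * p + 2)
    - 4 * q * (p - 1) / p ^ 2 * (4 + Real.pi ^ 2 / 6) + 4 * q * (q - 1) / p ^ 2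

theorem hasImproperIntegral_coeff₁ {p : ℝ} (q : ℝ) :
    HasImproperIntegral (fun ρ => coeff₁ p q (Real.log (1 + ρ)) (W₀ ρ) / (1 + ρ) ^ 2)
      (massCoeff₁ p q) := by
  refine ((hasImproperIntegral_profile.const_mul (2 * (p - 1) / p)).add
    ((hasImproperIntegral_log_pow 1).const_mul (-(2 * q / p)))).congr (fun ρ hρ => ?_) ?_
  · rw [coeff₁]; ring
  · rw [massCoeff₁]; norm_num; ring

/-- The multiples of the first two integrals are chosen so that `F₁` cancels and the square of `2 W₀
+ L²` has its coefficient in `coeff₂`; the rest are elementary or known. -/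
theorem hasImproperIntegral_coeff₂ {p C : ℝ} (q : ℝ) {W A s : ℝ → ℝ} (hp : 0 < p)
    (hs : FluxSol 1 W A s) (hW0 : W 0 = 0)
    (hq : ∀ ρ, 0 ≤ ρ → s ρ = -(2 * W ρ + 4 * (p - 1) / p ^ 3 * F₁ p ρ) / (1 + ρ) ^ 2)
    (hg : ∀ ρ, 0 ≤ ρ → (1 + ρ) * |A ρ| ≤ C ∧ |W ρ| ≤ C * Real.log (1 + ρ)) :
    HasImproperIntegral (fun ρ => coeff₂ p q (Real.log (1 + ρ)) (W₀ ρ) (W ρ) / (1 + ρ) ^ 2)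
      (massCoeff₂ p q) := by
  refine (((((((hasImproperIntegral_second_profile hp hs hW0 hq hg).const_mul p).add
    ((hasImproperIntegral_quadratic (p := p)).const_mul (2 * (p - 1) / p ^ 2))).add
    (hasImproperIntegral_log_mul_W₀.const_mul (-(8 * (p - 1) ^ 2 / p ^ 2)
      - 8 * q * (p - 1) / p ^ 2))).add
    ((hasImproperIntegral_log_pow 3).const_mul (-(4 * (p - 1) * (p - 2) / (3 * p ^ 2))
      - 4 * q * (p - 1) / p ^ 2))).add
    (hasImproperIntegral_W₀.const_mul (4 * (p - 1) * q / p ^ 2))).add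
    ((hasImproperIntegral_log_pow 2).const_mul (2 * q * (q - 1) / p ^ 2))).congr
    (fun ρ hρ => ?_) ?_
  · have hu : 1 + ρ ≠ 0 := by positivity
    rw [coeff₂]
    generalize F₁ p ρ = f
    generalize W₀ ρ = w
    generalize Real.log (1 + ρ) = L
    field_simp
    ring
  · rw [massCoeff₂]
    norm_num [Nat.factorial]
    field_simp
    ring

/-! ### Integrals over discs -/

/-- Polar coordinates followed by `ρ = s² / μ²`; the factor `2 s ds` becomes `μ² dρ`. -/
theorem integral_ball_radial {H : ℝ → ℝ} {r μ : ℝ} (hr : 0 < r) (hμ : 0 < μ)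
    (hH : ContinuousOn H (Set.Icc 0 (r ^ 2 / μ ^ 2))) :
    ∫ x in Metric.ball (0 : Plane) r, H (‖x‖ ^ 2 / μ ^ 2)
      = Real.pi * μ ^ 2 * ∫ ρ in (0 : ℝ)..(r ^ 2 / μ ^ 2), H ρ := by
  have h1 : ∫ x in Metric.ball (0 : Plane) r, H (‖x‖ ^ 2 / μ ^ 2)
      = ∫ x : Plane, (Set.Iio r).indicator (fun s => H (s ^ 2 / μ ^ 2)) ‖x‖ := by
    rw [← MeasureTheory.integral_indicator measurableSet_ball]
    congr 1
    ext x
    by_cases hx : ‖x‖ < r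
    · rw [Set.indicator_of_mem (by simpa using hx),
        Set.indicator_of_mem (show ‖x‖ ∈ Set.Iio r from hx)]
    · rw [Set.indicator_of_notMem (by simpa using hx),
        Set.indicator_of_notMem (show ‖x‖ ∉ Set.Iio r from hx)]
  have hvol : (MeasureTheory.volume : MeasureTheory.Measure Plane).real (Metric.ball 0 1)
      = Real.pi := by
    rw [MeasureTheory.measureReal_def, EuclideanSpace.volume_ball_fin_two]
    simp [Real.pi_pos.le]
  have h2 : ∫ s in Set.Ioi (0 : ℝ), s ^ (Module.finrank ℝ Plane - 1) •
        (Set.Iio r).indicator (fun s => H (s ^ 2 / μ ^ 2)) s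
      = ∫ s in (0 : ℝ)..r, s * H (s ^ 2 / μ ^ 2) := by
    rw [finrank_euclideanSpace_fin, intervalIntegral.integral_of_le hr.le,
      MeasureTheory.integral_Ioc_eq_integral_Ioo, ← Set.Ioi_inter_Iio,
      ← MeasureTheory.setIntegral_indicator measurableSet_Iio]
    congr 1
    ext s
    by_cases hs : s ∈ Set.Iio r
    · simp [Set.indicator_of_mem hs]
    · simp [Set.indicator_of_notMem hs]
  have h3 : ∫ s in (0 : ℝ)..r, (H ∘ fun s => s ^ 2 / μ ^ 2) s * (2 * s / μ ^ 2)
      = ∫ ρ in (0 : ℝ) ^ 2 / μ ^ 2..(r ^ 2 / μ ^ 2), H ρ := by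
    refine intervalIntegral.integral_comp_mul_deriv' (fun s _ => hasDerivAt_sq_div μ s)
      (by fun_prop) (hH.mono ?_)
    rw [Set.uIcc_of_le hr.le]
    rintro _ ⟨s, hs, rfl⟩
    exact ⟨by positivity, by have := hs.1; have := hs.2; beta_reduce; gcongr⟩
  rw [h1, MeasureTheory.integral_fun_norm_addHaar, h2, hvol, finrank_euclideanSpace_fin]
  rw [zero_pow two_ne_zero, zero_div] at h3
  rw [← h3, ← intervalIntegral.integral_const_mul, nsmul_eq_mul, smul_eq_mul, ← mul_assoc,
    ← intervalIntegral.integral_const_mul]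
  congr 1
  ext s
  simp only [Function.comp]
  push_cast
  field_simp

theorem integral_sqrt_div_le {b : ℝ} (hb : 0 ≤ b) :
    (∫ ρ in (0 : ℝ)..b, √(1 + ρ) / (1 + ρ) ^ 2) ≤ 2 := by
  rw [intervalIntegral.integral_eq_sub_of_hasDerivAt (f := fun ρ => -2 * (√(1 + ρ))⁻¹)]
  · have : 0 ≤ (√(1 + b))⁻¹ := by positivity
    simp
  · intro ρ hρ
    rw [Set.uIcc_of_le hb] at hρ
    exact ((hasDerivAt_inv_sqrt_one_add hρ.1).const_mul (-2)).congr_deriv (by ring)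
  · refine ContinuousOn.intervalIntegrable ?_
    rw [Set.uIcc_of_le hb]
    refine ContinuousOn.div (by fun_prop) (by fun_prop) fun ρ hρ => ?_
    have := hρ.1
    positivity

/-- The first error is `K ∫ (1 + ρ)^(-3/2) ≤ 2 K`, the second the discarded tail. -/
theorem HasImproperIntegral.near {Φ f : ℝ → ℝ} {ℓ K C b : ℝ} (hf : HasImproperIntegral f ℓ)
    (hcont : ContinuousOn f (Set.Ici 0))
    (hC : ∀ ρ, 0 ≤ ρ → |f ρ| ≤ C * (√(1 + ρ) / (1 + ρ) ^ 2)) (hb : 0 ≤ b) (hK : 0 ≤ K)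
    (hΦ : ContinuousOn Φ (Set.Icc 0 b))
    (h : ∀ ρ ∈ Set.Icc 0 b, |Φ ρ - f ρ| ≤ K * (√(1 + ρ) / (1 + ρ) ^ 2)) :
    |(∫ ρ in (0 : ℝ)..b, Φ ρ) - ℓ| ≤ 2 * K + 2 * C * (√(1 + b))⁻¹ := by
  have hfi : IntervalIntegrable f MeasureTheory.volume 0 b := by
    refine ContinuousOn.intervalIntegrable (hcont.mono ?_)
    rw [Set.uIcc_of_le hb]
    exact Set.Icc_subset_Ici_self
  have hΦi : IntervalIntegrable Φ MeasureTheory.volume 0 b := by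
    refine ContinuousOn.intervalIntegrable ?_
    rwa [Set.uIcc_of_le hb]
  have hsi : IntervalIntegrable (fun ρ : ℝ => K * (√(1 + ρ) / (1 + ρ) ^ 2))
      MeasureTheory.volume 0 b := by
    refine ContinuousOn.intervalIntegrable ?_
    rw [Set.uIcc_of_le hb]
    refine continuousOn_const.mul (ContinuousOn.div (by fun_prop) (by fun_prop) fun ρ hρ => ?_)
    have := hρ.1
    positivity
  have h1 : |(∫ ρ in (0 : ℝ)..b, Φ ρ) - ∫ ρ in (0 : ℝ)..b, f ρ| ≤ 2 * K := by
    rw [← intervalIntegral.integral_sub hΦi hfi]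
    rw [← Real.norm_eq_abs]
    refine (intervalIntegral.norm_integral_le_of_norm_le (f := fun ρ => Φ ρ - f ρ) hb
      (Filter.Eventually.of_forall fun ρ hρ => h ρ ⟨hρ.1.le, hρ.2⟩) hsi).trans ?_
    rw [intervalIntegral.integral_const_mul]
    nlinarith [integral_sqrt_div_le hb]
  have h2 := hf.tail_le hcont hC hb
  calc _ = |((∫ ρ in (0 : ℝ)..b, Φ ρ) - ∫ ρ in (0 : ℝ)..b, f ρ)
        + ((∫ ρ in (0 : ℝ)..b, f ρ) - ℓ)| := by ring_nf
    _ ≤ _ := (abs_add_le _ _).trans (add_le_add h1 h2)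

/-! ### Growth of the expansion coefficients -/

theorem exists_coeff_growth {C : ℝ} {W : ℝ → ℝ} (p q : ℝ)
    (hW : ∀ ρ, 0 ≤ ρ → |W ρ| ≤ C * Real.log (1 + ρ)) :
    ∃ K : ℝ, 0 < K ∧ ∀ ρ, 0 ≤ ρ → |coeff₁ p q (Real.log (1 + ρ)) (W₀ ρ)| ≤ K * √(1 + ρ) ∧
      |coeff₂ p q (Real.log (1 + ρ)) (W₀ ρ) (W ρ)| ≤ K * √(1 + ρ) := by
  obtain ⟨K₀, -, hW₀⟩ := exists_W₀_growth
  set Λ : ℝ → ℝ := fun ρ => 1 + Real.log (1 + ρ) with hΛ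
  -- Along the principal filter of `[0, ∞)` an `O`-bound is a bound at every point.
  have hl : ∀ᶠ ρ in 𝓟 (Set.Ici (0 : ℝ)), 0 ≤ Real.log (1 + ρ) :=
    eventually_principal.2 fun ρ hρ => Real.log_nonneg (by linarith [Set.mem_Ici.1 hρ])
  have bL : (fun ρ => Real.log (1 + ρ)) =O[𝓟 (Set.Ici 0)] Λ :=
    IsBigO.of_bound 1 (hl.mono fun ρ h => by
      rw [Real.norm_eq_abs, Real.norm_eq_abs, abs_of_nonneg h, abs_of_nonneg (by positivity)]
      simp only [hΛ]; linarith)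
  have b1 : (fun _ => (1 : ℝ)) =O[𝓟 (Set.Ici 0)] Λ :=
    IsBigO.of_bound 1 (hl.mono fun ρ h => by
      rw [norm_one, Real.norm_eq_abs, abs_of_nonneg (by positivity)]
      simp only [hΛ]; linarith)
  have bw : W₀ =O[𝓟 (Set.Ici 0)] Λ := by
    refine IsBigO.trans (IsBigO.of_bound K₀ (hl.mp (eventually_principal.2 fun ρ hρ h => ?_))) bL
    rw [Real.norm_eq_abs, Real.norm_eq_abs, abs_of_nonneg h]
    exact (hW₀ ρ hρ).2
  have bz : W =O[𝓟 (Set.Ici 0)] Λ := by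
    refine IsBigO.trans (IsBigO.of_bound C (hl.mp (eventually_principal.2 fun ρ hρ h => ?_))) bL
    rw [Real.norm_eq_abs, Real.norm_eq_abs, abs_of_nonneg h]
    exact hW ρ hρ
  have up : ∀ {f : ℝ → ℝ} (n m : ℕ), f =O[𝓟 (Set.Ici 0)] (fun ρ => Λ ρ ^ n) → n + m = 4 →
      f =O[𝓟 (Set.Ici 0)] fun ρ => Λ ρ ^ 4 := fun {f} n m hf hnm => by
    have := hf.mul (b1.pow m)
    simp only [one_pow, mul_one, ← pow_add, hnm] at this
    exact this
  have bX : (fun ρ => 2 * W₀ ρ + Real.log (1 + ρ) ^ 2) =O[𝓟 (Set.Ici 0)] fun ρ => Λ ρ ^ 2 := by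
    refine IsBigO.add ?_ (bL.pow 2)
    have := (bw.const_mul_left 2).mul b1
    simpa [← pow_two] using this
  have bw' : W₀ =O[𝓟 (Set.Ici 0)] fun ρ => Λ ρ ^ 1 := by simpa using bw
  have bz' : W =O[𝓟 (Set.Ici 0)] fun ρ => Λ ρ ^ 1 := by simpa using bz
  have bL' : (fun ρ => Real.log (1 + ρ)) =O[𝓟 (Set.Ici 0)] fun ρ => Λ ρ ^ 1 := by simpa using bL
  have bLw : (fun ρ => Real.log (1 + ρ) * W₀ ρ) =O[𝓟 (Set.Ici 0)] fun ρ => Λ ρ ^ 2 := by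
    simpa [← pow_two] using bL.mul bw
  have bLX : (fun ρ => Real.log (1 + ρ) * (2 * W₀ ρ + Real.log (1 + ρ) ^ 2))
      =O[𝓟 (Set.Ici 0)] fun ρ => Λ ρ ^ 3 := by
    simpa [← pow_succ'] using bL.mul bX
  have bXX : (fun ρ => (2 * W₀ ρ + Real.log (1 + ρ) ^ 2) ^ 2)
      =O[𝓟 (Set.Ici 0)] fun ρ => Λ ρ ^ 4 := by
    simpa [← pow_mul] using bX.pow 2
  have h1 : (fun ρ => coeff₁ p q (Real.log (1 + ρ)) (W₀ ρ))
      =O[𝓟 (Set.Ici 0)] fun ρ => Λ ρ ^ 4 := by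
    refine (((up 2 2 bX rfl).const_mul_left (2 * (p - 1) / p)).add
      ((up 1 3 bL' rfl).const_mul_left (-(2 * q / p)))).congr_left fun ρ => ?_
    rw [coeff₁]; ring
  have h2 : (fun ρ => coeff₂ p q (Real.log (1 + ρ)) (W₀ ρ) (W ρ))
      =O[𝓟 (Set.Ici 0)] fun ρ => Λ ρ ^ 4 := by
    refine ((((((((up 1 3 bz' rfl).const_mul_left p).add
      ((up 2 2 bLw rfl).const_mul_left (-(8 * (p - 1) ^ 2 / p ^ 2)))).add
      ((up 3 1 (bL.pow 3) rfl).const_mul_left (-(4 * (p - 1) * (p - 2) / (3 * p ^ 2))))).add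
      (bXX.const_mul_left (2 * (p - 1) ^ 2 / p ^ 2))).add
      ((up 3 1 bLX rfl).const_mul_left (-(2 * q / p * (2 * (p - 1) / p))))).add
      ((up 1 3 bw' rfl).const_mul_left (4 * (p - 1) * q / p ^ 2))).add
      ((up 2 2 (bL.pow 2) rfl).const_mul_left (2 * q * (q - 1) / p ^ 2))).congr_left fun ρ => ?_
    rw [coeff₂]; ring
  obtain ⟨C₄, hC₄, h4⟩ := exists_one_add_log_pow_le 4
  obtain ⟨D₁, hD₁, k1⟩ := h1.exists_pos
  obtain ⟨D₂, hD₂, k2⟩ := h2.exists_pos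
  have fin : ∀ ρ, 0 ≤ ρ → ∀ D : ℝ, 0 < D → ∀ D', 0 < D' → ∀ y : ℝ, |y| ≤ D * ‖Λ ρ ^ 4‖ →
      |y| ≤ (D + D') * C₄ * √(1 + ρ) := fun ρ hρ D hD D' hD' y hy => by
    have hL : 0 ≤ Real.log (1 + ρ) := Real.log_nonneg (by linarith)
    rw [Real.norm_eq_abs, abs_of_nonneg (by positivity : 0 ≤ Λ ρ ^ 4)] at hy
    calc |y| ≤ D * Λ ρ ^ 4 := hy
      _ ≤ D * (C₄ * √(1 + ρ)) := by gcongr; exact h4 ρ hρ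
      _ ≤ (D + D') * (C₄ * √(1 + ρ)) := by gcongr; linarith
      _ = _ := by ring
  refine ⟨(D₁ + D₂) * C₄, by positivity, fun ρ hρ => ⟨?_, ?_⟩⟩
  · exact fin ρ hρ D₁ hD₁ D₂ hD₂ _ (eventually_principal.1 k1.bound ρ hρ)
  · rw [add_comm D₁]
    exact fin ρ hρ D₂ hD₂ D₁ hD₁ _ (eventually_principal.1 k2.bound ρ hρ)

/-! ### Second order expansions -/

/-- `I = 1 + ε a + ε² b + o(ε²)`. -/
def SecondOrder (l : Filter ℝ) (ε I : ℝ → ℝ) (a b : ℝ) : Prop :=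
  (fun γ => I γ - (1 + ε γ * a + ε γ ^ 2 * b)) =o[l] fun γ => ε γ ^ 2

section SecondOrder

variable {l : Filter ℝ} {ε I J : ℝ → ℝ} {a b c d : ℝ}

theorem SecondOrder.sub_one_isBigO (hI : SecondOrder l ε I a b) (hε : Tendsto ε l (𝓝 0)) :
    (fun γ => I γ - 1) =O[l] ε := by
  have h1 : (fun γ => ε γ ^ 2) =O[l] ε := by
    simpa [pow_two] using (hε.isBigO_one ℝ).mul (isBigO_refl ε l)
  have h2 : (fun γ => ε γ * a + ε γ ^ 2 * b) =O[l] ε := by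
    refine IsBigO.add ?_ ?_
    · simpa [mul_comm] using (isBigO_refl ε l).const_mul_left a
    · simpa [mul_comm] using h1.const_mul_left b
  refine (((IsLittleO.isBigO hI).trans h1).add h2).congr_left fun γ => ?_
  ring

theorem SecondOrder.mul (hI : SecondOrder l ε I a b) (hJ : SecondOrder l ε J c d)
    (hε : Tendsto ε l (𝓝 0)) :
    SecondOrder l ε (fun γ => I γ * J γ) (a + c) (b + d + a * c) := by
  have e1 : ε =O[l] fun _ => (1 : ℝ) := hε.isBigO_one ℝ
  have eo : ε =o[l] fun _ => (1 : ℝ) := (isLittleO_one_iff ℝ).2 hε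
  have hJ1 : J =O[l] fun _ => (1 : ℝ) := by
    have := ((hJ.sub_one_isBigO hε).trans e1).add (isBigO_refl (fun _ => (1 : ℝ)) l)
    simpa using this
  have hP1 : (fun γ => 1 + ε γ * a + ε γ ^ 2 * b) =O[l] fun _ => (1 : ℝ) := by
    have h : Tendsto (fun γ => 1 + ε γ * a + ε γ ^ 2 * b) l (𝓝 (1 + 0 * a + 0 ^ 2 * b)) :=
      (tendsto_const_nhds.add (hε.mul_const a)).add ((hε.pow 2).mul_const b)
    exact h.isBigO_one ℝ
  have t1 := hI.mul_isBigO hJ1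
  have t2 := hP1.mul_isLittleO hJ
  have t3 : (fun γ => ε γ * (a * d + b * c + ε γ * b * d) * ε γ ^ 2)
      =o[l] fun γ => ε γ ^ 2 := by
    have hb : (fun γ => a * d + b * c + ε γ * b * d) =O[l] fun _ => (1 : ℝ) := by
      have h : Tendsto (fun γ => a * d + b * c + ε γ * b * d) l
          (𝓝 (a * d + b * c + 0 * b * d)) :=
        tendsto_const_nhds.add ((hε.mul_const b).mul_const d)
      exact h.isBigO_one ℝ
    simpa using (eo.mul_isBigO hb).mul_isBigO (isBigO_refl (fun γ => ε γ ^ 2) l)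
  simp only [mul_one, one_mul] at t1 t2
  refine ((t1.add t2).add t3).congr_left fun γ => ?_
  ring

/-- Taylor expansion of `(1 - x)^α` at `x = 1 - I = O(ε)`: the cubic remainder is `o(ε²)`, and `x²`
is `ε² a²` up to `o(ε²)`. -/
theorem SecondOrder.rpow (hI : SecondOrder l ε I a b) (hε : Tendsto ε l (𝓝 0)) (α : ℝ) :
    SecondOrder l ε (fun γ => I γ ^ α) (α * a) (α * b + α * (α - 1) / 2 * a ^ 2) := by
  have eo : ε =o[l] fun _ => (1 : ℝ) := (isLittleO_one_iff ℝ).2 hε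
  have hx : (fun γ => 1 - I γ) =O[l] ε := (hI.sub_one_isBigO hε).neg_left.congr_left fun γ => by ring
  have hx0 : Tendsto (fun γ => 1 - I γ) l (𝓝 0) := hx.trans_tendsto hε
  have e3 : (fun γ => ε γ ^ 3) =o[l] fun γ => ε γ ^ 2 := by
    simpa [pow_succ' _ 2] using eo.mul_isBigO (isBigO_refl (fun γ => ε γ ^ 2) l)
  have t1 : (fun γ => I γ ^ α - (1 - α * (1 - I γ) + α * (α - 1) / 2 * (1 - I γ) ^ 2))
      =o[l] fun γ => ε γ ^ 2 := by
    have h := ((one_sub_rpow_taylor_three α).comp_tendsto hx0).trans (hx.pow 3)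
    refine (h.trans_isLittleO e3).congr_left fun γ => ?_
    simp
  have t2 := hI.const_mul_left α
  have t3 : (fun γ => (I γ - 1) ^ 2 - ε γ ^ 2 * a ^ 2) =o[l] fun γ => ε γ ^ 2 := by
    have hs : (fun γ => I γ - 1 - ε γ * a) =o[l] ε := by
      have h2 : (fun γ => ε γ ^ 2) =o[l] ε := by
        simpa [pow_two] using eo.mul_isBigO (isBigO_refl ε l)
      refine ((hI.trans h2).add (h2.const_mul_left b)).congr_left fun γ => ?_
      ring
    have hs' : (fun γ => I γ - 1 + ε γ * a) =O[l] ε := by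
      refine (hI.sub_one_isBigO hε).add ?_
      simpa [mul_comm] using (isBigO_refl ε l).const_mul_left a
    have := hs.mul_isBigO hs'
    refine (this.congr_left fun γ => ?_).congr_right fun γ => ?_
    · ring
    · ring
  refine ((t1.add t2).add (t3.const_mul_left (α * (α - 1) / 2))).congr_left fun γ => ?_
  ring

end SecondOrder

/-! ### Expansion of the masses -/

/-- The mass of `B^q e^{B^p}` over the disc of radius `r`, normalised by its leading order. -/
def relMass (p q lam γ : ℝ) (b : ℝ → ℝ) (r : ℝ) : ℝ :=
  lam * p ^ 2 / 2 * (∫ x in Metric.ball (0 : Plane) r, b ‖x‖ ^ q * Real.exp (b ‖x‖ ^ p))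
    / (4 * Real.pi * ((γ * γ ^ (-p)) ^ 2 * γ ^ q))

/-- On `[0, r]` the profile `b` is the approximate solution corrected by a small remainder. -/
def IsCorrected (p : ℝ) (W : ℝ → ℝ) (C γ μ r : ℝ) (b : ℝ → ℝ) : Prop :=
  ∃ w A s : ℝ → ℝ, FluxSol 1 w A s ∧
    (∀ ρ ∈ Set.Icc 0 (r ^ 2 / μ ^ 2), |w ρ| ≤ 1 ∧ (1 + ρ) * |A ρ| ≤ C * γ ^ (-p) ∧
      |w ρ| ≤ C * γ ^ (-p) * Real.log (1 + ρ)) ∧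
    ∃ S > r, Set.EqOn b (fun r => approx p W γ (r ^ 2 / μ ^ 2) (w (r ^ 2 / μ ^ 2))) (Set.Ico 0 S)

/-- The relation for `λ` makes the constants `λ p²/2 · π μ² · γ^q e^(γ^p)` equal to the normalising
factor. -/
theorem relMass_eq {p q γ μ lam r : ℝ} {b Φ v : ℝ → ℝ} (hγ : 0 < γ) (hμ : 0 < μ) (hr : 0 < r)
    (hlam : lam * p ^ 2 * γ ^ (2 * (p - 1)) * μ ^ 2 * Real.exp (γ ^ p) = 8)
    (hΦ : ∀ ρ, Φ ρ = Phi p q (γ ^ (-p)) (Real.log (1 + ρ)) (v ρ) / (1 + ρ) ^ 2)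
    (hΦc : ContinuousOn Φ (Set.Icc 0 (r ^ 2 / μ ^ 2)))
    (hv : ∀ ρ ∈ Set.Icc 0 (r ^ 2 / μ ^ 2), 0 < 1 - γ ^ (-p) * v ρ)
    (hb : ∀ s ∈ Set.Ico 0 r, b s = γ * (1 - γ ^ (-p) * v (s ^ 2 / μ ^ 2))) :
    relMass p q lam γ b r = ∫ ρ in (0 : ℝ)..(r ^ 2 / μ ^ 2), Φ ρ := by
  have h1 : ∫ x in Metric.ball (0 : Plane) r, b ‖x‖ ^ q * Real.exp (b ‖x‖ ^ p)
      = ∫ x in Metric.ball (0 : Plane) r, γ ^ q * Real.exp (γ ^ p) * Φ (‖x‖ ^ 2 / μ ^ 2) := by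
    refine MeasureTheory.setIntegral_congr_fun measurableSet_ball fun x hx => ?_
    have hx' : ‖x‖ < r := by simpa using hx
    have hρ : ‖x‖ ^ 2 / μ ^ 2 ∈ Set.Icc 0 (r ^ 2 / μ ^ 2) := ⟨by positivity, by gcongr⟩
    rw [hb _ ⟨norm_nonneg x, hx'⟩, exp_nonlinearity_eq hγ hρ.1 (hv _ hρ), hΦ]
    ring
  rw [relMass, h1, MeasureTheory.integral_const_mul, integral_ball_radial hr hμ hΦc]
  obtain ⟨h2, -⟩ := lam_relation hγ hlam
  have hε : 0 < γ ^ (-p) := by positivity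
  have hq : 0 < γ ^ q := by positivity
  have hpi := Real.pi_pos
  rw [div_eq_iff (by positivity)]
  linear_combination (1 / 2 * Real.pi * γ ^ q * ∫ ρ in (0 : ℝ)..(r ^ 2 / μ ^ 2), Φ ρ) * h2

theorem relMass_near {p q γ μ lam r C K K' : ℝ} {W AW qW b : ℝ → ℝ} (hp : 1 < p) (hγ : 1 ≤ γ)
    (hμ : 0 < μ) (hr : 0 < r) (hC : 0 < C) (hK : 0 ≤ K)
    (hlam : lam * p ^ 2 * γ ^ (2 * (p - 1)) * μ ^ 2 * Real.exp (γ ^ p) = 8)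
    (hWs : FluxSol 1 W AW qW) {n₁ n₂ : ℝ}
    (hi₁ : HasImproperIntegral
      (fun ρ => coeff₁ p q (Real.log (1 + ρ)) (W₀ ρ) / (1 + ρ) ^ 2) n₁)
    (hi₂ : HasImproperIntegral
      (fun ρ => coeff₂ p q (Real.log (1 + ρ)) (W₀ ρ) (W ρ) / (1 + ρ) ^ 2) n₂)
    (hK' : ∀ ρ, 0 ≤ ρ → |coeff₁ p q (Real.log (1 + ρ)) (W₀ ρ)| ≤ K' * √(1 + ρ) ∧
      |coeff₂ p q (Real.log (1 + ρ)) (W₀ ρ) (W ρ)| ≤ K' * √(1 + ρ))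
    (hlog : tlog μ r ≤ √γ)
    (hexp : ∀ ρ y : ℝ, 0 ≤ ρ → Real.log (1 + ρ) ≤ √γ + 1 → |y| ≤ 1 →
      |Phi p q (γ ^ (-p)) (Real.log (1 + ρ))
          (profileArg p (γ ^ (-p)) (Real.log (1 + ρ)) (W₀ ρ) (W ρ + y))
        - (1 + γ ^ (-p) * coeff₁ p q (Real.log (1 + ρ)) (W₀ ρ)
          + (γ ^ (-p)) ^ 2 * coeff₂ p q (Real.log (1 + ρ)) (W₀ ρ) (W ρ + y))|
        ≤ K * (γ ^ (-p)) ^ 3 * √(1 + ρ))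
    (hsmall : ∀ ρ y : ℝ, 0 ≤ ρ → Real.log (1 + ρ) ≤ √γ + 1 → |y| ≤ 1 →
      |γ ^ (-p) * profileArg p (γ ^ (-p)) (Real.log (1 + ρ)) (W₀ ρ) (W ρ + y)| ≤ 1 / 2)
    (hb : IsCorrected p W C γ μ r b) :
    |relMass p q lam γ b r - (1 + γ ^ (-p) * n₁ + (γ ^ (-p)) ^ 2 * n₂)|
      ≤ 2 * ((K + p * C) * (γ ^ (-p)) ^ 3)
        + 2 * (1 + 2 * K') * (√(1 + r ^ 2 / μ ^ 2))⁻¹ := by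
  obtain ⟨w, A, s, hw, hest, S, hS, hB⟩ := hb
  have hγ0 : 0 < γ := by linarith
  have hε : 0 < γ ^ (-p) := by positivity
  have hε1 : γ ^ (-p) ≤ 1 := Real.rpow_le_one_of_one_le_of_nonpos hγ (by linarith)
  have hρb : 0 ≤ r ^ 2 / μ ^ 2 := by positivity
  have hlogle : ∀ ρ ∈ Set.Icc 0 (r ^ 2 / μ ^ 2), Real.log (1 + ρ) ≤ √γ + 1 := fun ρ hρ => by
    have : Real.log (1 + ρ) ≤ tlog μ r :=
      Real.log_le_log (by linarith [hρ.1]) (by linarith [hρ.2])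
    linarith
  have hlogc : ContinuousOn (fun ρ : ℝ => Real.log (1 + ρ)) (Set.Ici 0) := fun ρ hρ =>
    (hasDerivAt_log_one_add (by linarith [Set.mem_Ici.1 hρ])).continuousAt.continuousWithinAt
  have hW₀c : ContinuousOn W₀ (Set.Ici 0) := fun ρ hρ =>
    (hasDerivAt_W₀ (by linarith [Set.mem_Ici.1 hρ])).continuousAt.continuousWithinAt
  have hWc : ContinuousOn W (Set.Ici 0) := fun ρ hρ =>
    (hWs.deriv ρ (by linarith [Set.mem_Ici.1 hρ])).continuousAt.continuousWithinAt
  have hwc : ContinuousOn w (Set.Ici 0) := fun ρ hρ =>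
    (hw.deriv ρ (by linarith [Set.mem_Ici.1 hρ])).continuousAt.continuousWithinAt
  have hu2 : ∀ ρ ∈ Set.Ici (0 : ℝ), (1 + ρ) ^ 2 ≠ 0 := fun ρ hρ => by
    have := Set.mem_Ici.1 hρ
    positivity
  set v : ℝ → ℝ := fun ρ =>
    profileArg p (γ ^ (-p)) (Real.log (1 + ρ)) (W₀ ρ) (W ρ + w ρ) with hv
  have hvc : ContinuousOn v (Set.Ici 0) := by
    simp only [hv, profileArg]
    fun_prop
  have hvpos : ∀ ρ ∈ Set.Icc 0 (r ^ 2 / μ ^ 2), 0 < 1 - γ ^ (-p) * v ρ := fun ρ hρ => by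
    linarith [(abs_le.1 (hsmall ρ (w ρ) hρ.1 (hlogle ρ hρ) (hest ρ hρ).1)).2]
  have hΦc : ContinuousOn
      (fun ρ => Phi p q (γ ^ (-p)) (Real.log (1 + ρ)) (v ρ) / (1 + ρ) ^ 2)
      (Set.Icc 0 (r ^ 2 / μ ^ 2)) := by
    have hb1 : ContinuousOn (fun ρ => 1 - γ ^ (-p) * v ρ) (Set.Icc 0 (r ^ 2 / μ ^ 2)) :=
      continuousOn_const.sub (continuousOn_const.mul (hvc.mono Set.Icc_subset_Ici_self))
    have hr : ∀ e : ℝ, ContinuousOn (fun ρ => (1 - γ ^ (-p) * v ρ) ^ e)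
        (Set.Icc 0 (r ^ 2 / μ ^ 2)) := fun e =>
      hb1.rpow_const fun ρ hρ => Or.inl (hvpos ρ hρ).ne'
    simp only [Phi]
    refine ContinuousOn.div ((hr q).mul (ContinuousOn.rexp ?_)) (by fun_prop)
      fun ρ hρ => hu2 ρ hρ.1
    exact (((hr p).sub continuousOn_const).div_const _).add
      (continuousOn_const.mul (hlogc.mono Set.Icc_subset_Ici_self))
  rw [relMass_eq (v := v) hγ0 hμ hr hlam (fun ρ => rfl) hΦc hvpos
    fun s hs => hB ⟨hs.1, hs.2.trans hS⟩]
  have hint : HasImproperIntegral (fun ρ => (1 + γ ^ (-p) * coeff₁ p q (Real.log (1 + ρ)) (W₀ ρ)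
      + (γ ^ (-p)) ^ 2 * coeff₂ p q (Real.log (1 + ρ)) (W₀ ρ) (W ρ)) / (1 + ρ) ^ 2)
      (1 + γ ^ (-p) * n₁ + (γ ^ (-p)) ^ 2 * n₂) :=
    ((hasImproperIntegral_one.add (hi₁.const_mul _)).add (hi₂.const_mul _)).congr
      (fun ρ hρ => by ring) rfl
  refine hint.near ?_ (fun ρ hρ => ?_) hρb (by positivity) hΦc fun ρ hρ => ?_
  · refine ContinuousOn.div ?_ (by fun_prop) hu2
    simp only [coeff₁, coeff₂]
    fun_prop
  · obtain ⟨k1, k2⟩ := hK' ρ hρ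
    have hs1 : 1 ≤ √(1 + ρ) := Real.one_le_sqrt.2 (by linarith)
    rw [abs_div, abs_of_pos (by positivity : 0 < (1 + ρ) ^ 2), mul_div_assoc']
    gcongr
    have h1 : |γ ^ (-p) * coeff₁ p q (Real.log (1 + ρ)) (W₀ ρ)| ≤ K' * √(1 + ρ) := by
      rw [abs_mul, abs_of_pos hε]
      exact (mul_le_of_le_one_left (abs_nonneg _) hε1).trans k1
    have h2 : |(γ ^ (-p)) ^ 2 * coeff₂ p q (Real.log (1 + ρ)) (W₀ ρ) (W ρ)|
        ≤ K' * √(1 + ρ) := by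
      rw [abs_mul, abs_of_pos (by positivity : 0 < (γ ^ (-p)) ^ 2)]
      exact (mul_le_of_le_one_left (abs_nonneg _) (pow_le_one₀ hε.le hε1)).trans k2
    refine (abs_add_le _ _).trans ((add_le_add ((abs_add_le _ _).trans
      (add_le_add_right h1 _)) h2).trans ?_)
    rw [abs_one]
    linarith
  · obtain ⟨k1, -, k2⟩ := hest ρ hρ
    have hcen := Phi_expansion_center (y := w ρ) hp hγ0 hρ.1 hC
      (hexp ρ (w ρ) hρ.1 (hlogle ρ hρ) k1) k2
    rw [← sub_div, abs_div, abs_of_pos (by have := hρ.1; positivity : 0 < (1 + ρ) ^ 2),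
      mul_div_assoc']
    gcongr

theorem isLittleO_exp_neg_sqrt (p : ℝ) :
    (fun γ : ℝ => Real.exp (-(√γ / 2))) =o[atTop] fun γ => (γ ^ (-p)) ^ 2 := by
  have h := (isLittleO_exp_neg_mul_rpow_atTop (a := 1 / 2) (by norm_num) (-(4 * p))).comp_tendsto
    Real.tendsto_sqrt_atTop
  refine (h.congr_left fun γ => ?_).congr' EventuallyEq.rfl
    ((eventually_gt_atTop 0).mono fun γ hγ => ?_)
  · simp only [Function.comp]
    ring_nf
  · simp only [Function.comp]
    rw [Real.sqrt_eq_rpow, ← Real.rpow_mul hγ.le, ← Real.rpow_natCast, ← Real.rpow_mul hγ.le]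
    congr 1
    push_cast
    ring

theorem secondOrder_relMass {p C CW : ℝ} (q : ℝ) {W AW qW μ lam rbar : ℝ → ℝ} {B : ℝ → ℝ → ℝ}
    (hp : 1 < p) (hC : 0 < C) (hWs : FluxSol 1 W AW qW) (hW0 : W 0 = 0)
    (hqW : ∀ ρ, 0 ≤ ρ → qW ρ = -(2 * W ρ + 4 * (p - 1) / p ^ 3 * F₁ p ρ) / (1 + ρ) ^ 2)
    (hWg : ∀ ρ, 0 ≤ ρ → (1 + ρ) * |AW ρ| ≤ CW ∧ |W ρ| ≤ CW * Real.log (1 + ρ))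
    (hs : IsScaling p μ lam rbar)
    (hB : ∀ᶠ γ in atTop, IsCorrected p W C γ (μ γ) (rbar γ) (B γ))
    (ht : ∀ᶠ γ in atTop, tlog (μ γ) (rbar γ) = √γ) :
    SecondOrder atTop (fun γ => γ ^ (-p)) (fun γ => relMass p q (lam γ) γ (B γ) (rbar γ))
      (massCoeff₁ p q) (massCoeff₂ p q) := by
  obtain ⟨K, hK, hexp⟩ := exists_uniform_expansion hp q fun ρ hρ => (hWg ρ hρ).2
  obtain ⟨K', hK', hgr⟩ := exists_coeff_growth p q fun ρ hρ => (hWg ρ hρ).2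
  have hε0 : Tendsto (fun γ : ℝ => γ ^ (-p)) atTop (𝓝 0) :=
    tendsto_rpow_neg_atTop (by linarith)
  have hε3 : (fun γ : ℝ => (γ ^ (-p)) ^ 3) =o[atTop] fun γ => (γ ^ (-p)) ^ 2 := by
    simpa [pow_succ' _ 2] using ((isLittleO_one_iff ℝ).2 hε0).mul_isBigO
      (isBigO_refl (fun γ : ℝ => (γ ^ (-p)) ^ 2) atTop)
  have hR : (fun γ : ℝ => 2 * ((K + p * C) * (γ ^ (-p)) ^ 3)
      + 2 * (1 + 2 * K') * Real.exp (-(√γ / 2))) =o[atTop] fun γ => (γ ^ (-p)) ^ 2 :=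
    ((hε3.const_mul_left _).const_mul_left _).add ((isLittleO_exp_neg_sqrt p).const_mul_left _)
  refine IsBigO.trans_isLittleO (IsBigO.of_bound 1 ?_) hR
  filter_upwards [hexp, eventually_profileArg_small hp (fun ρ hρ => (hWg ρ hρ).2), hs.μ_pos,
    hs.lam_eq, hs.rbar_pos, hB, ht, eventually_ge_atTop 1] with γ h1 h2 h3 h4 h5 h6 h7 h8
  have h := relMass_near hp h8 h3 h5 hC hK.le h4 hWs (hasImproperIntegral_coeff₁ q)
    (hasImproperIntegral_coeff₂ q (by linarith) hWs hW0 hqW hWg) hgr h7.le h1 h2 h6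
  -- The hypothesis `t(r̄) = √γ` enters here: the tail is `e^(-√γ/2)`, negligible against `ε²`.
  have h9 : (√(1 + rbar γ ^ 2 / μ γ ^ 2))⁻¹ = Real.exp (-(√γ / 2)) := by
    have h10 : 1 + rbar γ ^ 2 / μ γ ^ 2 = Real.exp (√γ) := by
      rw [← h7, tlog, Real.exp_log (by positivity)]
    rw [h10, ← Real.exp_half, Real.exp_neg]
  rw [h9] at h
  rw [one_mul, Real.norm_eq_abs, Real.norm_eq_abs]
  exact h.trans (le_abs_self _)

/-! ### The masses in closed form -/

theorem rpow_two_mul_eq {p γ : ℝ} (hγ : 0 < γ) : γ ^ (2 * p) = ((γ ^ (-p)) ^ 2)⁻¹ := by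
  simpa using rpow_nat_mul_eq (p := p) hγ 2

theorem weightedMass_eq {p lam γ r : ℝ} {b : ℝ → ℝ} (hγ : 0 < γ) :
    weightedMass p lam b r = 4 * Real.pi * γ ^ (2 - p) * relMass p p lam γ b r := by
  have h : (γ * γ ^ (-p)) ^ 2 * γ ^ p = γ ^ (2 - p) := by
    rw [Real.rpow_sub hγ, Real.rpow_neg hγ.le, Real.rpow_two]
    have : 0 < γ ^ p := by positivity
    field_simp
  have h' : 0 < γ ^ (2 - p) := by positivity
  have hpi := Real.pi_pos
  rw [weightedMass, relMass, h]
  field_simp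

theorem mass_eq {p lam γ r : ℝ} {b : ℝ → ℝ} (hγ : 0 < γ) :
    mass p lam b r = 4 * Real.pi / γ ^ (2 * (p - 1)) * relMass p 0 lam γ b r := by
  have h : (γ * γ ^ (-p)) ^ 2 * γ ^ (0 : ℝ) = (γ ^ (2 * (p - 1)))⁻¹ := by
    rw [Real.rpow_zero, mul_one, show 2 * (p - 1) = 2 * p - 2 by ring, Real.rpow_sub hγ,
      rpow_two_mul_eq hγ, Real.rpow_two]
    have : 0 < γ ^ (-p) := by positivity
    field_simp
  have h' : 0 < γ ^ (2 * (p - 1)) := by positivity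
  have hpi := Real.pi_pos
  rw [mass, relMass, h]
  simp only [Real.rpow_zero, one_mul]
  field_simp

theorem isLittleO_of_secondOrder {p a b : ℝ} {f I g : ℝ → ℝ}
    (h : SecondOrder atTop (fun γ : ℝ => γ ^ (-p)) I a b)
    (hf : ∀ᶠ γ in atTop, f γ - g γ = I γ - (1 + γ ^ (-p) * a + (γ ^ (-p)) ^ 2 * b)) :
    (fun γ => f γ - g γ) =o[atTop] fun γ : ℝ => 1 / γ ^ (2 * p) := by
  refine h.congr' (hf.mono fun γ hγ => hγ.symm) ((eventually_gt_atTop 0).mono fun γ hγ => ?_)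
  beta_reduce
  rw [rpow_two_mul_eq hγ, one_div, inv_inv]

section Masses

variable {p : ℝ} {lam rbar : ℝ → ℝ} {B : ℝ → ℝ → ℝ}

theorem weightedMass_expansion (hp : 1 < p)
    (h : SecondOrder atTop (fun γ => γ ^ (-p)) (fun γ => relMass p p (lam γ) γ (B γ) (rbar γ))
      (massCoeff₁ p p) (massCoeff₂ p p)) :
    (fun γ : ℝ => weightedMass p (lam γ) (B γ) (rbar γ)
          / (4 * Real.pi * γ ^ (2 - p))
        - (1 + 2 * (p - 2) / (p * γ ^ p)
          + (p - 1) / (p ^ 2 * γ ^ (2 * p)) *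
            (-8 - 2 * Real.pi ^ 2 / 3 + 2 * (p - 1) * (Real.pi ^ 2 / 3 + 33 / 2)
              + 3 * (p - 2) - 7 * (4 * p - 5))))
      =o[atTop] fun γ : ℝ => 1 / γ ^ (2 * p) := by
  refine isLittleO_of_secondOrder h ((eventually_gt_atTop 0).mono fun γ hγ => ?_)
  have hε : 0 < γ ^ (-p) := by positivity
  have h1 : 0 < γ ^ (2 - p) := by positivity
  have hpi := Real.pi_pos
  have e1 : γ ^ p = (γ ^ (-p))⁻¹ := by rw [Real.rpow_neg hγ.le, inv_inv]
  rw [weightedMass_eq hγ, rpow_two_mul_eq hγ, e1, mul_div_cancel_left₀ _ (by positivity)]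
  congr 1
  rw [massCoeff₁, massCoeff₂]
  field_simp
  ring

theorem mass_expansion (hp : 1 < p)
    (h : SecondOrder atTop (fun γ => γ ^ (-p)) (fun γ => relMass p 0 (lam γ) γ (B γ) (rbar γ))
      (massCoeff₁ p 0) (massCoeff₂ p 0)) :
    (fun γ : ℝ => mass p (lam γ) (B γ) (rbar γ)
          / (4 * Real.pi / γ ^ (2 * (p - 1)))
        - (1 + 4 * (p - 1) / (p * γ ^ p)
          + 1 / γ ^ (2 * p) *
            (2 * (p - 1) / p ^ 2 *
                ((p - 1) * (Real.pi ^ 2 / 3 + 33 / 2) + 3 / 2 * (p - 2)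
                  - 7 * (4 * p - 5) / 2)
              + 4 * (p - 1) / p
              + (p - 1) ^ 2 / p ^ 2 * (8 + 2 * Real.pi ^ 2 / 3))))
      =o[atTop] fun γ : ℝ => 1 / γ ^ (2 * p) := by
  refine isLittleO_of_secondOrder h ((eventually_gt_atTop 0).mono fun γ hγ => ?_)
  have hε : 0 < γ ^ (-p) := by positivity
  have h1 : 0 < γ ^ (2 * (p - 1)) := by positivity
  have hpi := Real.pi_pos
  have e1 : γ ^ p = (γ ^ (-p))⁻¹ := by rw [Real.rpow_neg hγ.le, inv_inv]
  rw [mass_eq hγ, rpow_two_mul_eq (p := p) hγ, e1, mul_div_cancel_left₀ _ (by positivity)]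
  congr 1
  rw [massCoeff₁, massCoeff₂]
  field_simp
  ring

/-- The exponents add up to `1`, which leaves one factor `4π`, and they balance the powers of `γ`.
The first order terms `4(p-1)/p` and `2(p-2)/p` cancel under the same weights. -/
theorem mass_product_expansion (hp : 1 < p)
    (h0 : SecondOrder atTop (fun γ => γ ^ (-p)) (fun γ => relMass p 0 (lam γ) γ (B γ) (rbar γ))
      (massCoeff₁ p 0) (massCoeff₂ p 0))
    (hp' : SecondOrder atTop (fun γ => γ ^ (-p)) (fun γ => relMass p p (lam γ) γ (B γ) (rbar γ))
      (massCoeff₁ p p) (massCoeff₂ p p)) :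
    (fun γ : ℝ => mass p (lam γ) (B γ) (rbar γ) ^ ((2 - p) / p)
          * weightedMass p (lam γ) (B γ) (rbar γ) ^ (2 * (p - 1) / p)
          / (4 * Real.pi)
        - (1 + 4 * (p - 1) / (p ^ 2 * γ ^ (2 * p))))
      =o[atTop] fun γ : ℝ => 1 / γ ^ (2 * p) := by
  have hε0 : Tendsto (fun γ : ℝ => γ ^ (-p)) atTop (𝓝 0) :=
    tendsto_rpow_neg_atTop (by linarith)
  have hpos : ∀ {I : ℝ → ℝ} {a b : ℝ}, SecondOrder atTop (fun γ : ℝ => γ ^ (-p)) I a b →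
      ∀ᶠ γ in atTop, 0 < I γ := fun {I a b} hI => by
    have := (hI.sub_one_isBigO hε0).trans_tendsto hε0
    filter_upwards [this.eventually_const_lt (by norm_num : (-1 : ℝ) < 0)] with γ hγ
    linarith
  refine isLittleO_of_secondOrder ((h0.rpow hε0 ((2 - p) / p)).mul
    (hp'.rpow hε0 (2 * (p - 1) / p)) hε0) ?_
  filter_upwards [eventually_gt_atTop 0, hpos h0, hpos hp'] with γ hγ hI hJ
  have hε : 0 < γ ^ (-p) := by positivity
  have hpi := Real.pi_pos
  have hexp : (2 - p) / p + 2 * (p - 1) / p = 1 := by field_simp; ring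
  have hfac : (4 * Real.pi / γ ^ (2 * (p - 1))) ^ ((2 - p) / p)
      * (4 * Real.pi * γ ^ (2 - p)) ^ (2 * (p - 1) / p) = 4 * Real.pi := by
    rw [Real.div_rpow (by positivity) (by positivity),
      Real.mul_rpow (x := 4 * Real.pi) (by positivity) (by positivity), ← Real.rpow_mul hγ.le, ← Real.rpow_mul hγ.le,
      show (2 - p) * (2 * (p - 1) / p) = 2 * (p - 1) * ((2 - p) / p) by ring]
    have h1 : 0 < γ ^ (2 * (p - 1) * ((2 - p) / p)) := by positivity
    have h2 : (4 * Real.pi) ^ ((2 - p) / p) * (4 * Real.pi) ^ (2 * (p - 1) / p)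
        = 4 * Real.pi := by
      rw [← Real.rpow_add (by positivity), hexp, Real.rpow_one]
    field_simp
    rw [h2]
  rw [mass_eq hγ, weightedMass_eq hγ, Real.mul_rpow (by positivity) hI.le,
    Real.mul_rpow (by positivity) hJ.le, mul_mul_mul_comm, hfac,
    mul_div_cancel_left₀ _ (by positivity), rpow_two_mul_eq (p := p) hγ]
  congr 1
  rw [massCoeff₁, massCoeff₂, massCoeff₁, massCoeff₂]
  field_simp
  ring

end Masses

end RadialBubble

end

theorem mainTheorem12 (p h₀ : ℝ) (hp₁ : 1 < p) (hp₂ : p ≤ 2) (hh₀ : 0 < h₀) :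
    IsUniqueProfile (fun r => T₀ r ^ 2 - T₀ r) w₀ ∧
    ∃ w₁ : ℝ → ℝ, IsUniqueProfile (fun r => 4 * (p - 1) / p ^ 3 * F p r) w₁ ∧
    ∀ μ lam rbar : ℝ → ℝ,
      (∀ᶠ γ in atTop, 0 < μ γ) →
      (∀ᶠ γ in atTop,
        lam γ * p ^ 2 * γ ^ (2 * (p - 1)) * μ γ ^ 2 * Real.exp (γ ^ p) = 8) →
      (∀ᶠ γ in atTop, 0 < rbar γ) →
      Tendsto (fun γ => μ γ / rbar γ) atTop (𝓝 0) →
      (∀ᶠ γ in atTop, tlog (μ γ) (rbar γ) ≤ Real.sqrt γ) →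
      ((fun γ : ℝ => γ ^ (4 * p) * rbar γ ^ 2) =O[atTop] fun _ => (1 : ℝ)) →
      -- for large `γ` the bubble is well defined beyond radius `rbar γ`, and unique
      (∀ᶠ γ in atTop, ∃ R > rbar γ, ∃ b : ℝ → ℝ, IsBubble p h₀ (lam γ) γ R b ∧
        ∀ (ρ : ℝ) (b' : ℝ → ℝ), IsBubble p h₀ (lam γ) γ ρ b' →
          Set.EqOn b' b (Set.Ico 0 (min ρ R))) ∧
      ∀ (R : ℝ → ℝ) (B : ℝ → ℝ → ℝ),
        (∀ᶠ γ in atTop, rbar γ < R γ ∧ IsBubble p h₀ (lam γ) γ (R γ) (B γ)) →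
        -- pointwise estimates on the remainder and its derivative
        (∃ C : ℝ, ∀ᶠ γ in atTop, ∀ r ∈ Set.Icc 0 (rbar γ),
          |remainder p w₁ γ (μ γ) (B γ) r| ≤ C * (γ ^ (-p) * tlog (μ γ) r) ∧
          |radialDeriv (remainder p w₁ γ (μ γ) (B γ)) r|
            ≤ C * (γ ^ (-p) * radialDeriv (tlog (μ γ)) r)) ∧
        -- expansion of the nonlinearity
        (∃ C : ℝ, ∀ᶠ γ in atTop, ∀ x ∈ Metric.closedBall (0 : Plane) (rbar γ), ∃ θ : ℝ,
          |θ| ≤ C * (Real.exp (tlog (μ γ) ‖x‖ / 2) / γ ^ (3 * p)) ∧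
          lam γ * p * B γ ‖x‖ ^ (p - 1) * Real.exp (B γ ‖x‖ ^ p) =
            -(2 / (p * γ ^ (p - 1))) * lap (tlog (μ γ)) x * (1 + θ)
              + 4 * (p - 1) / (p ^ 2 * γ ^ (2 * p - 1)) * lap (fun r => w₀ (r / μ γ)) x
              + lap (fun r => w₁ (r / μ γ)) x / γ ^ (3 * p - 1)) ∧
        -- integral expansions
        ((∀ᶠ γ in atTop, tlog (μ γ) (rbar γ) = Real.sqrt γ) →
          ((fun γ : ℝ => weightedMass p (lam γ) (B γ) (rbar γ)
                / (4 * Real.pi * γ ^ (2 - p))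
              - (1 + 2 * (p - 2) / (p * γ ^ p)
                + (p - 1) / (p ^ 2 * γ ^ (2 * p)) *
                  (-8 - 2 * Real.pi ^ 2 / 3 + 2 * (p - 1) * (Real.pi ^ 2 / 3 + 33 / 2)
                    + 3 * (p - 2) - 7 * (4 * p - 5))))
            =o[atTop] fun γ : ℝ => 1 / γ ^ (2 * p)) ∧
          ((fun γ : ℝ => mass p (lam γ) (B γ) (rbar γ)
                / (4 * Real.pi / γ ^ (2 * (p - 1)))
              - (1 + 4 * (p - 1) / (p * γ ^ p)
                + 1 / γ ^ (2 * p) *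
                  (2 * (p - 1) / p ^ 2 *
                      ((p - 1) * (Real.pi ^ 2 / 3 + 33 / 2) + 3 / 2 * (p - 2)
                        - 7 * (4 * p - 5) / 2)
                    + 4 * (p - 1) / p
                    + (p - 1) ^ 2 / p ^ 2 * (8 + 2 * Real.pi ^ 2 / 3))))
            =o[atTop] fun γ : ℝ => 1 / γ ^ (2 * p)) ∧
          ((fun γ : ℝ => mass p (lam γ) (B γ) (rbar γ) ^ ((2 - p) / p)
                * weightedMass p (lam γ) (B γ) (rbar γ) ^ (2 * (p - 1) / p)
                / (4 * Real.pi)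
              - (1 + 4 * (p - 1) / (p ^ 2 * γ ^ (2 * p))))
            =o[atTop] fun γ : ℝ => 1 / γ ^ (2 * p))) := by
  have hp0 : 0 < p := by linarith
  obtain ⟨W, AW, qW, hWs, hW0, hqW, CW, -, hWg⟩ := exists_second_profile p (4 * (p - 1) / p ^ 3)
  refine ⟨isUniqueProfile_w₀, fun r => W (r ^ 2), ?_, ?_⟩
  · exact hWs.isUniqueProfile (G := fun ρ => 4 * (p - 1) / p ^ 3 * F₁ p ρ) one_pos hW0 hqW
  intro μ lam rbar hμ hlam hr hrat ht hsm
  have hs : IsScaling p μ lam rbar := ⟨hμ, hlam, hr, hrat, ht, hsm⟩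
  obtain ⟨C, hC, hfam⟩ := exists_bubble_family hp₁ hh₀ hWs hW0 hqW (fun ρ hρ => (hWg ρ hρ).2) hs
  refine ⟨hfam.mono fun γ ⟨w, A, q, _, _, R, hR, hb⟩ => ⟨R, hR, _, hb, fun _ _ hb' =>
    hb.eqOn hb'⟩, fun R B hB => ?_⟩
  -- By uniqueness the given solution coincides with the constructed one on the smaller disc, which
  -- still extends beyond `r̄`.
  have hcor : ∀ᶠ γ in atTop, IsCorrected p W C γ (μ γ) (rbar γ) (B γ) := by
    filter_upwards [hfam, hB] with γ ⟨w, A, q, hw, hest, S, hS, hb⟩ ⟨hR, hbB⟩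
    exact ⟨w, A, q, hw, hest, min (R γ) S, lt_min hR hS, hb.eqOn hbB⟩
  have hgt : ∀ᶠ γ : ℝ in atTop, 0 < γ := eventually_gt_atTop 0
  refine ⟨⟨C, ?_⟩, ?_, fun ht' => ?_⟩
  · filter_upwards [hcor, hμ, hgt] with γ ⟨w, A, q, hw, hest, S, hS, hb⟩ hμ hγ r hr
    exact remainder_bounds hp₁ hγ hw (fun ρ hρ => (hest ρ hρ).2) hr.1
      (by have := hr.1; have := hr.2; gcongr) (hr.2.trans_lt hS) hb
  · obtain ⟨K, -, hexp⟩ := exists_uniform_expansion hp₁ (p - 1) fun ρ hρ => (hWg ρ hρ).2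
    refine ⟨K + p * C, ?_⟩
    filter_upwards [hcor, hμ, hlam, ht, hgt, hexp,
      eventually_profileArg_small hp₁ fun ρ hρ => (hWg ρ hρ).2]
      with γ ⟨w, A, q, hw, hest, S, hS, hb⟩ hμ hlam ht hγ hexp hsmall x hx
    have hx' : ‖x‖ ≤ rbar γ := by simpa using hx
    have hρ0 : 0 ≤ ‖x‖ ^ 2 / μ γ ^ 2 := by positivity
    have hρ : ‖x‖ ^ 2 / μ γ ^ 2 ≤ rbar γ ^ 2 / μ γ ^ 2 := by gcongr
    have hlog : Real.log (1 + ‖x‖ ^ 2 / μ γ ^ 2) ≤ √γ + 1 := by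
      have : Real.log (1 + ‖x‖ ^ 2 / μ γ ^ 2) ≤ tlog (μ γ) (rbar γ) :=
        Real.log_le_log (by linarith) (by linarith)
      linarith
    obtain ⟨h1, -, h2⟩ := hest _ ⟨hρ0, hρ⟩
    exact nonlinearity_expansion hp₁ hγ hμ hC hlam hWs hqW x
      (fun y hy => hexp _ y hρ0 hlog hy) (fun y hy => hsmall _ y hρ0 hlog hy) h1 h2
      (hb ⟨norm_nonneg x, hx'.trans_lt hS⟩)
  · have hM := secondOrder_relMass p hp₁ hC hWs hW0 hqW hWg hs hcor ht'
    have hN := secondOrder_relMass 0 hp₁ hC hWs hW0 hqW hWg hs hcor ht'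
    exact ⟨weightedMass_expansion hp₁ hM, mass_expansion hp₁ hN,
      mass_product_expansion hp₁ hN hM⟩
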